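/- Let $H$ be the hexagonal (honeycomb) lattice, and consider on it the zero-temperature ($J=-\infty$) $q$-state Potts antiferromagnet: the weight of a configuration $\sigma$ with $\sigma_x\in\{1,\dots,q\}$ is the formal product of the factors $1-\delta_{\sigma_x\sigma_y}$ over all edges $xy$. A Gibbs measure is a probability measure whose conditional distribution of the spins in each finite $\Lambda$, given the spins outside $\Lambda$, is proportional to the product of all factors that involve a spin in $\Lambda$. For such a system let $$c_{ij}=\sup\bigl\{d\bigl(\pi_{\{i\}}(\cdot\,|\sigma),\pi_{\{i\}}(\cdot\,|\sigma')\bigr):\ \sigma_k=\sigma'_k\ \text{for all } k\ne j\bigr\},\qquad \alpha=\sup_i\sum_{j\neq i}c_{ij},$$ where $\pi_{\{i\}}(\cdot\,|\sigma)$ is the conditional distribution of the spin at $i$ and $d(p,p')=\sup_A|p(A)-p'(A)|$. We say that the correlations of $\mu$ decay exponentially if there are $C,m>0$ with $$|\mu(fg)-\mu(f)\mu(g)|\le C\sum_{i,j}\delta_i(f)\,e^{-m\,\mathrm{dist}(i,j)}\,\delta_j(g)$$ for all measurable $f,g$ with $\sum_i\delta_i(f)<\infty$ and $\sum_i\delta_i(g)<\infty$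 (such $f$, $g$ and $fg$ being $\mu$-integrable), where $\delta_i(f)$ is the oscillation of $f$ under changes of the spin at $i$ alone. 1. (Decimation of hexagonal clusters.) Let the clusters be the hexagonal faces of $H$ whose coordinates in the triangular lattice of faces are both even. These six-site clusters are pairwise disjoint and no edge of $H$ joins two of them. The remaining sites are pairwise non-adjacent in $H$ and form again a hexagonal lattice $H'$, each of whose faces surrounds exactly one cluster and consists of the six remaining sites adjacent to that cluster. Summing over the spins of a cluster gives an effective weight for the six spins on the surrounding face of $H'$, which is strictly positive for $q\ge3$. For every $q\ge 3$ the decimated system on $H'$ has $c_{ij}=c_{1n}$, $c_{2n}$ or $c_{3n}$ (constants depending only on $q$) when $j$ is a nearest neighbour of $i$ in $H'$, a second neighbour of $i$, or diametrically opposite to $i$ in a face of $H'$, respectively; $c_{ij}=0$ when $i$ and $j$ do not lie on a common face; and $$\alpha=3c_{1n}+6c_{2n}+3c_{3n}.$$ At $q=4$ one has $\alpha<1$, and the decimated system has exactly one Gibbs measure, with exponentially decaying correlations. 2. (Single-site decimation.) Let the clusters be the single sites of one of the two sublattices of $H$. The remaining sites form a triangular lattice, in which the three neighbours of each summed site form one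 of the upward triangles; the effective weight of such a triangle is $q-C(t_1,t_2,t_3)$, where $C$ is the number of distinct colours among $t_1,t_2,t_3$. For every $q\ge4$ the decimated system has $c_{ij}=c_{nn}$ (a constant depending only on $q$) when $i,j$ are nearest neighbours in the triangular lattice, $c_{ij}=0$ for all other $i\ne j$, and $\alpha=6c_{nn}$. For $q\ge 4$, $\alpha<1$ holds if and only if $q\ge5$; and for every $q\ge5$ the decimated system has exactly one Gibbs measure, with exponentially decaying correlations. 3. For every $q\ge4$, the marginal of any Gibbs measure of the zero-temperature Potts antiferromagnet on $H$ on the remaining sites of either decimation is a Gibbs measure of the corresponding decimated system; and the zero-temperature Potts antiferromagnet on $H$ has exactly one Gibbs measure, with exponentially decaying correlations. -/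

import Mathlib

open MeasureTheory Set
open scoped ENNReal

noncomputable section

namespace PottsAF

/-! ### Gibbs measures of lattice spin systems with state space `Fin q`

A system is given by its unnormalised Boltzmann weights `W Λ σ`: the product of all local factors
that involve a spin in the finite volume `Λ`, evaluated at the configuration `σ`. -/

section Gibbs

variable {V : Type} {q : ℕ}

open Classical in
/-- The configuration equal to `τ` inside `Λ` and to `ω` outside `Λ`. -/
def glue (ω : V → Fin q) (Λ : Finset V) (τ : Λ → Fin q) : V → Fin q :=
  fun x => if h : x ∈ Λ then τ ⟨x, h⟩ else ω x

open Classical in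
/-- `π_Λ(τ | ω)`: probability of the configuration `τ` in `Λ` given `ω` outside `Λ`. -/
def kernel (W : Finset V → (V → Fin q) → ℝ) (Λ : Finset V) (ω : V → Fin q) (τ : Λ → Fin q) : ℝ :=
  W Λ (glue ω Λ τ) / ∑ τ' : Λ → Fin q, W Λ (glue ω Λ τ')

/-- The σ-algebra generated by the spins outside `Λ`. -/
abbrev outside (V : Type) (q : ℕ) (Λ : Finset V) : MeasurableSpace (V → Fin q) :=
  MeasurableSpace.comap (fun (σ : V → Fin q) (x : {x : V // x ∉ Λ}) => σ x) inferInstance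

/-- Infinite-volume Gibbs measures: for every finite `Λ`, the conditional distribution of the spins
in `Λ` given the spins outside `Λ` is `π_Λ`. -/
def IsGibbs (W : Finset V → (V → Fin q) → ℝ) (μ : Measure (V → Fin q)) : Prop :=
  IsProbabilityMeasure μ ∧
  ∀ (Λ : Finset V) (τ : Λ → Fin q),
    μ[Set.indicator {σ : V → Fin q | ∀ x : Λ, σ x = τ x} (fun _ => (1 : ℝ)) | outside V q Λ]
      =ᵐ[μ] fun ω => kernel W Λ ω τ

/-- `π_{i}(· | ω)`: conditional distribution of the single spin at `i`. -/
def siteKernel (W : Finset V → (V → Fin q) → ℝ) (i : V) (ω : V → Fin q) (a : Fin q) : ℝ :=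
  kernel W {i} ω (fun _ => a)

/-- `d(p, p') = sup_A |p(A) - p'(A)|` for mass functions `p`, `p'` on `Fin q`. -/
def varDist (p p' : Fin q → ℝ) : ℝ :=
  ⨆ A : Finset (Fin q), |∑ a ∈ A, p a - ∑ a ∈ A, p' a|

/-- Dobrushin's interdependence matrix. -/
def interdependence (W : Finset V → (V → Fin q) → ℝ) (i j : V) : ℝ≥0∞ :=
  ⨆ (σ : V → Fin q) (σ' : V → Fin q) (_ : ∀ k, k ≠ j → σ k = σ' k),
    ENNReal.ofReal (varDist (siteKernel W i σ) (siteKernel W i σ'))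

/-- The Dobrushin constant `α = sup_i ∑_{j ≠ i} c_{ij}`. -/
def dobrushinConstant (W : Finset V → (V → Fin q) → ℝ) : ℝ≥0∞ :=
  ⨆ i : V, ∑' j : {j : V // j ≠ i}, interdependence W i j

/-- The oscillation `δ_i(f)`. -/
def oscillation (f : (V → Fin q) → ℝ) (i : V) : ℝ≥0∞ :=
  ⨆ (σ : V → Fin q) (σ' : V → Fin q) (_ : ∀ k, k ≠ i → σ k = σ' k),
    ENNReal.ofReal |f σ - f σ'|

/-- Exponential decay of correlations with respect to the distance `d` on sites: for all `f`, `g` of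
finite total oscillation, `|μ(fg) - μ(f)μ(g)| ≤ C ∑_{i,j} δ_i(f) exp(-m d(i,j)) δ_j(g)`. -/
def ExponentialDecay (μ : Measure (V → Fin q)) (d : V → V → ℕ) : Prop :=
  ∃ C m : ℝ, 0 < C ∧ 0 < m ∧ ∀ f g : (V → Fin q) → ℝ, Measurable f → Measurable g →
    ∑' i, oscillation f i < ∞ → ∑' i, oscillation g i < ∞ →
    Integrable f μ ∧ Integrable g μ ∧ Integrable (fun σ => f σ * g σ) μ ∧
    ENNReal.ofReal |∫ σ, f σ * g σ ∂μ - (∫ σ, f σ ∂μ) * ∫ σ, g σ ∂μ| ≤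
      ENNReal.ofReal C * ∑' i, ∑' j,
        oscillation f i * ENNReal.ofReal (Real.exp (-m * d i j)) * oscillation g j

/-- There is exactly one Gibbs measure, and its correlations decay exponentially. -/
def UniqueGibbsWithDecay (W : Finset V → (V → Fin q) → ℝ) (d : V → V → ℕ) : Prop :=
  ∃ μ : Measure (V → Fin q), IsGibbs W μ ∧ (∀ μ', IsGibbs W μ' → μ' = μ) ∧ ExponentialDecay μ d

end Gibbs

/-! ### The zero-temperature Potts antiferromagnet and decimation -/

section Potts

variable {V : Type} {q : ℕ}

open Classical in
/-- Boltzmann weight at `J = -∞`: the product of the factors `1 - δ(σ x, σ y)` over all edges `xy`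
with at least one endpoint in `Λ`. -/
def pottsWeight (G : SimpleGraph V) (Λ : Finset V) (σ : V → Fin q) : ℝ :=
  if ∀ x ∈ Λ, ∀ y, G.Adj x y → σ x ≠ σ y then 1 else 0

variable {κ : Type}

/-- The sites that remain after the clusters `cl c` have been summed out. -/
abbrev Remaining (cl : κ → Finset V) : Type := {x : V // ∀ c, x ∉ cl c}

/-- The clusters are pairwise disjoint and no edge joins two different clusters. -/
def NonInteracting (G : SimpleGraph V) (cl : κ → Finset V) : Prop :=
  ∀ c c', c ≠ c' → Disjoint (cl c) (cl c') ∧ ∀ x ∈ cl c, ∀ y ∈ cl c', ¬ G.Adj x y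

/-- The remaining sites adjacent to the cluster `c`. -/
def boundary (G : SimpleGraph V) (cl : κ → Finset V) (c : κ) : Set (Remaining cl) :=
  {y | ∃ x ∈ cl c, G.Adj x y}

open Classical in
/-- Effective weight of the remaining spins `t` obtained by summing over the spins `s` of the
cluster `c`: the sum over `s` of the product of `1 - δ` over all edges meeting the cluster. -/
def effectiveWeight (G : SimpleGraph V) (cl : κ → Finset V) (c : κ)
    (t : Remaining cl → Fin q) : ℝ :=
  ∑ s : (cl c) → Fin q,
    if (∀ x y : (cl c), G.Adj x y → s x ≠ s y) ∧
       (∀ (x : (cl c)) (y : Remaining cl), G.Adj x y → s x ≠ t y) then 1 else 0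

/-- Boltzmann weight of the decimated system: the factors of the edges that survive between
remaining sites, times the effective weights of all clusters that touch `Λ`. -/
def decimatedWeight (G : SimpleGraph V) (cl : κ → Finset V) (Λ : Finset (Remaining cl))
    (t : Remaining cl → Fin q) : ℝ :=
  pottsWeight (G.comap Subtype.val) Λ t *
    ∏ᶠ (c : κ) (_ : ∃ y ∈ Λ, y ∈ boundary G cl c), effectiveWeight G cl c t

/-- Restriction of a configuration to the remaining sites. -/
def restrictRemaining (cl : κ → Finset V) (σ : V → Fin q) : Remaining cl → Fin q :=
  fun x => σ x.1

end Potts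

/-! ### The lattices -/

/-- Sites of the hexagonal lattice: `(p, false)` and `(p, true)` are the two sites of cell `p`. -/
abbrev HexSite : Type := (ℤ × ℤ) × Bool

/-- The hexagonal lattice: `(p, false)` is joined to `(p, true)`, `(p - (1,0), true)` and
`(p - (0,1), true)`. -/
def hexLattice : SimpleGraph HexSite :=
  SimpleGraph.fromRel fun x y => x.2 = false ∧ y.2 = true ∧
    (y.1 = x.1 ∨ y.1 = x.1 - (1, 0) ∨ y.1 = x.1 - (0, 1))

/-- The hexagonal faces; the six sites are listed in cyclic order. -/
def hexFace (p : ℤ × ℤ) : Finset HexSite :=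
  {(p, true), (p + (1, 0), false), (p + (1, 0), true),
    (p + (1, 1), false), (p + (0, 1), true), (p + (0, 1), false)}

/-- The triangular lattice. -/
def triLattice : SimpleGraph (ℤ × ℤ) :=
  SimpleGraph.fromRel fun x y => y = x + (1, 0) ∨ y = x + (0, 1) ∨ y = x + (1, -1)

/-- The upward triangular faces of the triangular lattice. -/
def triFace (p : ℤ × ℤ) : Finset (ℤ × ℤ) := {p, p + (1, 0), p + (0, 1)}

/-- The hexagonal six-spin clusters: every second hexagonal face in both lattice directions. -/
def hexCluster (p : ℤ × ℤ) : Finset HexSite := hexFace (2 * p.1, 2 * p.2)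

/-- The one-site clusters: the sites of one of the two sublattices. -/
def siteCluster (p : ℤ × ℤ) : Finset HexSite := {(p, true)}

/-- Weights of the system after decimation of the hexagonal clusters. -/
abbrev hexDecimated (q : ℕ) :
    Finset (Remaining hexCluster) → (Remaining hexCluster → Fin q) → ℝ :=
  decimatedWeight hexLattice hexCluster

/-- Weights of the system after single-site decimation. -/
abbrev siteDecimated (q : ℕ) :
    Finset (Remaining siteCluster) → (Remaining siteCluster → Fin q) → ℝ :=
  decimatedWeight hexLattice siteCluster

end PottsAF

end

/-! The engine is Dobrushin's comparison method. Replacing a local function `f` by its single-site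
average at `i` kills the oscillation at `i` and passes it on to the other sites `j` with weights
`c_{ij}`. Averaging once at every site of the support therefore multiplies the total oscillation by
at most `α`, and when `α < 1` repeated sweeps make `f` almost constant. A functional `E` whose value
changes by at most `b i * oscillation f i` when `f` is averaged at `i` is then bounded by `∑
oscillation f i * w i` for every `w` with `b + k w ≤ w`, where `k` dominates the matrix `c`
(`ofReal_abs_le_of_sweep`). With `E = μ - ν` and `b = w = 0` this is uniqueness. With `E` the
covariance with `g` and `b` the oscillation of `g`, a multiple of `∑_j e^{-m d(i,j)} δ_j(g)` serves
as `w`, which is exponential decay.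

Decimation is exact. Every edge at a set `Λ` of remaining sites, or at a cluster touching it, meets
exactly one cluster, so averaging a function of the remaining spins over `Λ` and its clusters is
averaging over `Λ` in the decimated system (`avg_thicken`). Marginals of Gibbs measures are thus
Gibbs. Conversely, averaging out the clusters met by the support of a local function leaves a
function of the remaining spins, so Dobrushin's condition for the decimated system yields uniqueness
and decay for the original one (`uniqueGibbsWithDecay_of_decimation`). Existence comes from greedy
colouring (the degree is 3) and compactness. The decay estimate for all functions of finite total
oscillation, not only local ones, uses that uniqueness makes the tail trivial.

It remains to bound `α`. If two single-site laws have all cross ratios `p'(a) p(b) / (p(a) p'(b))`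
bounded, their variation distance is bounded (`varDist_le_of_cross`), and cross ratios of products
of face weights are products of cross ratios of single faces. For single-site clusters and `q ≥ 5`
the face weights are explicit. For hexagonal clusters at `q = 4` they count list colourings of a
six-cycle; the bounds needed are finite checks on a transfer-matrix count. -/

namespace PottsAF

/-! ### Gluing of configurations, local functions and measurability. -/

section Basics

variable {V : Type} {q : ℕ}

theorem glue_apply_mem {ω : V → Fin q} {Λ : Finset V} {τ : Λ → Fin q} {x : V} (h : x ∈ Λ) :
    glue ω Λ τ x = τ ⟨x, h⟩ := by simp [glue, h]

theorem glue_apply_notMem {ω : V → Fin q} {Λ : Finset V} {τ : Λ → Fin q} {x : V} (h : x ∉ Λ) :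
    glue ω Λ τ x = ω x := by simp [glue, h]

theorem glue_self (ω : V → Fin q) (Λ : Finset V) : glue ω Λ (fun x => ω x) = ω := by
  funext x; by_cases h : x ∈ Λ <;> simp [glue, h]

theorem glue_congr {ω ω' : V → Fin q} {Λ : Finset V} (h : ∀ x, x ∉ Λ → ω x = ω' x)
    (τ : Λ → Fin q) : glue ω Λ τ = glue ω' Λ τ := by
  funext x; by_cases hx : x ∈ Λ <;> simp [glue, hx, h]

theorem glue_glue (ω : V → Fin q) (Λ : Finset V) (τ τ' : Λ → Fin q) :
    glue (glue ω Λ τ) Λ τ' = glue ω Λ τ' :=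
  glue_congr (fun _ hx => glue_apply_notMem hx) τ'

theorem measurable_glue (Λ : Finset V) (τ : Λ → Fin q) :
    Measurable fun ω : V → Fin q => glue ω Λ τ := by
  refine measurable_pi_iff.2 fun x => ?_
  by_cases hx : x ∈ Λ
  · simp only [glue, hx, dite_true]; exact measurable_const
  · simp only [glue, hx, dite_false]; exact measurable_pi_apply x

theorem outside_le (Λ : Finset V) :
    outside V q Λ ≤ (inferInstance : MeasurableSpace (V → Fin q)) := by
  refine Measurable.comap_le ?_
  exact measurable_pi_iff.2 fun x => measurable_pi_apply x.1

theorem measurable_glue_outside (Λ : Finset V) (τ : Λ → Fin q) :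
    Measurable[outside V q Λ] fun ω : V → Fin q => glue ω Λ τ := by
  refine @measurable_pi_iff _ _ _ (outside V q Λ) _ _ |>.2 fun x => ?_
  by_cases hx : x ∈ Λ
  · simp only [glue, hx, dite_true]; exact measurable_const
  · simp only [glue, hx, dite_false]
    exact (measurable_pi_apply (X := fun _ : {x : V // x ∉ Λ} => Fin q) ⟨x, hx⟩).comp
      (comap_measurable _)

/-- Freezing the spins of `Λ` does not change `f`, and the freezing map is measurable for the
outside σ-algebra. -/
theorem measurable_outside_of_dependsOn {β : Type} [MeasurableSpace β] {f : (V → Fin q) → β}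
    {Λ : Finset V} (hf : Measurable f) (h : DependsOn f {x | x ∉ Λ}) :
    Measurable[outside V q Λ] f := by
  rcases isEmpty_or_nonempty (V → Fin q) with hE | ⟨⟨η⟩⟩
  · exact fun s _ => by
      have : f ⁻¹' s = ∅ := Set.eq_empty_of_isEmpty _
      rw [this]; exact @MeasurableSet.empty _ (outside V q Λ)
  · have : f = fun ω => f (glue ω Λ fun x => η x) := by
      funext ω
      exact h fun x hx => (glue_apply_notMem hx).symm
    rw [this]
    exact hf.comp (measurable_glue_outside _ _)

theorem dependsOn_of_measurable_outside {β : Type} [MeasurableSpace β] [MeasurableSingletonClass β]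
    {f : (V → Fin q) → β} {Λ : Finset V} (hf : Measurable[outside V q Λ] f) :
    DependsOn f {x | x ∉ Λ} := by
  intro σ σ' h
  have hs : MeasurableSet[outside V q Λ] (f ⁻¹' {f σ'}) := hf (measurableSet_singleton _)
  obtain ⟨t, -, ht⟩ := hs
  have h1 : σ' ∈ f ⁻¹' {f σ'} := rfl
  have h2 : σ ∈ f ⁻¹' {f σ'} := by
    rw [← ht] at h1 ⊢
    have : (fun x : {x : V // x ∉ Λ} => σ x) = fun x : {x : V // x ∉ Λ} => σ' x :=
      funext fun x => h x.1 x.2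
    simpa [this] using h1
  exact h2

theorem measurable_of_dependsOn {β : Type} [MeasurableSpace β] {f : (V → Fin q) → β}
    {S : Finset V} (h : DependsOn f (S : Set V)) : Measurable f := by
  rcases isEmpty_or_nonempty (V → Fin q) with hE | ⟨⟨η⟩⟩
  · exact fun s _ => by
      have : f ⁻¹' s = ∅ := Set.eq_empty_of_isEmpty _
      rw [this]; exact MeasurableSet.empty
  · have : Nonempty β := ⟨f η⟩
    obtain ⟨g, hg⟩ := dependsOn_iff_exists_comp.1 h
    rw [hg]
    refine (measurable_of_finite g).comp ?_
    exact measurable_pi_iff.2 fun x => measurable_pi_apply x.1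

theorem finite_range_of_dependsOn {β : Type} {f : (V → Fin q) → β}
    {S : Finset V} (h : DependsOn f (S : Set V)) : (Set.range f).Finite := by
  rcases isEmpty_or_nonempty (V → Fin q) with hE | ⟨⟨η⟩⟩
  · simp [Set.range_eq_empty]
  · have : Nonempty β := ⟨f η⟩
    obtain ⟨g, hg⟩ := dependsOn_iff_exists_comp.1 h
    rw [hg]
    exact (Set.finite_range g).subset (Set.range_comp_subset_range _ _)

theorem bounded_of_dependsOn {f : (V → Fin q) → ℝ} {S : Finset V}
    (h : DependsOn f (S : Set V)) : ∃ C, ∀ σ, |f σ| ≤ C := by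
  obtain ⟨C, hC⟩ := ((finite_range_of_dependsOn h).image (fun x => |x|)).bddAbove
  exact ⟨C, fun σ => hC ⟨f σ, ⟨σ, rfl⟩, rfl⟩⟩

theorem continuous_of_dependsOn {f : (V → Fin q) → ℝ} {S : Finset V}
    (h : DependsOn f (S : Set V)) : Continuous f := by
  obtain ⟨g, hg⟩ := dependsOn_iff_exists_comp.1 h
  rw [hg]
  refine (continuous_of_discreteTopology (f := g)).comp ?_
  exact continuous_pi fun x => continuous_apply x.1

theorem integrable_of_bounded {μ : Measure (V → Fin q)} [IsFiniteMeasure μ] {f : (V → Fin q) → ℝ}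
    (hf : Measurable f) {C : ℝ} (hC : ∀ σ, |f σ| ≤ C) : Integrable f μ :=
  Integrable.of_bound hf.aestronglyMeasurable C (Filter.Eventually.of_forall hC)

theorem integrable_of_dependsOn {μ : Measure (V → Fin q)} [IsFiniteMeasure μ]
    {f : (V → Fin q) → ℝ} {S : Finset V} (h : DependsOn f (S : Set V)) : Integrable f μ := by
  obtain ⟨C, hC⟩ := bounded_of_dependsOn h
  exact integrable_of_bounded (measurable_of_dependsOn h) hC

theorem dependsOn_glue {β : Type} {f : (V → Fin q) → β} {S : Set V} (h : DependsOn f S)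
    (Λ : Finset V) (τ : Λ → Fin q) : DependsOn (fun ω => f (glue ω Λ τ)) (S \ (Λ : Set V)) := by
  intro σ σ' hσ
  refine h fun x hx => ?_
  by_cases hΛ : x ∈ Λ
  · simp [glue_apply_mem hΛ]
  · rw [glue_apply_notMem hΛ, glue_apply_notMem hΛ]
    exact hσ x ⟨hx, hΛ⟩

theorem measure_ext_of_local [Countable V] {μ ν : Measure (V → Fin q)} [IsProbabilityMeasure μ]
    [IsProbabilityMeasure ν]
    (h : ∀ (f : (V → Fin q) → ℝ) (S : Finset V), DependsOn f (S : Set V) →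
      ∫ σ, f σ ∂μ = ∫ σ, f σ ∂ν) : μ = ν := by
  refine ext_of_generate_finite (measurableCylinders fun _ : V => Fin q)
    generateFrom_measurableCylinders.symm isPiSystem_measurableCylinders (fun s hs => ?_) (by simp)
  obtain ⟨S, T, hT, rfl⟩ := (mem_measurableCylinders _).1 hs
  have hm : MeasurableSet (cylinder S T) := MeasurableSet.cylinder (α := fun _ : V => Fin q) S hT
  have := h ((cylinder S T).indicator fun _ => (1 : ℝ)) S
    (dependsOn_cylinder_indicator_const (α := fun _ : V => Fin q) T 1)
  rw [integral_indicator hm, integral_indicator hm] at this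
  simp only [integral_const, smul_eq_mul, mul_one, measureReal_restrict_apply_univ] at this
  exact (measureReal_eq_measureReal_iff).1 this

end Basics

/-! ### Finite-volume averages and the DLR equations. -/

section Average

variable {V : Type} {q : ℕ}

/-- Every weight depends on finitely many spins. -/
def FiniteRange (W : Finset V → (V → Fin q) → ℝ) : Prop :=
  ∀ Λ, ∃ S : Finset V, DependsOn (W Λ) (S : Set V)

open Classical in
/-- `π_Λ f`, the average of `f` over the spins in `Λ`. -/
noncomputable def avg (W : Finset V → (V → Fin q) → ℝ) (Λ : Finset V) (f : (V → Fin q) → ℝ)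
    (ω : V → Fin q) : ℝ :=
  ∑ τ : Λ → Fin q, kernel W Λ ω τ * f (glue ω Λ τ)

variable {W : Finset V → (V → Fin q) → ℝ}

theorem kernel_congr (W : Finset V → (V → Fin q) → ℝ) {Λ : Finset V} {ω ω' : V → Fin q}
    (h : ∀ x, x ∉ Λ → ω x = ω' x) (τ : Λ → Fin q) : kernel W Λ ω τ = kernel W Λ ω' τ := by
  unfold kernel
  simp only [fun τ => glue_congr h τ]

theorem kernel_nonneg (h0 : ∀ Λ σ, 0 ≤ W Λ σ) (Λ : Finset V) (ω : V → Fin q) (τ : Λ → Fin q) :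
    0 ≤ kernel W Λ ω τ :=
  div_nonneg (h0 _ _) (Finset.sum_nonneg fun _ _ => h0 _ _)

theorem kernel_le_one (h0 : ∀ Λ σ, 0 ≤ W Λ σ) (Λ : Finset V) (ω : V → Fin q) (τ : Λ → Fin q) :
    kernel W Λ ω τ ≤ 1 := by
  classical
  exact div_le_one_of_le₀ (Finset.single_le_sum (f := fun τ => W Λ (glue ω Λ τ))
    (fun _ _ => h0 _ _) (Finset.mem_univ τ)) (Finset.sum_nonneg fun _ _ => h0 _ _)

open Classical in
theorem sum_kernel_eq_one {Λ : Finset V} {ω : V → Fin q}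
    (h : 0 < ∑ τ : Λ → Fin q, W Λ (glue ω Λ τ)) :
    ∑ τ : Λ → Fin q, kernel W Λ ω τ = 1 := by
  unfold kernel
  rw [← Finset.sum_div, div_self h.ne']

theorem avg_congr (W : Finset V → (V → Fin q) → ℝ) (Λ : Finset V) (f : (V → Fin q) → ℝ)
    {ω ω' : V → Fin q} (h : ∀ x, x ∉ Λ → ω x = ω' x) : avg W Λ f ω = avg W Λ f ω' := by
  unfold avg
  simp only [fun τ => glue_congr h τ, fun τ => kernel_congr W h τ]

theorem avg_mul_right (W : Finset V → (V → Fin q) → ℝ) (Λ : Finset V) (f : (V → Fin q) → ℝ)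
    {g : (V → Fin q) → ℝ} (hg : DependsOn g {x | x ∉ Λ}) (ω : V → Fin q) :
    avg W Λ (fun σ => f σ * g σ) ω = avg W Λ f ω * g ω := by
  unfold avg
  rw [Finset.sum_mul]
  refine Finset.sum_congr rfl fun τ _ => ?_
  have := hg (x := glue ω Λ τ) (y := ω) fun x hx => glue_apply_notMem hx
  simp only [this, mul_assoc]

theorem dependsOn_kernel (hW : FiniteRange W) (Λ : Finset V) :
    ∃ S : Finset V, ∀ τ : Λ → Fin q, DependsOn (fun ω => kernel W Λ ω τ) (S : Set V) := by
  obtain ⟨S, hS⟩ := hW Λ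
  refine ⟨S, fun τ σ σ' h => ?_⟩
  have key : ∀ τ : Λ → Fin q, W Λ (glue σ Λ τ) = W Λ (glue σ' Λ τ) := fun τ =>
    dependsOn_glue hS Λ τ fun x hx => h x hx.1
  simp only [kernel, key]

theorem dependsOn_avg (hW : FiniteRange W) (Λ : Finset V) {f : (V → Fin q) → ℝ} {S : Finset V}
    (hf : DependsOn f (S : Set V)) : ∃ S' : Finset V, DependsOn (avg W Λ f) (S' : Set V) := by
  classical
  obtain ⟨T, hT⟩ := dependsOn_kernel hW Λ
  refine ⟨S ∪ T, fun σ σ' h => ?_⟩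
  unfold avg
  refine Finset.sum_congr rfl fun τ _ => ?_
  have h1 := hT τ (x := σ) (y := σ') fun x hx => h x (by simp at hx; simp [hx])
  have h2 := dependsOn_glue hf Λ τ (x := σ) (y := σ') fun x hx => h x (by simp at hx; simp [hx])
  simp only at h1 h2
  rw [h1, h2]

theorem measurable_kernel (hW : FiniteRange W) (Λ : Finset V) (τ : Λ → Fin q) :
    Measurable fun ω => kernel W Λ ω τ := by
  obtain ⟨T, hT⟩ := dependsOn_kernel hW Λ
  exact measurable_of_dependsOn (hT τ)

theorem measurable_kernel_outside (hW : FiniteRange W) (Λ : Finset V) (τ : Λ → Fin q) :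
    Measurable[outside V q Λ] fun ω => kernel W Λ ω τ :=
  measurable_outside_of_dependsOn (measurable_kernel hW Λ τ) fun _ _ h => kernel_congr W h τ

theorem measurable_avg (hW : FiniteRange W) (Λ : Finset V) {f : (V → Fin q) → ℝ}
    (hf : Measurable f) : Measurable (avg W Λ f) := by
  refine Finset.measurable_sum _ fun τ _ => ?_
  exact (measurable_kernel hW Λ τ).mul (hf.comp (measurable_glue Λ τ))

theorem abs_indicator_one_le {α : Type*} (s : Set α) (a : α) :
    |s.indicator (fun _ => (1 : ℝ)) a| ≤ 1 := by
  by_cases h : a ∈ s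
  · rw [Set.indicator_of_mem h, abs_one]
  · rw [Set.indicator_of_notMem h, abs_zero]; exact zero_le_one

theorem measurableSet_eqOn (Λ : Finset V) (τ : Λ → Fin q) :
    MeasurableSet {σ : V → Fin q | ∀ x : Λ, σ x = τ x} := by
  have : {σ : V → Fin q | ∀ x : Λ, σ x = τ x} =
      (fun (σ : V → Fin q) (x : Λ) => σ x) ⁻¹' {τ} := by
    ext σ; simp [funext_iff]
  rw [this]
  exact (measurable_pi_iff.2 fun x => measurable_pi_apply x.1) (measurableSet_singleton τ)

-- Writes `f` as a sum of products of an indicator inside `Λ` and a function of the outside spins,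
-- the shape to which the conditional probabilities of a Gibbs measure apply.
open Classical in
theorem eq_sum_indicator (Λ : Finset V) (f : (V → Fin q) → ℝ) (σ : V → Fin q) :
    f σ = ∑ τ : Λ → Fin q,
      Set.indicator {σ : V → Fin q | ∀ x : Λ, σ x = τ x} (fun _ => (1 : ℝ)) σ *
        f (glue σ Λ τ) := by
  rw [Finset.sum_eq_single (fun x : Λ => σ x)]
  · simp [glue_self]
  · intro τ _ hτ
    rw [Set.indicator_of_notMem, zero_mul]
    exact fun h => hτ (funext fun x => (h x).symm)
  · simp

/-- The DLR equation for bounded measurable functions. -/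
theorem IsGibbs.integral_avg (h0 : ∀ Λ σ, 0 ≤ W Λ σ) (hW : FiniteRange W)
    {μ : Measure (V → Fin q)} (hμ : IsGibbs W μ) (Λ : Finset V) {f : (V → Fin q) → ℝ}
    (hf : Measurable f) {C : ℝ} (hC : ∀ σ, |f σ| ≤ C) :
    ∫ σ, avg W Λ f σ ∂μ = ∫ σ, f σ ∂μ := by
  classical
  have := hμ.1
  have hg : ∀ τ : Λ → Fin q, StronglyMeasurable[outside V q Λ] fun σ => f (glue σ Λ τ) :=
    fun τ => (hf.comp (measurable_glue_outside Λ τ)).stronglyMeasurable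
  have hgm : ∀ τ : Λ → Fin q, Measurable fun σ => f (glue σ Λ τ) :=
    fun τ => hf.comp (measurable_glue Λ τ)
  have hind : ∀ τ : Λ → Fin q, Measurable
      (Set.indicator {σ : V → Fin q | ∀ x : Λ, σ x = τ x} (fun _ => (1 : ℝ))) :=
    fun τ => measurable_const.indicator (measurableSet_eqOn Λ τ)
  have hindle : ∀ (τ : Λ → Fin q) σ,
      |Set.indicator {σ : V → Fin q | ∀ x : Λ, σ x = τ x} (fun _ => (1 : ℝ)) σ| ≤ 1 :=
    fun τ σ => abs_indicator_one_le _ σ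
  have hC0 : ∀ σ : V → Fin q, 0 ≤ C := fun σ => (abs_nonneg _).trans (hC σ)
  have hprod : ∀ τ : Λ → Fin q, Integrable (fun σ =>
      Set.indicator {σ : V → Fin q | ∀ x : Λ, σ x = τ x} (fun _ => (1 : ℝ)) σ *
        f (glue σ Λ τ)) μ := fun τ =>
    integrable_of_bounded ((hind τ).mul (hgm τ)) (C := 1 * C) fun σ => by
      rw [abs_mul]
      exact mul_le_mul (hindle τ σ) (hC _) (abs_nonneg _) zero_le_one
  have hker : ∀ τ : Λ → Fin q, Integrable (fun σ => kernel W Λ σ τ * f (glue σ Λ τ)) μ := fun τ =>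
    integrable_of_bounded ((measurable_kernel hW Λ τ).mul (hgm τ)) (C := 1 * C) fun σ => by
      rw [abs_mul]
      refine mul_le_mul ?_ (hC _) (abs_nonneg _) zero_le_one
      rw [abs_of_nonneg (kernel_nonneg h0 _ _ _)]
      exact kernel_le_one h0 _ _ _
  have key : ∀ τ : Λ → Fin q, ∫ σ, kernel W Λ σ τ * f (glue σ Λ τ) ∂μ =
      ∫ σ, Set.indicator {σ : V → Fin q | ∀ x : Λ, σ x = τ x} (fun _ => (1 : ℝ)) σ *
        f (glue σ Λ τ) ∂μ := by
    intro τ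
    -- The factor `f (glue σ Λ τ)` is measurable outside `Λ`, so it leaves the conditional
    -- expectation, and what remains is the kernel.
    rw [← integral_condExp (outside_le (q := q) Λ) (f := fun σ =>
      Set.indicator {σ : V → Fin q | ∀ x : Λ, σ x = τ x} (fun _ => (1 : ℝ)) σ * f (glue σ Λ τ))]
    refine integral_congr_ae ?_
    have h1 := condExp_mul_of_stronglyMeasurable_right (μ := μ) (hg τ) (hprod τ)
      (integrable_of_bounded (hind τ) (hindle τ))
    refine Filter.EventuallyEq.trans ?_ h1.symm
    filter_upwards [hμ.2 Λ τ] with σ hσ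
    simp only [Pi.mul_apply, hσ]
  calc ∫ σ, avg W Λ f σ ∂μ = ∑ τ : Λ → Fin q, ∫ σ, kernel W Λ σ τ * f (glue σ Λ τ) ∂μ :=
        integral_finsetSum _ fun τ _ => hker τ
    _ = ∑ τ : Λ → Fin q, ∫ σ, Set.indicator {σ : V → Fin q | ∀ x : Λ, σ x = τ x}
        (fun _ => (1 : ℝ)) σ * f (glue σ Λ τ) ∂μ := Finset.sum_congr rfl fun τ _ => key τ
    _ = ∫ σ, f σ ∂μ := by
        rw [← integral_finsetSum _ fun τ _ => hprod τ]
        exact integral_congr_ae (.of_forall fun σ => (eq_sum_indicator Λ f σ).symm)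

theorem IsGibbs.integral_avg_local (h0 : ∀ Λ σ, 0 ≤ W Λ σ) (hW : FiniteRange W)
    {μ : Measure (V → Fin q)} (hμ : IsGibbs W μ) (Λ : Finset V) {f : (V → Fin q) → ℝ}
    {S : Finset V} (hf : DependsOn f (S : Set V)) :
    ∫ σ, avg W Λ f σ ∂μ = ∫ σ, f σ ∂μ := by
  obtain ⟨C, hC⟩ := bounded_of_dependsOn hf
  exact hμ.integral_avg h0 hW Λ (measurable_of_dependsOn hf) hC

open Classical in
/-- The law of the configuration obtained by resampling the spins in `Λ`. -/
noncomputable def resample (W : Finset V → (V → Fin q) → ℝ) (Λ : Finset V)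
    (μ : Measure (V → Fin q)) : Measure (V → Fin q) :=
  ∑ τ : Λ → Fin q, (μ.withDensity fun ω => ENNReal.ofReal (kernel W Λ ω τ)).map
    fun ω => glue ω Λ τ

open Classical in
theorem lintegral_resample (hW : FiniteRange W) (Λ : Finset V) (μ : Measure (V → Fin q))
    {f : (V → Fin q) → ℝ≥0∞} (hf : Measurable f) : ∫⁻ σ, f σ ∂(resample W Λ μ) =
      ∑ τ : Λ → Fin q, ∫⁻ ω, ENNReal.ofReal (kernel W Λ ω τ) * f (glue ω Λ τ) ∂μ := by
  classical
  rw [resample, lintegral_finsetSum_measure]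
  refine Finset.sum_congr (by congr!) fun τ _ => ?_
  rw [lintegral_map hf (measurable_glue Λ τ)]
  exact lintegral_withDensity_eq_lintegral_mul _ (measurable_kernel hW Λ τ).ennreal_ofReal
    (hf.comp (measurable_glue Λ τ))

/-- The hypothesis says that resampling the spins in `Λ` does not change integrals of local
functions. Cylinders form a generating π-system, so the resampled measure is `μ` itself, and the
conditional probabilities can be read off from it. -/
theorem isGibbs_of_local [Countable V] (h0 : ∀ Λ σ, 0 ≤ W Λ σ) (hW : FiniteRange W)
    {μ : Measure (V → Fin q)} [IsProbabilityMeasure μ]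
    (h : ∀ (Λ : Finset V) (f : (V → Fin q) → ℝ) (S : Finset V), DependsOn f (S : Set V) →
      ∫ σ, avg W Λ f σ ∂μ = ∫ σ, f σ ∂μ) : IsGibbs W μ := by
  classical
  refine ⟨inferInstance, fun Λ => ?_⟩
  have hlocal : ∀ (f : (V → Fin q) → ℝ) (S : Finset V), DependsOn f (S : Set V) → (∀ σ, 0 ≤ f σ) →
      ∫⁻ σ, ENNReal.ofReal (f σ) ∂(resample W Λ μ) = ∫⁻ σ, ENNReal.ofReal (f σ) ∂μ := by
    intro f S hf hf0
    rw [lintegral_resample hW Λ μ (measurable_of_dependsOn hf).ennreal_ofReal,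
      ← ofReal_integral_eq_lintegral_ofReal (integrable_of_dependsOn hf) (.of_forall hf0),
      ← h Λ f S hf]
    obtain ⟨S', hS'⟩ := dependsOn_avg hW Λ hf
    rw [ofReal_integral_eq_lintegral_ofReal (integrable_of_dependsOn hS')
      (.of_forall fun σ => Finset.sum_nonneg fun τ _ =>
        mul_nonneg (kernel_nonneg h0 _ _ _) (hf0 _)), ← lintegral_finsetSum]
    · refine lintegral_congr fun ω => ?_
      rw [avg, ENNReal.ofReal_sum_of_nonneg fun τ _ =>
        mul_nonneg (kernel_nonneg h0 _ _ _) (hf0 _)]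
      refine Finset.sum_congr (by congr!) fun τ _ => ?_
      rw [ENNReal.ofReal_mul (kernel_nonneg h0 _ _ _)]
    · exact fun τ _ => (measurable_kernel hW Λ τ).ennreal_ofReal.mul
        ((measurable_of_dependsOn hf).comp (measurable_glue Λ τ)).ennreal_ofReal
  have hprob : IsProbabilityMeasure (resample W Λ μ) := ⟨by
    have := hlocal (fun _ => 1) ∅ (fun _ _ _ => rfl) (fun _ => zero_le_one)
    simpa using this⟩
  have hres : resample W Λ μ = μ := by
    refine ext_of_generate_finite (measurableCylinders fun _ : V => Fin q)
      generateFrom_measurableCylinders.symm isPiSystem_measurableCylinders (fun s hs => ?_) (by simp)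
    obtain ⟨S, T, hT, rfl⟩ := (mem_measurableCylinders _).1 hs
    have hm : MeasurableSet (cylinder S T) := MeasurableSet.cylinder (α := fun _ : V => Fin q) S hT
    have := hlocal ((cylinder S T).indicator fun _ => (1 : ℝ)) S
      (dependsOn_cylinder_indicator_const (α := fun _ : V => Fin q) T 1)
      (fun σ => Set.indicator_nonneg (by simp) σ)
    have e : ∀ (A : Set (V → Fin q)) σ, ENNReal.ofReal (A.indicator (fun _ => (1 : ℝ)) σ) =
        A.indicator (fun _ => (1 : ℝ≥0∞)) σ := fun A σ => by
      by_cases hσ : σ ∈ A <;> simp [hσ]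
    simpa only [e, lintegral_indicator hm, setLIntegral_const, one_mul] using this
  intro τ
  refine (ae_eq_condExp_of_forall_setIntegral_eq (outside_le Λ)
    (integrable_of_bounded (measurable_const.indicator (measurableSet_eqOn Λ τ)) (C := 1)
      fun σ => ?_) (fun s _ _ => (integrable_of_bounded (measurable_kernel hW Λ τ) (C := 1)
        fun σ => ?_).integrableOn) (fun s hs _ => ?_)
    (measurable_kernel_outside hW Λ τ).aestronglyMeasurable).symm
  · exact abs_indicator_one_le _ σ
  · rw [abs_of_nonneg (kernel_nonneg h0 _ _ _)]
    exact kernel_le_one h0 _ _ _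
  have hs' : MeasurableSet s := outside_le Λ s hs
  -- Resampling inside `Λ` neither enters nor leaves an event determined by the outside spins.
  have hsdep : ∀ ω (τ' : Λ → Fin q), glue ω Λ τ' ∈ s ↔ ω ∈ s := by
    intro ω τ'
    have := dependsOn_of_measurable_outside (β := Prop) (f := fun ω => ω ∈ s) (Λ := Λ)
      (@measurableSet_setOfPred _ (outside V q Λ) _ |>.1 hs) (x := glue ω Λ τ') (y := ω)
        fun x hx => glue_apply_notMem hx
    simpa using this
  have hev := measurableSet_eqOn Λ τ
  rw [setIntegral_indicator hev, setIntegral_const, smul_eq_mul, mul_one, measureReal_def]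
  nth_rewrite 2 [← hres]
  rw [← lintegral_indicator_one (hs'.inter hev), lintegral_resample hW Λ μ
    (measurable_one.indicator (hs'.inter hev)), Finset.sum_eq_single τ]
  · rw [integral_eq_lintegral_of_nonneg_ae (.of_forall fun σ => kernel_nonneg h0 _ _ _)
      (measurable_kernel hW Λ τ).aestronglyMeasurable, ← lintegral_indicator hs']
    congr 1
    refine lintegral_congr fun ω => ?_
    by_cases hω : ω ∈ s
    · have : glue ω Λ τ ∈ s ∩ {σ : V → Fin q | ∀ x : Λ, σ x = τ x} :=
        ⟨(hsdep _ _).2 hω, fun x => glue_apply_mem x.2⟩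
      rw [Set.indicator_of_mem hω, Set.indicator_of_mem this]; simp
    · have : glue ω Λ τ ∉ s ∩ {σ : V → Fin q | ∀ x : Λ, σ x = τ x} :=
        fun h => hω ((hsdep _ _).1 h.1)
      rw [Set.indicator_of_notMem hω, Set.indicator_of_notMem this]; simp
  · intro τ' _ hτ'
    refine (lintegral_congr fun ω => ?_).trans lintegral_zero
    have : glue ω Λ τ' ∉ s ∩ {σ : V → Fin q | ∀ x : Λ, σ x = τ x} := fun h =>
      hτ' (funext fun x => by rw [← h.2 x, glue_apply_mem x.2])
    rw [Set.indicator_of_notMem this, mul_zero]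
  · simp

end Average


/-! ### Oscillations of functions. -/

section Oscillation

variable {V : Type} {q : ℕ}

theorem le_oscillation (f : (V → Fin q) → ℝ) {i : V} {σ σ' : V → Fin q}
    (h : ∀ k, k ≠ i → σ k = σ' k) : ENNReal.ofReal |f σ - f σ'| ≤ oscillation f i :=
  le_iSup_of_le σ (le_iSup_of_le σ' (le_iSup_of_le h le_rfl))

theorem oscillation_le {f : (V → Fin q) → ℝ} {i : V} {c : ℝ≥0∞}
    (h : ∀ σ σ' : V → Fin q, (∀ k, k ≠ i → σ k = σ' k) → ENNReal.ofReal |f σ - f σ'| ≤ c) :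
    oscillation f i ≤ c :=
  iSup_le fun σ => iSup_le fun σ' => iSup_le fun hσ => h σ σ' hσ

theorem oscillation_eq_zero {f : (V → Fin q) → ℝ} {S : Set V} (hf : DependsOn f S) {i : V}
    (hi : i ∉ S) : oscillation f i = 0 := by
  refine le_antisymm (oscillation_le fun σ σ' h => ?_) bot_le
  rw [hf fun x hx => h x fun hxi => hi (hxi ▸ hx)]
  simp

/-- The spins in `T` are changed one at a time. -/
theorem ofReal_abs_sub_le_sum_oscillation (f : (V → Fin q) → ℝ) (T : Finset V) :
    ∀ {σ σ' : V → Fin q}, (∀ k, k ∉ T → σ k = σ' k) →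
      ENNReal.ofReal |f σ - f σ'| ≤ ∑ i ∈ T, oscillation f i := by
  classical
  induction T using Finset.induction_on with
  | empty =>
    intro σ σ' h
    have : σ = σ' := funext fun k => h k (by simp)
    simp [this]
  | insert a T ha ih =>
    intro σ σ' h
    have h1 : ENNReal.ofReal |f σ - f (Function.update σ a (σ' a))| ≤ oscillation f a :=
      le_oscillation f fun k hk => by simp [hk]
    have h2 := ih (σ := Function.update σ a (σ' a)) (σ' := σ') fun k hk => by
      by_cases hka : k = a
      · subst hka; simp
      · simp only [Function.update_of_ne hka]; exact h k (by simp [hka, hk])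
    rw [Finset.sum_insert ha]
    calc ENNReal.ofReal |f σ - f σ'|
        ≤ ENNReal.ofReal (|f σ - f (Function.update σ a (σ' a))| +
          |f (Function.update σ a (σ' a)) - f σ'|) :=
          ENNReal.ofReal_le_ofReal (abs_sub_le _ _ _)
      _ ≤ _ := ENNReal.ofReal_add_le.trans (add_le_add h1 h2)

theorem ofReal_abs_sub_le_tsum_oscillation {f : (V → Fin q) → ℝ} {S : Finset V}
    (hf : DependsOn f (S : Set V)) (σ σ' : V → Fin q) :
    ENNReal.ofReal |f σ - f σ'| ≤ ∑' i, oscillation f i := by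
  have h : f σ = f (glue σ' S fun x => σ x) :=
    hf fun x hx => (glue_apply_mem (τ := fun x => σ x) (Finset.mem_coe.1 hx)).symm
  rw [h]
  exact (ofReal_abs_sub_le_sum_oscillation f S fun k hk => glue_apply_notMem hk).trans
    (ENNReal.sum_le_tsum S)

theorem oscillation_lt_top {f : (V → Fin q) → ℝ} {C : ℝ} (hC : ∀ σ, |f σ| ≤ C) (i : V) :
    oscillation f i < ∞ := by
  refine (oscillation_le (c := ENNReal.ofReal (C + C)) fun σ σ' _ =>
    ENNReal.ofReal_le_ofReal ?_).trans_lt ENNReal.ofReal_lt_top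
  exact (abs_sub _ _).trans (add_le_add (hC σ) (hC σ'))

theorem tsum_oscillation_lt_top {f : (V → Fin q) → ℝ} {S : Finset V}
    (hf : DependsOn f (S : Set V)) : ∑' i, oscillation f i < ∞ := by
  obtain ⟨C, hC⟩ := bounded_of_dependsOn hf
  rw [tsum_eq_sum fun i hi => oscillation_eq_zero hf (by simpa using hi)]
  exact ENNReal.sum_lt_top.2 fun i _ => oscillation_lt_top hC i

end Oscillation

/-! ### Variation distance of laws on the colours. -/

section VarDist

variable {q : ℕ}

theorem le_varDist (p p' : Fin q → ℝ) (A : Finset (Fin q)) :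
    |∑ a ∈ A, p a - ∑ a ∈ A, p' a| ≤ varDist p p' :=
  le_ciSup (f := fun A : Finset (Fin q) => |∑ a ∈ A, p a - ∑ a ∈ A, p' a|)
    (Set.finite_range _).bddAbove A

theorem varDist_nonneg (p p' : Fin q → ℝ) : 0 ≤ varDist p p' :=
  (abs_nonneg _).trans (le_varDist p p' ∅)

theorem varDist_comm (p p' : Fin q → ℝ) : varDist p p' = varDist p' p := by
  unfold varDist
  simp only [abs_sub_comm]

/-- As the total masses agree, `f` may be shifted to have minimum zero. Then only the colours with
`p' ≤ p` contribute positively, and their total excess is at most the variation distance. -/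
theorem sum_sub_mul_le_varDist {p p' f : Fin q → ℝ} (hp : ∑ a, p a = ∑ a, p' a) {D : ℝ}
    (hD : ∀ a b, f a - f b ≤ D) : ∑ a, (p a - p' a) * f a ≤ varDist p p' * D := by
  rcases isEmpty_or_nonempty (Fin q) with hE | hE
  · simp only [Finset.univ_eq_empty, Finset.sum_empty]
    have : varDist p p' = 0 := by
      unfold varDist
      simp [Finset.eq_empty_of_isEmpty]
    simp [this]
  obtain ⟨m, -, hm⟩ := Finset.exists_min_image Finset.univ f Finset.univ_nonempty
  have hD0 : 0 ≤ D := by simpa using hD m m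
  have h1 : ∑ a, (p a - p' a) * f a = ∑ a, (p a - p' a) * (f a - f m) := by
    simp only [mul_sub, Finset.sum_sub_distrib, ← Finset.sum_mul, hp, sub_self, zero_mul, sub_zero]
  rw [h1]
  calc ∑ a, (p a - p' a) * (f a - f m)
      ≤ ∑ a ∈ Finset.univ.filter (fun a => p' a ≤ p a), (p a - p' a) * D := by
        rw [Finset.sum_filter]
        refine Finset.sum_le_sum fun a _ => ?_
        have h0 : 0 ≤ f a - f m := sub_nonneg.2 (hm a (Finset.mem_univ a))
        split_ifs with h
        · exact mul_le_mul_of_nonneg_left (hD a m) (sub_nonneg.2 h)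
        · exact mul_nonpos_of_nonpos_of_nonneg (by linarith) h0
    _ ≤ varDist p p' * D := by
        rw [← Finset.sum_mul, Finset.sum_sub_distrib]
        exact mul_le_mul_of_nonneg_right ((le_abs_self _).trans (le_varDist _ _ _)) hD0

theorem abs_sum_sub_mul_le_varDist {p p' f : Fin q → ℝ} (hp : ∑ a, p a = ∑ a, p' a) {D : ℝ}
    (hD : ∀ a b, |f a - f b| ≤ D) : |∑ a, (p a - p' a) * f a| ≤ varDist p p' * D := by
  refine abs_le.2 ⟨?_, sum_sub_mul_le_varDist hp fun a b => (le_abs_self _).trans (hD a b)⟩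
  have := sum_sub_mul_le_varDist (p := p') (p' := p) hp.symm
    fun a b => (le_abs_self _).trans (hD a b)
  rw [varDist_comm] at this
  have h2 : ∑ a, (p a - p' a) * f a = -∑ a, (p' a - p a) * f a := by
    rw [← Finset.sum_neg_distrib]; exact Finset.sum_congr rfl fun a _ => by ring
  rw [h2]; linarith

end VarDist

/-! ### Effect of a single-site average on oscillations. -/

section SingleSite

variable {V : Type} {q : ℕ}

open Classical in
/-- Nonnegative weights of finite range with positive partition functions. -/
structure IsSpec (W : Finset V → (V → Fin q) → ℝ) : Prop where
  nonneg : ∀ Λ σ, 0 ≤ W Λ σ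
  finiteRange : FiniteRange W
  pos : ∀ (Λ : Finset V) (ω : V → Fin q), 0 < ∑ τ : Λ → Fin q, W Λ (glue ω Λ τ)

variable {W : Finset V → (V → Fin q) → ℝ}

open Classical in
theorem IsSpec.sum_kernel (hS : IsSpec W) (Λ : Finset V) (ω : V → Fin q) :
    ∑ τ : Λ → Fin q, kernel W Λ ω τ = 1 := sum_kernel_eq_one (hS.pos Λ ω)

open Classical in
theorem sum_singleton (i : V) (F : (({i} : Finset V) → Fin q) → ℝ) :
    ∑ τ : ({i} : Finset V) → Fin q, F τ = ∑ a, F fun _ => a := by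
  refine (Fintype.sum_bijective (fun (a : Fin q) (_ : ({i} : Finset V)) => a) ⟨?_, ?_⟩ _ _
    fun _ => rfl).symm
  · exact fun a b h => congrFun h ⟨i, by simp⟩
  · intro τ
    refine ⟨τ ⟨i, by simp⟩, ?_⟩
    funext x
    obtain ⟨x, hx⟩ := x
    obtain rfl : x = i := by simpa using hx
    rfl

theorem avg_singleton (i : V) (f : (V → Fin q) → ℝ) (ω : V → Fin q) :
    avg W {i} f ω = ∑ a, siteKernel W i ω a * f (glue ω {i} fun _ => a) := by
  classical
  unfold avg siteKernel
  convert sum_singleton i (fun τ => kernel W {i} ω τ * f (glue ω {i} τ))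

theorem IsSpec.sum_siteKernel (hS : IsSpec W) (i : V) (ω : V → Fin q) :
    ∑ a, siteKernel W i ω a = 1 := by
  classical
  have := hS.sum_kernel {i} ω
  rw [sum_singleton] at this
  exact this

theorem siteKernel_nonneg (hS : IsSpec W) (i : V) (ω : V → Fin q) (a : Fin q) :
    0 ≤ siteKernel W i ω a := kernel_nonneg hS.nonneg _ _ _

theorem le_interdependence (W : Finset V → (V → Fin q) → ℝ) (i : V) {j : V} {σ σ' : V → Fin q}
    (h : ∀ k, k ≠ j → σ k = σ' k) :
    ENNReal.ofReal (varDist (siteKernel W i σ) (siteKernel W i σ')) ≤ interdependence W i j :=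
  le_iSup_of_le σ (le_iSup_of_le σ' (le_iSup_of_le h le_rfl))

theorem interdependence_le {i j : V} {c : ℝ≥0∞}
    (h : ∀ σ σ' : V → Fin q, (∀ k, k ≠ j → σ k = σ' k) →
      ENNReal.ofReal (varDist (siteKernel W i σ) (siteKernel W i σ')) ≤ c) :
    interdependence W i j ≤ c :=
  iSup_le fun σ => iSup_le fun σ' => iSup_le fun hσ => h σ σ' hσ

theorem oscillation_avg_self (i : V) (f : (V → Fin q) → ℝ) :
    oscillation (avg W {i} f) i = 0 :=
  oscillation_eq_zero (S := {x | x ∉ ({i} : Finset V)})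
    (fun _ _ h => avg_congr W {i} f h) (by simp)

/-- Dobrushin's basic estimate. A change of the spin at `j` acts on the integrand, which costs the
oscillation at `j`, and on the law of the spin at `i`, which costs the variation distance times the
oscillation at `i`. -/
theorem oscillation_avg_le (hS : IsSpec W) (i j : V) {f : (V → Fin q) → ℝ}
    {C : ℝ} (hC : ∀ σ, |f σ| ≤ C) :
    oscillation (avg W {i} f) j ≤
      oscillation f j + interdependence W i j * oscillation f i := by
  refine oscillation_le fun ω ω' h => ?_
  have hi := oscillation_lt_top hC i
  have hj := oscillation_lt_top hC j
  have hD : ∀ a b : Fin q, |f (glue ω {i} fun _ => a) - f (glue ω {i} fun _ => b)| ≤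
      (oscillation f i).toReal := by
    intro a b
    refine (ENNReal.ofReal_le_iff_le_toReal hi.ne).1 (le_oscillation f fun k hk => ?_)
    have : k ∉ ({i} : Finset V) := by simpa using hk
    rw [glue_apply_notMem this, glue_apply_notMem this]
  have hD' : ∀ a : Fin q, |f (glue ω {i} fun _ => a) - f (glue ω' {i} fun _ => a)| ≤
      (oscillation f j).toReal := by
    intro a
    refine (ENNReal.ofReal_le_iff_le_toReal hj.ne).1 (le_oscillation f fun k hk => ?_)
    by_cases hki : k ∈ ({i} : Finset V)
    · rw [glue_apply_mem hki, glue_apply_mem hki]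
    · rw [glue_apply_notMem hki, glue_apply_notMem hki, h k hk]
  have e : avg W {i} f ω - avg W {i} f ω' =
      ∑ a, (siteKernel W i ω a - siteKernel W i ω' a) * f (glue ω {i} fun _ => a) +
      ∑ a, siteKernel W i ω' a *
        (f (glue ω {i} fun _ => a) - f (glue ω' {i} fun _ => a)) := by
    rw [avg_singleton, avg_singleton, ← Finset.sum_sub_distrib, ← Finset.sum_add_distrib]
    exact Finset.sum_congr rfl fun a _ => by ring
  have h1 := abs_sum_sub_mul_le_varDist (p := siteKernel W i ω) (p' := siteKernel W i ω')
    (by rw [hS.sum_siteKernel, hS.sum_siteKernel]) hD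
  have h2 : |∑ a, siteKernel W i ω' a *
      (f (glue ω {i} fun _ => a) - f (glue ω' {i} fun _ => a))| ≤ (oscillation f j).toReal := by
    refine (Finset.abs_sum_le_sum_abs _ _).trans ?_
    calc _ ≤ ∑ a, siteKernel W i ω' a * (oscillation f j).toReal := by
          refine Finset.sum_le_sum fun a _ => ?_
          rw [abs_mul, abs_of_nonneg (siteKernel_nonneg hS _ _ _)]
          exact mul_le_mul_of_nonneg_left (hD' a) (siteKernel_nonneg hS _ _ _)
      _ = _ := by rw [← Finset.sum_mul, hS.sum_siteKernel, one_mul]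
  calc ENNReal.ofReal |avg W {i} f ω - avg W {i} f ω'|
      ≤ ENNReal.ofReal ((oscillation f j).toReal +
        varDist (siteKernel W i ω) (siteKernel W i ω') * (oscillation f i).toReal) := by
        refine ENNReal.ofReal_le_ofReal ?_
        rw [e]
        linarith [abs_add_le (∑ a, (siteKernel W i ω a - siteKernel W i ω' a) *
          f (glue ω {i} fun _ => a)) (∑ a, siteKernel W i ω' a *
            (f (glue ω {i} fun _ => a) - f (glue ω' {i} fun _ => a)))]
    _ ≤ _ := by
        refine ENNReal.ofReal_add_le.trans ?_
        rw [ENNReal.ofReal_toReal hj.ne, ENNReal.ofReal_mul (varDist_nonneg _ _),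
          ENNReal.ofReal_toReal hi.ne]
        gcongr
        exact le_interdependence W i h

end SingleSite

/-! ### Sweeps of single-site averages and the comparison bound. -/

section Sweep

variable {V : Type} {q : ℕ} {W : Finset V → (V → Fin q) → ℝ}

/-- The matrix `k` dominates Dobrushin's interdependence matrix off the diagonal, and its row sums
are at most `α`. -/
structure Dominates (W : Finset V → (V → Fin q) → ℝ) (k : V → V → ℝ≥0∞) (α : ℝ≥0∞) : Prop where
  le : ∀ i j, j ≠ i → interdependence W i j ≤ k i j
  sum_le : ∀ i, ∑' j, k i j ≤ α

open Classical in
theorem tsum_update_mul (k : V → V → ℝ≥0∞) (v w : V → ℝ≥0∞) (i : V) :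
    ∑' j, (if j = i then k i i * v i else v j + k i j * v i) * w j =
      ∑' j, (if j = i then 0 else v j * w j) + v i * ∑' j, k i j * w j := by
  rw [← ENNReal.tsum_mul_left, ← ENNReal.tsum_add]
  refine tsum_congr fun j => ?_
  split_ifs with h
  · subst h; ring
  · ring

/-- One pass of averages over the sites of `T`. The bookkeeping is done with upper bounds `v` of the
oscillations, which evolve by an exact linear rule, and `c` collects the changes of `E`. Unvisited
sites still carry at least their original oscillation, which forces a loss of at least `(1 - α) *
oscillation f i` at each visit. Because `b + k w ≤ w`, the quantity `c + ∑ v w` never grows. -/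
theorem exists_sweep (hS : IsSpec W) {k : V → V → ℝ≥0∞} {α : ℝ≥0∞} (hk : Dominates W k α)
    (hα : α ≤ 1) {b w : V → ℝ≥0∞} (hw : ∀ i, b i + ∑' j, k i j * w j ≤ w i)
    {E : ((V → Fin q) → ℝ) → ℝ}
    (hE : ∀ (i : V) (f : (V → Fin q) → ℝ) (S : Finset V), DependsOn f (S : Set V) →
      ENNReal.ofReal |E f| ≤ ENNReal.ofReal |E (avg W {i} f)| + b i * oscillation f i)
    {f : (V → Fin q) → ℝ} {S : Finset V} (hf : DependsOn f (S : Set V)) (T : Finset V) :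
    ∃ (g : (V → Fin q) → ℝ) (S' : Finset V) (v : V → ℝ≥0∞) (c : ℝ≥0∞),
      DependsOn g (S' : Set V) ∧ (∀ i, oscillation g i ≤ v i) ∧
      (∀ i, i ∉ T → oscillation f i ≤ v i) ∧
      ∑' i, v i + (1 - α) * ∑ i ∈ T, oscillation f i ≤ ∑' i, oscillation f i ∧
      ENNReal.ofReal |E f| ≤ ENNReal.ofReal |E g| + c ∧
      c + ∑' i, v i * w i ≤ ∑' i, oscillation f i * w i := by
  classical
  induction T using Finset.induction_on with
  | empty => exact ⟨f, S, oscillation f, 0, hf, fun _ => le_rfl, fun _ _ => le_rfl, by simp,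
      by simp, by simp⟩
  | insert a T ha ih =>
    obtain ⟨g, S', v, c, hg, hgv, hfv, hsum, hEg, hc⟩ := ih
    obtain ⟨S'', hS''⟩ := dependsOn_avg hS.finiteRange {a} hg
    obtain ⟨C, hC⟩ := bounded_of_dependsOn hg
    refine ⟨avg W {a} g, S'', fun j => if j = a then k a a * v a else v j + k a j * v a,
      c + b a * v a, hS'', fun j => ?_, fun j hj => ?_, ?_, ?_, ?_⟩
    · by_cases hja : j = a
      · subst hja; simp [oscillation_avg_self]
      · simp only [hja, if_false]
        refine (oscillation_avg_le hS a j hC).trans ?_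
        gcongr
        · exact hgv j
        · exact hk.le a j hja
        · exact hgv a
    · have hj' : j ≠ a ∧ j ∉ T := by simpa using hj
      simp only [hj'.1, if_false]
      exact (hfv j hj'.2).trans le_self_add
    · have h1 := tsum_update_mul k v (fun _ => 1) a
      simp only [mul_one] at h1
      rw [h1, Finset.sum_insert ha]
      refine le_trans ?_ hsum
      -- The visit to `a` removes `v a` and redistributes at most `α * v a`; the difference pays for
      -- the new term of the sum over `T`.
      rw [ENNReal.tsum_eq_add_tsum_ite (f := v) a]
      calc ∑' j, (if j = a then 0 else v j) + v a * ∑' j, k a j +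
            (1 - α) * (oscillation f a + ∑ i ∈ T, oscillation f i)
          ≤ ∑' j, (if j = a then 0 else v j) + v a * α +
            (1 - α) * (v a + ∑ i ∈ T, oscillation f i) := by
            gcongr
            · exact hk.sum_le a
            · exact hfv a ha
        _ = ∑' j, (if j = a then 0 else v j) + (α + (1 - α)) * v a +
            (1 - α) * ∑ i ∈ T, oscillation f i := by ring
        _ = _ := by rw [add_tsub_cancel_of_le hα, one_mul]; ring
    · refine hEg.trans ?_
      calc ENNReal.ofReal |E g| + c
          ≤ (ENNReal.ofReal |E (avg W {a} g)| + b a * oscillation g a) + c := by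
            gcongr; exact hE a g S' hg
        _ ≤ (ENNReal.ofReal |E (avg W {a} g)| + b a * v a) + c := by
            gcongr; exact hgv a
        _ = _ := by ring
    · refine le_trans ?_ hc
      rw [tsum_update_mul, ENNReal.tsum_eq_add_tsum_ite (f := fun i => v i * w i) a]
      calc c + b a * v a + (∑' j, (if j = a then 0 else v j * w j) + v a * ∑' j, k a j * w j)
          = c + (v a * (b a + ∑' j, k a j * w j) +
            ∑' j, (if j = a then 0 else v j * w j)) := by ring
        _ ≤ _ := by
          gcongr
          exact hw a

/-- After `n` sweeps the total oscillation is at most `α ^ n` times the original one, so by `hEK`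
the value of `E` at the remaining function tends to zero, while the accumulated cost stays below `∑
oscillation f i * w i`. -/
theorem ofReal_abs_le_of_sweep (hS : IsSpec W) {k : V → V → ℝ≥0∞} {α : ℝ≥0∞}
    (hk : Dominates W k α) (hα : α < 1) {b w : V → ℝ≥0∞}
    (hw : ∀ i, b i + ∑' j, k i j * w j ≤ w i) {E : ((V → Fin q) → ℝ) → ℝ}
    (hE : ∀ (i : V) (f : (V → Fin q) → ℝ) (S : Finset V), DependsOn f (S : Set V) →
      ENNReal.ofReal |E f| ≤ ENNReal.ofReal |E (avg W {i} f)| + b i * oscillation f i)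
    {K : ℝ≥0∞} (hK : K ≠ ∞)
    (hEK : ∀ (f : (V → Fin q) → ℝ) (S : Finset V), DependsOn f (S : Set V) →
      ENNReal.ofReal |E f| ≤ K * ∑' i, oscillation f i)
    {f : (V → Fin q) → ℝ} {S : Finset V} (hf : DependsOn f (S : Set V)) :
    ENNReal.ofReal |E f| ≤ ∑' i, oscillation f i * w i := by
  have step : ∀ n : ℕ, ∃ (g : (V → Fin q) → ℝ) (S' : Finset V) (c : ℝ≥0∞),
      DependsOn g (S' : Set V) ∧ ∑' i, oscillation g i ≤ α ^ n * ∑' i, oscillation f i ∧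
      ENNReal.ofReal |E f| ≤ ENNReal.ofReal |E g| + c ∧
      c + ∑' i, oscillation g i * w i ≤ ∑' i, oscillation f i * w i := by
    intro n
    induction n with
    | zero => exact ⟨f, S, 0, hf, by simp, by simp, by simp⟩
    | succ n ih =>
      obtain ⟨g, S', c, hg, hsum, hEg, hc⟩ := ih
      obtain ⟨g', S'', v, c', hg', hgv, -, hsum', hEg', hc'⟩ := exists_sweep hS hk hα.le hw hE hg S'
      refine ⟨g', S'', c + c', hg', ?_, ?_, ?_⟩
      · have hfin := tsum_oscillation_lt_top hg
        -- The sweep runs over the whole support of `g`, so the sum over visited sites is the total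
        -- oscillation; it is finite and can be cancelled, leaving the factor `α`.
        have hsup : ∑' i, oscillation g i = ∑ i ∈ S', oscillation g i :=
          tsum_eq_sum fun i hi => oscillation_eq_zero hg (by simpa using hi)
        rw [← hsup] at hsum'
        have h1 : ∑' i, v i ≤ α * ∑' i, oscillation g i := by
          refine ENNReal.le_of_add_le_add_right
            (a := (1 - α) * ∑' i, oscillation g i) (ENNReal.mul_ne_top (by finiteness) hfin.ne) ?_
          rwa [← add_mul, add_tsub_cancel_of_le hα.le, one_mul]
        calc ∑' i, oscillation g' i ≤ ∑' i, v i := ENNReal.tsum_le_tsum hgv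
          _ ≤ α * ∑' i, oscillation g i := h1
          _ ≤ α * (α ^ n * ∑' i, oscillation f i) := by gcongr
          _ = _ := by ring
      · calc ENNReal.ofReal |E f| ≤ ENNReal.ofReal |E g| + c := hEg
          _ ≤ (ENNReal.ofReal |E g'| + c') + c := by gcongr
          _ = _ := by ring
      · calc c + c' + ∑' i, oscillation g' i * w i
            ≤ c + (c' + ∑' i, v i * w i) := by
              rw [add_assoc]
              gcongr with i
              exact hgv i
          _ ≤ c + ∑' i, oscillation g i * w i := by gcongr
          _ ≤ _ := hc
  have hfin := tsum_oscillation_lt_top hf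
  have hlim : Filter.Tendsto (fun n : ℕ => K * (α ^ n * ∑' i, oscillation f i) +
      ∑' i, oscillation f i * w i) Filter.atTop
      (nhds (K * (0 * ∑' i, oscillation f i) + ∑' i, oscillation f i * w i)) := by
    refine Filter.Tendsto.add ?_ tendsto_const_nhds
    refine ENNReal.Tendsto.const_mul ?_ (Or.inr hK)
    exact ENNReal.Tendsto.mul_const (ENNReal.tendsto_pow_atTop_nhds_zero_of_lt_one hα)
      (Or.inr hfin.ne)
  rw [zero_mul, mul_zero, zero_add] at hlim
  refine ge_of_tendsto' hlim fun n => ?_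
  obtain ⟨g, S', c, hg, hsum, hEg, hc⟩ := step n
  calc ENNReal.ofReal |E f| ≤ ENNReal.ofReal |E g| + c := hEg
    _ ≤ K * ∑' i, oscillation g i + c := by gcongr; exact hEK g S' hg
    _ ≤ _ := by
      gcongr
      exact le_self_add.trans hc

end Sweep


/-! ### Uniqueness and covariance bounds from sweeps. -/

section Covariance

variable {V : Type} {q : ℕ} {W : Finset V → (V → Fin q) → ℝ} {μ : Measure (V → Fin q)}

theorem dependsOn_mul {f g : (V → Fin q) → ℝ} {S T : Set V} (hf : DependsOn f S)
    (hg : DependsOn g T) : DependsOn (fun σ => f σ * g σ) (S ∪ T) := fun _ _ h => by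
  simp only [hf fun x hx => h x (Or.inl hx), hg fun x hx => h x (Or.inr hx)]

/-- The covariance `μ(fg) - μ(f)μ(g)`. -/
noncomputable def cov (μ : Measure (V → Fin q)) (f g : (V → Fin q) → ℝ) : ℝ :=
  ∫ σ, f σ * g σ ∂μ - (∫ σ, f σ ∂μ) * ∫ σ, g σ ∂μ

theorem abs_integral_le_of_abs_le [IsProbabilityMeasure μ] {f : (V → Fin q) → ℝ} {C : ℝ}
    (h : ∀ᵐ σ ∂μ, |f σ| ≤ C) : |∫ σ, f σ ∂μ| ≤ C := by
  have := norm_integral_le_of_norm_le_const (μ := μ) (f := f) (C := C) h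
  simpa using this

theorem abs_sub_le_toReal_tsum {f : (V → Fin q) → ℝ} {S : Finset V}
    (hf : DependsOn f (S : Set V)) (σ σ' : V → Fin q) :
    |f σ - f σ'| ≤ (∑' i, oscillation f i).toReal :=
  (ENNReal.ofReal_le_iff_le_toReal (tsum_oscillation_lt_top hf).ne).1
    (ofReal_abs_sub_le_tsum_oscillation hf σ σ')

theorem nonempty_config [IsProbabilityMeasure μ] : Nonempty (V → Fin q) :=
  μ.nonempty_of_neZero

theorem ofReal_abs_integral_sub_le {ν : Measure (V → Fin q)} [IsProbabilityMeasure μ]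
    [IsProbabilityMeasure ν] {f : (V → Fin q) → ℝ} {S : Finset V} (hf : DependsOn f (S : Set V)) :
    ENNReal.ofReal |∫ σ, f σ ∂μ - ∫ σ, f σ ∂ν| ≤ 2 * ∑' i, oscillation f i := by
  obtain ⟨σ₀⟩ := nonempty_config (μ := μ)
  have h1 : ∀ (ρ : Measure (V → Fin q)) [IsProbabilityMeasure ρ],
      |∫ σ, f σ ∂ρ - f σ₀| ≤ (∑' i, oscillation f i).toReal := by
    intro ρ _
    have : ∫ σ, f σ ∂ρ - f σ₀ = ∫ σ, (f σ - f σ₀) ∂ρ := by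
      rw [integral_sub (integrable_of_dependsOn hf) (integrable_const _)]; simp
    rw [this]
    exact abs_integral_le_of_abs_le (.of_forall fun σ => abs_sub_le_toReal_tsum hf σ σ₀)
  refine (ENNReal.ofReal_le_iff_le_toReal
    (ENNReal.mul_ne_top (by simp) (tsum_oscillation_lt_top hf).ne)).2 ?_
  rw [ENNReal.toReal_mul]
  have h2 := h1 μ
  have h3 := h1 ν
  simp only [ENNReal.toReal_ofNat]
  rw [abs_le] at *
  constructor <;> linarith

theorem exists_ofReal_abs_cov_le [IsProbabilityMeasure μ] {g : (V → Fin q) → ℝ} {T : Finset V}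
    (hg : DependsOn g (T : Set V)) : ∃ K : ℝ≥0∞, K ≠ ∞ ∧ ∀ (f : (V → Fin q) → ℝ) (S : Finset V),
      DependsOn f (S : Set V) → ENNReal.ofReal |cov μ f g| ≤ K * ∑' i, oscillation f i := by
  obtain ⟨C, hC⟩ := bounded_of_dependsOn hg
  obtain ⟨σ₀⟩ := nonempty_config (μ := μ)
  have hC0 : 0 ≤ C := (abs_nonneg _).trans (hC σ₀)
  refine ⟨ENNReal.ofReal (2 * C), ENNReal.ofReal_ne_top, fun f S hf => ?_⟩
  set D := (∑' i, oscillation f i).toReal with hD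
  have hD0 : 0 ≤ D := ENNReal.toReal_nonneg
  have hfi : Integrable f μ := integrable_of_dependsOn hf
  have hgi : Integrable g μ := integrable_of_dependsOn hg
  have hfg : Integrable (fun σ => f σ * g σ) μ := by
    classical
    refine integrable_of_dependsOn (S := S ∪ T) ?_
    rw [Finset.coe_union]; exact dependsOn_mul hf hg
  have e : cov μ f g = ∫ σ, (f σ - f σ₀) * g σ ∂μ -
      (∫ σ, (f σ - f σ₀) ∂μ) * ∫ σ, g σ ∂μ := by
    rw [integral_sub hfi (integrable_const _)]
    simp only [sub_mul]
    rw [integral_sub hfg (hgi.const_mul _), integral_const_mul]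
    simp [cov]
  have h1 : |∫ σ, (f σ - f σ₀) * g σ ∂μ| ≤ D * C :=
    abs_integral_le_of_abs_le (.of_forall fun σ => by
      rw [abs_mul]
      exact mul_le_mul (abs_sub_le_toReal_tsum hf _ _) (hC σ) (abs_nonneg _) hD0)
  have h2 : |(∫ σ, (f σ - f σ₀) ∂μ) * ∫ σ, g σ ∂μ| ≤ D * C := by
    rw [abs_mul]
    exact mul_le_mul (abs_integral_le_of_abs_le
      (.of_forall fun σ => abs_sub_le_toReal_tsum hf _ _))
      (abs_integral_le_of_abs_le (.of_forall hC)) (abs_nonneg _) hD0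
  have h3 : |cov μ f g| ≤ 2 * C * D := by
    rw [e]
    refine (abs_sub _ _).trans ?_
    linarith
  calc ENNReal.ofReal |cov μ f g| ≤ ENNReal.ofReal (2 * C * D) := ENNReal.ofReal_le_ofReal h3
    _ = _ := by
      rw [ENNReal.ofReal_mul (by positivity), hD,
        ENNReal.ofReal_toReal (tsum_oscillation_lt_top hf).ne]

theorem abs_sub_avg_le (hS : IsSpec W) (Λ : Finset V) {f : (V → Fin q) → ℝ} {C : ℝ}
    (hC : ∀ σ, |f σ| ≤ C) (σ : V → Fin q) :
    |f σ - avg W Λ f σ| ≤ (∑ i ∈ Λ, oscillation f i).toReal := by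
  classical
  have hfin : ∑ i ∈ Λ, oscillation f i ≠ ∞ :=
    (ENNReal.sum_lt_top.2 fun i _ => oscillation_lt_top hC i).ne
  have e : f σ - avg W Λ f σ = ∑ τ : Λ → Fin q, kernel W Λ σ τ * (f σ - f (glue σ Λ τ)) := by
    unfold avg
    simp only [mul_sub, Finset.sum_sub_distrib, ← Finset.sum_mul]
    rw [hS.sum_kernel, one_mul]
  rw [e]
  refine (Finset.abs_sum_le_sum_abs _ _).trans ?_
  calc _ ≤ ∑ τ : Λ → Fin q, kernel W Λ σ τ * (∑ i ∈ Λ, oscillation f i).toReal := by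
        refine Finset.sum_le_sum fun τ _ => ?_
        rw [abs_mul, abs_of_nonneg (kernel_nonneg hS.nonneg _ _ _)]
        refine mul_le_mul_of_nonneg_left ?_ (kernel_nonneg hS.nonneg _ _ _)
        exact (ENNReal.ofReal_le_iff_le_toReal hfin).1
          (ofReal_abs_sub_le_sum_oscillation f Λ fun k hk => (glue_apply_notMem hk).symm)
    _ = _ := by rw [← Finset.sum_mul, hS.sum_kernel, one_mul]

/-- The function `f - avg W Λ f` integrates to zero against every function of the outside spins. So
`g` may be replaced by its difference from `g'`, the same function with the spins of `Λ` frozen, and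
both factors are bounded by oscillations over `Λ`. -/
theorem ofReal_abs_cov_le_avg (hS : IsSpec W) (hμ : IsGibbs W μ) (Λ : Finset V)
    {f g : (V → Fin q) → ℝ} {S T : Finset V} (hf : DependsOn f (S : Set V))
    (hg : DependsOn g (T : Set V)) :
    ENNReal.ofReal |cov μ f g| ≤ ENNReal.ofReal |cov μ (avg W Λ f) g| +
      (∑ i ∈ Λ, oscillation g i) * ∑ i ∈ Λ, oscillation f i := by
  classical
  have := hμ.1
  obtain ⟨η⟩ := nonempty_config (μ := μ)
  obtain ⟨C, hC⟩ := bounded_of_dependsOn hf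
  obtain ⟨C', hC'⟩ := bounded_of_dependsOn hg
  obtain ⟨S', hS'⟩ := dependsOn_avg hS.finiteRange Λ hf
  set g' : (V → Fin q) → ℝ := fun σ => g (glue σ Λ fun x => η x) with hg'
  have hg'd : DependsOn g' (T : Set V) := (dependsOn_glue hg Λ _).mono Set.sdiff_subset
  have hg'out : DependsOn g' {x | x ∉ Λ} := fun σ σ' h => by
    simp only [hg', glue_congr h]
  have int : ∀ {u v : (V → Fin q) → ℝ} {A B : Finset V}, DependsOn u (A : Set V) →
      DependsOn v (B : Set V) → Integrable (fun σ => u σ * v σ) μ := by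
    intro u v A B hu hv
    refine integrable_of_dependsOn (S := A ∪ B) ?_
    rw [Finset.coe_union]; exact dependsOn_mul hu hv
  have hF : ∑ i ∈ Λ, oscillation f i ≠ ∞ :=
    (ENNReal.sum_lt_top.2 fun i _ => oscillation_lt_top hC i).ne
  have hG : ∑ i ∈ Λ, oscillation g i ≠ ∞ :=
    (ENNReal.sum_lt_top.2 fun i _ => oscillation_lt_top hC' i).ne
  have h1 : ∫ σ, avg W Λ f σ ∂μ = ∫ σ, f σ ∂μ :=
    hμ.integral_avg_local hS.nonneg hS.finiteRange Λ hf
  have h2 : ∫ σ, f σ * g' σ ∂μ = ∫ σ, avg W Λ f σ * g' σ ∂μ := by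
    rw [← hμ.integral_avg_local hS.nonneg hS.finiteRange Λ (f := fun σ => f σ * g' σ) (S := S ∪ T)
      (by rw [Finset.coe_union]; exact dependsOn_mul hf hg'd)]
    simp only [avg_mul_right W Λ f hg'out]
  have h3 : cov μ f g - cov μ (avg W Λ f) g =
      ∫ σ, (f σ - avg W Λ f σ) * (g σ - g' σ) ∂μ := by
    have e : ∀ σ, (f σ - avg W Λ f σ) * (g σ - g' σ) =
        (f σ * g σ - avg W Λ f σ * g σ) - (f σ * g' σ - avg W Λ f σ * g' σ) := fun σ => by ring
    simp only [e]
    have i1 : Integrable (fun σ => f σ * g σ - avg W Λ f σ * g σ) μ :=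
      (int hf hg).sub (int hS' hg)
    have i2 : Integrable (fun σ => f σ * g' σ - avg W Λ f σ * g' σ) μ :=
      (int hf hg'd).sub (int hS' hg'd)
    rw [integral_sub i1 i2,
      integral_sub (int hf hg) (int hS' hg), integral_sub (int hf hg'd) (int hS' hg'd), h2]
    simp only [cov, h1]; ring
  have h4 : |cov μ f g - cov μ (avg W Λ f) g| ≤
      (∑ i ∈ Λ, oscillation f i).toReal * (∑ i ∈ Λ, oscillation g i).toReal := by
    rw [h3]
    refine abs_integral_le_of_abs_le (.of_forall fun σ => ?_)
    rw [abs_mul]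
    refine mul_le_mul (abs_sub_avg_le hS Λ hC σ) ?_ (abs_nonneg _) ENNReal.toReal_nonneg
    exact (ENNReal.ofReal_le_iff_le_toReal hG).1
      (ofReal_abs_sub_le_sum_oscillation g Λ fun k hk => (glue_apply_notMem hk).symm)
  calc ENNReal.ofReal |cov μ f g|
      ≤ ENNReal.ofReal (|cov μ (avg W Λ f) g| +
        (∑ i ∈ Λ, oscillation f i).toReal * (∑ i ∈ Λ, oscillation g i).toReal) := by
        refine ENNReal.ofReal_le_ofReal ?_
        have := abs_sub_abs_le_abs_sub (cov μ f g) (cov μ (avg W Λ f) g)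
        linarith
    _ ≤ _ := by
        refine ENNReal.ofReal_add_le.trans ?_
        rw [ENNReal.ofReal_mul ENNReal.toReal_nonneg, ENNReal.ofReal_toReal hF,
          ENNReal.ofReal_toReal hG, mul_comm (∑ i ∈ Λ, oscillation f i)]

/-- The functional `μ f - ν f` does not change under averaging, so the sweeping bound holds with `b
= w = 0`. -/
theorem eq_of_isGibbs [Countable V] (hS : IsSpec W) {k : V → V → ℝ≥0∞} {α : ℝ≥0∞}
    (hk : Dominates W k α) (hα : α < 1) {ν : Measure (V → Fin q)} (hμ : IsGibbs W μ)
    (hν : IsGibbs W ν) : μ = ν := by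
  have := hμ.1
  have := hν.1
  refine measure_ext_of_local fun f S hf => ?_
  have h := ofReal_abs_le_of_sweep hS hk hα (b := 0) (w := 0) (by simp)
    (E := fun f => ∫ σ, f σ ∂μ - ∫ σ, f σ ∂ν) (fun i f S hf => by
      simp only [hμ.integral_avg_local hS.nonneg hS.finiteRange {i} hf,
        hν.integral_avg_local hS.nonneg hS.finiteRange {i} hf]
      simp) (K := 2) (by simp) (fun f S hf => ofReal_abs_integral_sub_le hf) hf
  simp only [Pi.zero_apply, mul_zero, tsum_zero, nonpos_iff_eq_zero, ENNReal.ofReal_eq_zero] at h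
  exact sub_eq_zero.1 (abs_eq_zero.1 (le_antisymm h (abs_nonneg _)))

theorem ofReal_abs_cov_le_of_dominates (hS : IsSpec W) {k : V → V → ℝ≥0∞} {α : ℝ≥0∞}
    (hk : Dominates W k α) (hα : α < 1) (hμ : IsGibbs W μ) {f g : (V → Fin q) → ℝ}
    {S T : Finset V} (hf : DependsOn f (S : Set V)) (hg : DependsOn g (T : Set V))
    {w : V → ℝ≥0∞} (hw : ∀ i, oscillation g i + ∑' j, k i j * w j ≤ w i) :
    ENNReal.ofReal |cov μ f g| ≤ ∑' i, oscillation f i * w i := by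
  have := hμ.1
  obtain ⟨K, hK, hKf⟩ := exists_ofReal_abs_cov_le (μ := μ) hg
  refine ofReal_abs_le_of_sweep hS hk hα (E := fun f => cov μ f g) hw (fun i f S hf => ?_) hK hKf hf
  simpa using ofReal_abs_cov_le_avg hS hμ {i} hf hg

end Covariance

/-! ### Exponential potentials as supersolutions. -/

section Potential

variable {V : Type}

/-- The potential `∑_j e^{-m d(i,j)} δ_j`. -/
noncomputable def expPotential (d : V → V → ℕ) (m : ℝ) (δ : V → ℝ≥0∞) (i : V) : ℝ≥0∞ :=
  ∑' j, ENNReal.ofReal (Real.exp (-m * d i j)) * δ j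

/-- A Harnack inequality: by the triangle inequality, moving the base point by at most `R` costs at
most the factor `e^{mR}`. -/
theorem expPotential_le {d : V → V → ℕ} (htri : ∀ i j l, d i l ≤ d i j + d j l) {m : ℝ}
    (hm : 0 ≤ m) (δ : V → ℝ≥0∞) {R : ℕ} {i j : V} (hij : d i j ≤ R) :
    expPotential d m δ j ≤ ENNReal.ofReal (Real.exp (m * R)) * expPotential d m δ i := by
  unfold expPotential
  rw [← ENNReal.tsum_mul_left]
  refine ENNReal.tsum_le_tsum fun l => ?_
  rw [← mul_assoc, ← ENNReal.ofReal_mul (Real.exp_pos _).le, ← Real.exp_add]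
  gcongr
  have h : (d i l : ℝ) ≤ R + d j l := by exact_mod_cast (htri i j l).trans (by gcongr)
  nlinarith

theorem le_mul_expPotential {d : V → V → ℕ} {m : ℝ} (hm : 0 ≤ m) (δ : V → ℝ≥0∞) {R : ℕ} {i : V}
    {T : Finset V} (hT : ∀ j ∈ T, d i j ≤ R) :
    ∑ j ∈ T, δ j ≤ ENNReal.ofReal (Real.exp (m * R)) * expPotential d m δ i := by
  unfold expPotential
  refine le_trans ?_ (mul_le_mul_right (ENNReal.sum_le_tsum T) _)
  rw [Finset.mul_sum]
  refine Finset.sum_le_sum fun j hj => ?_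
  rw [← mul_assoc, ← ENNReal.ofReal_mul (Real.exp_pos _).le, ← Real.exp_add]
  refine le_mul_of_one_le_left bot_le ?_
  rw [← ENNReal.ofReal_one]
  refine ENNReal.ofReal_le_ofReal (Real.one_le_exp ?_)
  have : (d i j : ℝ) ≤ R := by exact_mod_cast hT j hj
  nlinarith

/-- A matrix of range `R` with row sums at most `α` enlarges the potential by at most `α e^{mR}`,
which is below one for small `m` when `α < 1`. Hence a multiple of the potential can serve as the
supersolution of the sweeping bound. -/
theorem tsum_mul_expPotential_le {d : V → V → ℕ} (htri : ∀ i j l, d i l ≤ d i j + d j l) {m : ℝ}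
    (hm : 0 ≤ m) (δ : V → ℝ≥0∞) {R : ℕ} {k : V → V → ℝ≥0∞} {α : ℝ≥0∞} {i : V}
    (hk : ∀ j, k i j ≠ 0 → d i j ≤ R) (hα : ∑' j, k i j ≤ α) :
    ∑' j, k i j * expPotential d m δ j ≤
      α * ENNReal.ofReal (Real.exp (m * R)) * expPotential d m δ i := by
  calc ∑' j, k i j * expPotential d m δ j
      ≤ ∑' j, k i j * (ENNReal.ofReal (Real.exp (m * R)) * expPotential d m δ i) := by
        refine ENNReal.tsum_le_tsum fun j => ?_
        by_cases hj : k i j = 0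
        · simp [hj]
        · gcongr
          exact expPotential_le htri hm δ (hk j hj)
    _ ≤ _ := by
        rw [ENNReal.tsum_mul_right, mul_assoc]
        gcongr

theorem exists_rate {α : ℝ≥0∞} (hα : α < 1) (R : ℕ) :
    ∃ m : ℝ, 0 < m ∧ α * ENNReal.ofReal (Real.exp (m * R)) < 1 := by
  have hc : Filter.Tendsto (fun m : ℝ => α * ENNReal.ofReal (Real.exp (m * R)))
      (nhdsWithin 0 (Set.Ioi 0)) (nhds (α * ENNReal.ofReal (Real.exp (0 * R)))) := by
    refine ENNReal.Tendsto.const_mul ?_ (Or.inr hα.ne_top)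
    refine ENNReal.tendsto_ofReal ?_
    have : Continuous fun m : ℝ => Real.exp (m * R) := by fun_prop
    exact (this.tendsto 0).mono_left nhdsWithin_le_nhds
  have h1 : α * ENNReal.ofReal (Real.exp (0 * R)) < 1 := by simpa using hα
  have h2 := (hc.eventually (gt_mem_nhds h1)).and self_mem_nhdsWithin
  obtain ⟨m, hm1, hm2⟩ := h2.exists
  exact ⟨m, hm2, hm1⟩

/-- The solution of `B + θ C = C`. -/
theorem exists_const {θ : ℝ≥0∞} (hθ : θ < 1) {B : ℝ≥0∞} (hB : B ≠ ∞) :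
    ∃ C : ℝ≥0∞, C ≠ ∞ ∧ B + θ * C = C := by
  have h0 : 1 - θ ≠ 0 := (tsub_pos_of_lt hθ).ne'
  refine ⟨B * (1 - θ)⁻¹, ENNReal.mul_ne_top hB (ENNReal.inv_ne_top.2 h0), ?_⟩
  have h1 : B = (1 - θ) * (B * (1 - θ)⁻¹) := by
    rw [mul_left_comm, ENNReal.mul_inv_cancel h0 (by finiteness), mul_one]
  nth_rewrite 1 [h1]
  rw [← add_mul, tsub_add_cancel_of_le hθ.le, one_mul]

end Potential


/-! ### Tail triviality under uniqueness and approximation by local functions. -/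

section Tail

variable {V : Type} {q : ℕ} {W : Finset V → (V → Fin q) → ℝ} {μ : Measure (V → Fin q)}

/-- Under uniqueness, tail events have probability `0` or `1`. -/
theorem measure_tail_event [Countable V] (hS : IsSpec W) (hμ : IsGibbs W μ)
    (huniq : ∀ μ', IsGibbs W μ' → μ' = μ) {A : Set (V → Fin q)} (hA : MeasurableSet A)
    (htail : ∀ (Λ : Finset V) (σ σ' : V → Fin q), (∀ x, x ∉ Λ → σ x = σ' x) → (σ ∈ A ↔ σ' ∈ A)) :
    μ A = 0 ∨ μ Aᶜ = 0 := by
  have := hμ.1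
  refine or_iff_not_imp_left.2 fun h0 => ?_
  have hν : IsProbabilityMeasure (ProbabilityTheory.cond μ A) :=
    ProbabilityTheory.cond_isProbabilityMeasure h0
  have hind : ∀ f : (V → Fin q) → ℝ, ∫ σ, f σ ∂(ProbabilityTheory.cond μ A) =
      (μ A)⁻¹.toReal * ∫ σ, f σ * A.indicator (fun _ => (1 : ℝ)) σ ∂μ := by
    intro f
    rw [ProbabilityTheory.cond, integral_smul_measure, smul_eq_mul, ← integral_indicator hA]
    congr 2
    funext σ
    by_cases hσ : σ ∈ A <;> simp [hσ]
  -- The indicator of a tail event passes through every finite-volume average, so conditioning on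
  -- `A` preserves the Gibbs property; uniqueness then forces the conditioned measure to be `μ`.
  have hgibbs : IsGibbs W (ProbabilityTheory.cond μ A) := by
    refine isGibbs_of_local hS.nonneg hS.finiteRange fun Λ f S hf => ?_
    obtain ⟨C, hC⟩ := bounded_of_dependsOn hf
    rw [hind, hind, ← hμ.integral_avg hS.nonneg hS.finiteRange Λ
      (f := fun σ => f σ * A.indicator (fun _ => (1 : ℝ)) σ) (C := C * 1)
      ((measurable_of_dependsOn hf).mul (measurable_const.indicator hA))
      (fun σ => by
        rw [abs_mul]
        exact mul_le_mul (hC σ) (abs_indicator_one_le _ _) (abs_nonneg _)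
          ((abs_nonneg _).trans (hC σ)))]
    congr 2
    funext σ
    rw [avg_mul_right W Λ f fun σ σ' h => ?_]
    have := htail Λ σ σ' h
    by_cases hσ : σ ∈ A
    · simp [hσ, this.1 hσ]
    · have hσ' : σ' ∉ A := fun h' => hσ (this.2 h')
      simp [hσ, hσ']
  rw [← huniq _ hgibbs, ProbabilityTheory.cond_apply hA]
  simp

theorem exists_ae_eq_const_of_tail [Countable V] (hS : IsSpec W) (hμ : IsGibbs W μ)
    (huniq : ∀ μ', IsGibbs W μ' → μ' = μ) {h : (V → Fin q) → ℝ} (hh : Measurable h)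
    (htail : ∀ (Λ : Finset V) (σ σ' : V → Fin q), (∀ x, x ∉ Λ → σ x = σ' x) → h σ = h σ') :
    ∃ c, ∀ᵐ σ ∂μ, h σ = c := by
  refine Filter.exists_eventuallyEq_const_of_forall_separating (l := ae μ) MeasurableSet
    fun U hU => ?_
  rcases measure_tail_event hS hμ huniq (hh hU) fun Λ σ σ' hσ => by
    simp only [Set.mem_preimage, htail Λ σ σ' hσ] with h0 | h1
  · exact Or.inr (measure_eq_zero_iff_ae_notMem.1 h0)
  · exact Or.inl ((measure_eq_zero_iff_ae_notMem.1 h1).mono fun σ hσ => not_not.1 hσ)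

/-- The supremum `h` of `f` over all finite modifications of the configuration is a tail function
within `ε` of `f`, hence almost surely constant. -/
theorem exists_ae_abs_sub_le [Countable V] (hS : IsSpec W) (hμ : IsGibbs W μ)
    (huniq : ∀ μ', IsGibbs W μ' → μ' = μ) {f : (V → Fin q) → ℝ} (hf : Measurable f) {ε : ℝ}
    (hε : ∀ (Λ : Finset V) (σ σ' : V → Fin q), (∀ x, x ∉ Λ → σ x = σ' x) → |f σ - f σ'| ≤ ε) :
    ∃ c, ∀ᵐ σ ∂μ, |f σ - c| ≤ ε := by
  let h : (V → Fin q) → ℝ := fun σ => ⨆ p : (Σ Λ : Finset V, Λ → Fin q), f (glue σ p.1 p.2)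
  have hloc : ∀ σ (p : Σ Λ : Finset V, Λ → Fin q), |f (glue σ p.1 p.2) - f σ| ≤ ε := fun σ p =>
    hε p.1 _ _ fun x hx => glue_apply_notMem hx
  have hbdd : ∀ σ, BddAbove (Set.range fun p : (Σ Λ : Finset V, Λ → Fin q) =>
      f (glue σ p.1 p.2)) := by
    rintro σ
    refine ⟨f σ + ε, ?_⟩
    rintro _ ⟨p, rfl⟩
    have := abs_le.1 (hloc σ p)
    simp only; linarith
  have hmeas : Measurable h :=
    Measurable.iSup fun p => hf.comp (measurable_glue p.1 p.2)
  have hclose : ∀ σ, |f σ - h σ| ≤ ε := by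
    intro σ
    have hp : f (glue σ ∅ fun x => σ x) = f σ := by rw [glue_self]
    have h1 : f σ ≤ h σ := hp ▸ le_ciSup (hbdd σ) ⟨∅, fun x => σ x⟩
    have : Nonempty (Σ Λ : Finset V, Λ → Fin q) := ⟨⟨∅, fun x => σ x⟩⟩
    have h2 : h σ ≤ f σ + ε := ciSup_le fun p => by
      have := abs_le.1 (hloc σ p)
      linarith
    rw [abs_le]; constructor <;> linarith
  have hle : ∀ (Λ : Finset V) (σ σ' : V → Fin q), (∀ x, x ∉ Λ → σ x = σ' x) → h σ ≤ h σ' := by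
    classical
    intro Λ σ σ' hσ
    have : Nonempty (Σ Λ : Finset V, Λ → Fin q) := ⟨⟨∅, fun x => σ x⟩⟩
    refine ciSup_le fun p => ?_
    have e : glue σ p.1 p.2 = glue σ' (p.1 ∪ Λ) fun x => glue σ p.1 p.2 x := by
      funext x
      by_cases hx : x ∈ p.1 ∪ Λ
      · rw [glue_apply_mem hx]
      · rw [glue_apply_notMem hx]
        rw [Finset.mem_union, not_or] at hx
        rw [glue_apply_notMem hx.1, hσ x hx.2]
    rw [e]
    exact le_ciSup (hbdd σ') ⟨p.1 ∪ Λ, fun x => glue σ p.1 p.2 x⟩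
  obtain ⟨c, hc⟩ := exists_ae_eq_const_of_tail hS hμ huniq hmeas fun Λ σ σ' hσ =>
    le_antisymm (hle Λ σ σ' hσ) (hle Λ σ' σ fun x hx => (hσ x hx).symm)
  refine ⟨c, hc.mono fun σ hσ => ?_⟩
  rw [← hσ]
  exact hclose σ

theorem oscillation_glue_le (f : (V → Fin q) → ℝ) (ω : V → Fin q) (Λ : Finset V) (i : V) :
    oscillation (fun σ : V → Fin q => f (glue ω Λ fun x => σ x)) i ≤ oscillation f i := by
  refine oscillation_le fun σ σ' h => le_oscillation f fun k hk => ?_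
  by_cases hkΛ : k ∈ Λ
  · rw [glue_apply_mem hkΛ, glue_apply_mem hkΛ]; exact h k hk
  · rw [glue_apply_notMem hkΛ, glue_apply_notMem hkΛ]

/-- Finite total oscillation alone says nothing about the dependence on the tail: tail functions
have zero oscillation. Tail triviality supplies, for each of the finitely many `s` on `Λ`, a
constant near `f (glue σ Λ s)`, and the approximant freezes the outside spins at one configuration
`ω` that is typical for all `s`. -/
theorem exists_local_approx [Countable V] (hS : IsSpec W) (hμ : IsGibbs W μ)
    (huniq : ∀ μ', IsGibbs W μ' → μ' = μ) {f : (V → Fin q) → ℝ} (hf : Measurable f)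
    (hfin : ∑' i, oscillation f i < ∞) (Λ : Finset V) :
    ∃ g : (V → Fin q) → ℝ, DependsOn g (Λ : Set V) ∧ (∀ i, oscillation g i ≤ oscillation f i) ∧
      ∀ᵐ σ ∂μ, |f σ - g σ| ≤ 2 * (∑' i : {i // i ∉ Λ}, oscillation f i).toReal := by
  classical
  have := hμ.1
  set ε := (∑' i : {i // i ∉ Λ}, oscillation f i).toReal with hεdef
  have hεfin : ∑' i : {i // i ∉ Λ}, oscillation f i ≠ ∞ :=
    ((ENNReal.tsum_comp_le_tsum_of_injective Subtype.val_injective _).trans_lt hfin).ne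
  have key : ∀ s : Λ → Fin q, ∃ c, ∀ᵐ σ ∂μ, |f (glue σ Λ s) - c| ≤ ε := by
    intro s
    refine exists_ae_abs_sub_le hS hμ huniq (f := fun σ => f (glue σ Λ s))
      (hf.comp (measurable_glue Λ s)) fun Λ' σ σ' h => ?_
    refine (ENNReal.ofReal_le_iff_le_toReal hεfin).1 ?_
    refine (ofReal_abs_sub_le_sum_oscillation f (Λ' \ Λ) fun k hk => ?_).trans ?_
    · by_cases hkΛ : k ∈ Λ
      · rw [glue_apply_mem hkΛ, glue_apply_mem hkΛ]
      · rw [glue_apply_notMem hkΛ, glue_apply_notMem hkΛ]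
        exact h k fun hk' => hk (Finset.mem_sdiff.2 ⟨hk', hkΛ⟩)
    · rw [← Finset.sum_subtype_of_mem (p := fun i => i ∉ Λ) (oscillation f)
        fun i hi => (Finset.mem_sdiff.1 hi).2]
      exact ENNReal.sum_le_tsum _
  choose c hc using key
  have hall : ∀ᵐ σ ∂μ, ∀ s : Λ → Fin q, |f (glue σ Λ s) - c s| ≤ ε := ae_all_iff.2 hc
  obtain ⟨ω, hω⟩ := hall.exists
  refine ⟨fun σ => f (glue ω Λ fun x => σ x), fun σ σ' h => ?_, oscillation_glue_le f ω Λ, ?_⟩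
  · have : (fun x : Λ => σ x) = fun x : Λ => σ' x := funext fun x => h x x.2
    simp only [this]
  · refine hall.mono fun σ hσ => ?_
    have h1 := hσ fun x => σ x
    have h2 := hω fun x => σ x
    rw [glue_self] at h1
    rw [abs_le] at *
    constructor <;> linarith

/-- Under uniqueness, it suffices to prove exponential decay for local functions. -/
theorem exponentialDecay_of_local [Countable V] (hS : IsSpec W) (hμ : IsGibbs W μ)
    (huniq : ∀ μ', IsGibbs W μ' → μ' = μ) {d : V → V → ℕ} {C : ℝ≥0∞} (hC : C ≠ ∞) {m : ℝ}
    (hm : 0 < m) (hloc : ∀ (f g : (V → Fin q) → ℝ) (S T : Finset V), DependsOn f (S : Set V) →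
      DependsOn g (T : Set V) → ENNReal.ofReal |cov μ f g| ≤
        ∑' i, oscillation f i * (C * expPotential d m (oscillation g) i)) :
    ExponentialDecay μ d := by
  have := hμ.1
  -- The summand `1` keeps the constant positive even when `C = 0`.
  refine ⟨C.toReal + 1, m, by positivity, hm, fun f g hf hg hfs hgs => ?_⟩
  choose F hF hFo hFe using exists_local_approx hS hμ huniq hf hfs
  choose G hG hGo hGe using exists_local_approx hS hμ huniq hg hgs
  have hbound : ∀ {f : (V → Fin q) → ℝ} {g : (V → Fin q) → ℝ} {S : Finset V} {r : ℝ},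
      DependsOn g (S : Set V) → (∀ᵐ σ ∂μ, |f σ - g σ| ≤ r) → ∃ M, ∀ᵐ σ ∂μ, |f σ| ≤ M := by
    intro f g S r hg hr
    obtain ⟨M, hM⟩ := bounded_of_dependsOn hg
    refine ⟨r + M, hr.mono fun σ hσ => ?_⟩
    have := abs_sub_abs_le_abs_sub (f σ) (g σ)
    linarith [hM σ]
  -- The approximation on the empty volume already shows that `f` and `g` are almost surely bounded,
  -- hence integrable.
  obtain ⟨M, hM⟩ := hbound (hF ∅) (hFe ∅)
  obtain ⟨N, hN⟩ := hbound (hG ∅) (hGe ∅)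
  have hfi : Integrable f μ := Integrable.of_bound hf.aestronglyMeasurable M hM
  have hgi : Integrable g μ := Integrable.of_bound hg.aestronglyMeasurable N hN
  have hM0 : 0 ≤ M := by obtain ⟨σ, hσ⟩ := hM.exists; exact (abs_nonneg _).trans hσ
  have hN0 : 0 ≤ N := by obtain ⟨σ, hσ⟩ := hN.exists; exact (abs_nonneg _).trans hσ
  have hfg : Integrable (fun σ => f σ * g σ) μ := by
    refine Integrable.of_bound (hf.mul hg).aestronglyMeasurable (M * N) ?_
    filter_upwards [hM, hN] with σ h1 h2
    rw [Real.norm_eq_abs, abs_mul]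
    exact mul_le_mul h1 h2 (abs_nonneg _) hM0
  refine ⟨hfi, hgi, hfg, ?_⟩
  set εf : Finset V → ℝ := fun Λ => 2 * (∑' i : {i // i ∉ Λ}, oscillation f i).toReal with hεf
  set εg : Finset V → ℝ := fun Λ => 2 * (∑' i : {i // i ∉ Λ}, oscillation g i).toReal with hεg
  have hε : ∀ {f : (V → Fin q) → ℝ}, ∑' i, oscillation f i < ∞ → Filter.Tendsto
      (fun Λ : Finset V => 2 * (∑' i : {i // i ∉ Λ}, oscillation f i).toReal) Filter.atTop
      (nhds 0) := by
    intro f hf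
    have h1 := (ENNReal.continuousAt_toReal ENNReal.zero_ne_top).tendsto.comp
      (ENNReal.tendsto_tsum_compl_atTop_zero hf.ne)
    simpa using h1.const_mul 2
  have hεf0 : Filter.Tendsto εf Filter.atTop (nhds 0) := hε hfs
  have hεg0 : Filter.Tendsto εg Filter.atTop (nhds 0) := hε hgs
  have hlim1 : ∀ {f : (V → Fin q) → ℝ} {F : Finset V → (V → Fin q) → ℝ} {e : Finset V → ℝ},
      Integrable f μ → (∀ Λ, Integrable (F Λ) μ) → Filter.Tendsto e Filter.atTop (nhds 0) →
      (∀ Λ, ∀ᵐ σ ∂μ, |f σ - F Λ σ| ≤ e Λ) →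
      Filter.Tendsto (fun Λ => ∫ σ, F Λ σ ∂μ) Filter.atTop (nhds (∫ σ, f σ ∂μ)) := by
    intro f F e hf hF he h
    rw [tendsto_iff_dist_tendsto_zero]
    refine squeeze_zero (fun _ => dist_nonneg) (fun Λ => ?_) he
    rw [dist_comm, Real.dist_eq, ← integral_sub hf (hF Λ)]
    exact abs_integral_le_of_abs_le (h Λ)
  have hFi : ∀ Λ, Integrable (F Λ) μ := fun Λ => integrable_of_dependsOn (hF Λ)
  have hGi : ∀ Λ, Integrable (G Λ) μ := fun Λ => integrable_of_dependsOn (hG Λ)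
  have hFGi : ∀ Λ, Integrable (fun σ => F Λ σ * G Λ σ) μ := fun Λ =>
    integrable_of_dependsOn (S := Λ) (by simpa using dependsOn_mul (hF Λ) (hG Λ))
  have t1 := hlim1 hfi hFi hεf0 hFe
  have t2 := hlim1 hgi hGi hεg0 hGe
  have t3 : Filter.Tendsto (fun Λ => ∫ σ, F Λ σ * G Λ σ ∂μ) Filter.atTop
      (nhds (∫ σ, f σ * g σ ∂μ)) := by
    refine hlim1 (e := fun Λ => εf Λ * (N + εg Λ) + M * εg Λ) hfg hFGi ?_ fun Λ => ?_
    · simpa using (hεf0.mul (hεg0.const_add N)).add (hεg0.const_mul M)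
    · filter_upwards [hM, hN, hFe Λ, hGe Λ] with σ h1 h2 h3 h4
      have e : f σ * g σ - F Λ σ * G Λ σ =
          (f σ - F Λ σ) * (g σ - (g σ - G Λ σ)) + f σ * (g σ - G Λ σ) := by ring
      rw [e]
      refine (abs_add_le _ _).trans ?_
      rw [abs_mul, abs_mul]
      have h5 : |g σ - (g σ - G Λ σ)| ≤ N + εg Λ := (abs_sub _ _).trans (add_le_add h2 h4)
      exact add_le_add (mul_le_mul h3 h5 (abs_nonneg _) ((abs_nonneg _).trans h3))
        (mul_le_mul h1 h4 (abs_nonneg _) hM0)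
  have t4 : Filter.Tendsto (fun Λ => ENNReal.ofReal |cov μ (F Λ) (G Λ)|) Filter.atTop
      (nhds (ENNReal.ofReal |cov μ f g|)) :=
    ENNReal.tendsto_ofReal (t3.sub (t1.mul t2)).abs
  refine le_of_tendsto' t4 fun Λ => (hloc _ _ Λ Λ (hF Λ) (hG Λ)).trans ?_
  have hCle : C ≤ ENNReal.ofReal (C.toReal + 1) := by
    rw [← ENNReal.ofReal_toReal hC]
    exact ENNReal.ofReal_le_ofReal (by simp)
  rw [← ENNReal.tsum_mul_left]
  refine ENNReal.tsum_le_tsum fun i => ?_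
  rw [mul_left_comm]
  refine mul_le_mul' hCle ?_
  rw [expPotential, ← ENNReal.tsum_mul_left]
  refine ENNReal.tsum_le_tsum fun j => ?_
  rw [← mul_assoc]
  gcongr
  · exact hFo Λ i
  · exact hGo Λ j

end Tail


/-! ### Dobrushin's theorem. -/

section Dobrushin

variable {V : Type} {q : ℕ} {W : Finset V → (V → Fin q) → ℝ}

open Classical in
/-- Dobrushin's matrix with zero diagonal. -/
noncomputable def offDiag (W : Finset V → (V → Fin q) → ℝ) (i j : V) : ℝ≥0∞ :=
  if j = i then 0 else interdependence W i j

theorem dominates_offDiag (W : Finset V → (V → Fin q) → ℝ) :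
    Dominates W (offDiag W) (dobrushinConstant W) := by
  classical
  refine ⟨fun i j h => by simp [offDiag, h], fun i => ?_⟩
  refine le_trans (le_of_eq ?_) (le_iSup _ i)
  rw [← tsum_subtype_eq_of_support_subset (s := {j | j ≠ i})]
  · exact tsum_congr fun j => by rw [offDiag, if_neg j.2]
  · intro j hj h
    subst h
    simp [offDiag] at hj

/-- Dobrushin's theorem. -/
theorem uniqueGibbsWithDecay_of_dobrushin [Countable V] (hS : IsSpec W)
    (hα : dobrushinConstant W < 1) (hex : ∃ μ, IsGibbs W μ) {d : V → V → ℕ}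
    (hself : ∀ i, d i i = 0) (htri : ∀ i j l, d i l ≤ d i j + d j l) {R : ℕ}
    (hR : ∀ i j, interdependence W i j ≠ 0 → d i j ≤ R) : UniqueGibbsWithDecay W d := by
  obtain ⟨μ, hμ⟩ := hex
  have hk := dominates_offDiag W
  have huniq : ∀ μ', IsGibbs W μ' → μ' = μ := fun μ' hμ' => eq_of_isGibbs hS hk hα hμ' hμ
  refine ⟨μ, hμ, huniq, ?_⟩
  obtain ⟨m, hm, hθ⟩ := exists_rate hα R
  -- The equation `1 + θ * C = C` with `θ = α e^{mR}` makes `C` times the potential of `g` a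
  -- supersolution with source the oscillation of `g`.
  obtain ⟨C, hC, hCeq⟩ := exists_const hθ ENNReal.one_ne_top
  refine exponentialDecay_of_local hS hμ huniq hC hm fun f g S T hf hg => ?_
  refine ofReal_abs_cov_le_of_dominates hS hk hα hμ hf hg fun i => ?_
  have h1 : oscillation g i ≤ expPotential d m (oscillation g) i := by
    have := le_mul_expPotential hm.le (oscillation g) (R := 0) (i := i) (T := {i})
      (d := d) (by simp [hself])
    simpa using this
  have h2 := tsum_mul_expPotential_le htri hm.le (oscillation g) (R := R) (k := offDiag W) (i := i)
    (fun j hj => by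
      by_cases hji : j = i
      · simp [offDiag, hji] at hj
      · exact hR i j (by simpa [offDiag, hji] using hj)) (hk.sum_le i)
  calc oscillation g i + ∑' j, offDiag W i j * (C * expPotential d m (oscillation g) j)
      = oscillation g i + C * ∑' j, offDiag W i j * expPotential d m (oscillation g) j := by
        rw [← ENNReal.tsum_mul_left]
        simp only [mul_left_comm]
    _ ≤ expPotential d m (oscillation g) i + C * (dobrushinConstant W *
        ENNReal.ofReal (Real.exp (m * R)) * expPotential d m (oscillation g) i) := by gcongr
    _ = (1 + dobrushinConstant W * ENNReal.ofReal (Real.exp (m * R)) * C) *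
        expPotential d m (oscillation g) i := by ring
    _ = _ := by rw [hCeq]

end Dobrushin

/-! ### Consistency of the kernels and existence of Gibbs measures. -/

section Existence

variable {V : Type} {q : ℕ} {W : Finset V → (V → Fin q) → ℝ}

-- Consistency follows from detailed balance: since `r` does not see the spins in `Λ`, the product
-- `W Λ σ * W Λ' σ'` is symmetric in configurations that agree outside `Λ`. The weights may vanish,
-- so normalisation of the inner kernel is a hypothesis.
open Classical in
theorem avg_avg {Λ Λ' : Finset V} (hΛ : Λ ⊆ Λ') {r : (V → Fin q) → ℝ}
    (hr : ∀ σ, W Λ' σ = W Λ σ * r σ) (hrd : DependsOn r {x | x ∉ Λ})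
    (hpos : ∀ ω, ∑ s : Λ → Fin q, kernel W Λ ω s = 1) (f : (V → Fin q) → ℝ) (ω : V → Fin q) :
    avg W Λ' (avg W Λ f) ω = avg W Λ' f ω := by
  have hswap : ∀ σ (s : Λ → Fin q), W Λ' σ * W Λ (glue σ Λ s) = W Λ σ * W Λ' (glue σ Λ s) := by
    intro σ s
    have := hrd (x := glue σ Λ s) (y := σ) fun x hx => glue_apply_notMem hx
    rw [hr, hr, this]; ring
  set Z := ∑ τ' : Λ' → Fin q, W Λ' (glue ω Λ' τ') with hZ
  let z : (V → Fin q) → ℝ := fun σ => ∑ s : Λ → Fin q, W Λ (glue σ Λ s)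
  have hz : ∀ σ (s : Λ → Fin q), z (glue σ Λ s) = z σ := by
    intro σ s
    simp only [z, glue_glue]
  have hglue : ∀ (τ : Λ' → Fin q) (s : Λ → Fin q),
      glue ω Λ' (fun x => glue (glue ω Λ' τ) Λ s x) = glue (glue ω Λ' τ) Λ s := by
    intro τ s
    funext x
    by_cases hx : x ∈ Λ'
    · rw [glue_apply_mem hx]
    · have hx' : x ∉ Λ := fun h => hx (hΛ h)
      rw [glue_apply_notMem hx, glue_apply_notMem hx', glue_apply_notMem hx]
  calc avg W Λ' (avg W Λ f) ω
      = ∑ p : (Λ' → Fin q) × (Λ → Fin q), W Λ (glue ω Λ' p.1) *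
          W Λ' (glue (glue ω Λ' p.1) Λ p.2) / (Z * z (glue ω Λ' p.1)) *
            f (glue (glue ω Λ' p.1) Λ p.2) := by
        rw [Fintype.sum_prod_type]
        refine Finset.sum_congr (by congr!) fun τ _ => ?_
        unfold avg
        rw [Finset.mul_sum]
        refine Finset.sum_congr (by congr!) fun s _ => ?_
        simp only
        rw [← hswap]
        simp only [kernel, ← hZ, z]
        ring
    _ = ∑ p : (Λ' → Fin q) × (Λ → Fin q), W Λ' (glue ω Λ' p.1) *
          W Λ (glue (glue ω Λ' p.1) Λ p.2) / (Z * z (glue ω Λ' p.1)) * f (glue ω Λ' p.1) := by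
        -- The involution exchanges the configuration before and after the spins in `Λ` are
        -- resampled.
        let φ : (Λ' → Fin q) × (Λ → Fin q) → (Λ' → Fin q) × (Λ → Fin q) := fun p =>
          (fun x => glue (glue ω Λ' p.1) Λ p.2 x, fun x => glue ω Λ' p.1 x)
        have hφ1 : ∀ p, glue ω Λ' (φ p).1 = glue (glue ω Λ' p.1) Λ p.2 := fun p => hglue p.1 p.2
        have hφ2 : ∀ p, glue (glue ω Λ' (φ p).1) Λ (φ p).2 = glue ω Λ' p.1 := fun p => by
          rw [hφ1, glue_glue]
          exact glue_self (glue ω Λ' p.1) Λ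
        have hinv : Function.Involutive φ := by
          intro p
          refine Prod.ext ?_ ?_
          · funext x
            change glue (glue ω Λ' (φ p).1) Λ (φ p).2 x = p.1 x
            rw [hφ2, glue_apply_mem x.2]
          · funext x
            change glue ω Λ' (φ p).1 x = p.2 x
            rw [hφ1, glue_apply_mem x.2]
        refine Fintype.sum_equiv hinv.toPerm _ _ fun p => ?_
        rw [Function.Involutive.coe_toPerm, hφ2, hφ1, hz]
        ring
    _ = avg W Λ' f ω := by
        rw [Fintype.sum_prod_type]
        refine Finset.sum_congr (by congr!) fun τ _ => ?_
        have h1 := hpos (glue ω Λ' τ)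
        calc ∑ s : Λ → Fin q, W Λ' (glue ω Λ' τ) * W Λ (glue (glue ω Λ' τ) Λ s) /
              (Z * z (glue ω Λ' τ)) * f (glue ω Λ' τ)
            = ∑ s : Λ → Fin q, (kernel W Λ' ω τ * f (glue ω Λ' τ)) *
                kernel W Λ (glue ω Λ' τ) s := by
              refine Finset.sum_congr rfl fun s _ => ?_
              have e1 : kernel W Λ' ω τ = W Λ' (glue ω Λ' τ) / Z := by
                simp only [kernel, hZ]
              have e2 : kernel W Λ (glue ω Λ' τ) s =
                  W Λ (glue (glue ω Λ' τ) Λ s) / z (glue ω Λ' τ) := by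
                simp only [kernel, z]
              rw [e1, e2]
              ring
          _ = _ := by
              rw [← Finset.mul_sum]
              rw [h1, mul_one]

/-- Existence of Gibbs measures, by compactness. -/
theorem exists_isGibbs [Countable V] (hS : IsSpec W) (ω : V → Fin q)
    (hcons : ∀ (Λ Λ' : Finset V), Λ ⊆ Λ' → ∀ (f : (V → Fin q) → ℝ) (ω : V → Fin q),
      avg W Λ' (avg W Λ f) ω = avg W Λ' f ω) : ∃ μ, IsGibbs W μ := by
  classical
  let ρ : Finset V → Measure (V → Fin q) := fun Λ =>
    ∑ τ : Λ → Fin q, ENNReal.ofReal (kernel W Λ ω τ) • Measure.dirac (glue ω Λ τ)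
  have hρ : ∀ Λ, IsProbabilityMeasure (ρ Λ) := fun Λ => ⟨by
    simp only [ρ, Measure.coe_finsetSum, Finset.sum_apply, Measure.smul_apply, measure_univ,
      smul_eq_mul, mul_one]
    rw [← ENNReal.ofReal_sum_of_nonneg fun τ _ => kernel_nonneg hS.nonneg _ _ _]
    rw [show ∑ τ : Λ → Fin q, kernel W Λ ω τ = 1 by convert hS.sum_kernel Λ ω]
    simp⟩
  have hint : ∀ Λ (f : (V → Fin q) → ℝ) (S : Finset V), DependsOn f (S : Set V) →
      ∫ σ, f σ ∂(ρ Λ) = avg W Λ f ω := by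
    intro Λ f S hf
    rw [integral_finsetSum_measure]
    · refine Finset.sum_congr (by congr!) fun τ _ => ?_
      rw [integral_smul_measure, integral_dirac' _ _ (measurable_of_dependsOn hf).stronglyMeasurable,
        ENNReal.toReal_ofReal (kernel_nonneg hS.nonneg _ _ _), smul_eq_mul]
    · intro τ _
      exact (integrable_of_dependsOn hf).smul_measure ENNReal.ofReal_ne_top
  let P : Finset V → ProbabilityMeasure (V → Fin q) := fun Λ => ⟨ρ Λ, hρ Λ⟩
  -- The probability measures on the compact configuration space form a compact space, so the
  -- finite-volume measures with boundary condition `ω` converge along an ultrafilter of growing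
  -- volumes.
  let U : Ultrafilter (Finset V) := Ultrafilter.of Filter.atTop
  obtain ⟨μ, -, hμ⟩ := isCompact_univ.ultrafilter_le_nhds (U.map P) (by simp)
  have hlim : ∀ (f : (V → Fin q) → ℝ) (S : Finset V), DependsOn f (S : Set V) →
      Filter.Tendsto (fun Λ => ∫ σ, f σ ∂(ρ Λ)) U (nhds (∫ σ, f σ ∂(μ : Measure (V → Fin q)))) := by
    intro f S hf
    have h1 : Filter.Tendsto P U (nhds μ) := hμ
    have h2 := ProbabilityMeasure.tendsto_iff_forall_integral_tendsto.1 h1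
      (BoundedContinuousFunction.mkOfCompact ⟨f, continuous_of_dependsOn hf⟩)
    exact h2
  refine ⟨μ, isGibbs_of_local hS.nonneg hS.finiteRange fun Λ f S hf => ?_⟩
  obtain ⟨S', hS'⟩ := dependsOn_avg hS.finiteRange Λ hf
  refine tendsto_nhds_unique ((hlim _ S' hS').congr' ?_) (hlim f S hf)
  have hev : ∀ᶠ Λ' in (U : Filter (Finset V)), Λ ⊆ Λ' :=
    (Ultrafilter.of_le Filter.atTop) (Filter.eventually_ge_atTop Λ)
  filter_upwards [hev] with Λ' hΛ'
  rw [hint Λ' _ S' hS', hint Λ' f S hf, hcons Λ Λ' hΛ']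

end Existence

/-! ### The Potts antiferromagnet on a graph of degree below `q`. -/

section Potts

variable {V : Type} {q : ℕ} {G : SimpleGraph V}

theorem pottsWeight_nonneg (G : SimpleGraph V) (Λ : Finset V) (σ : V → Fin q) :
    0 ≤ pottsWeight G Λ σ := by
  unfold pottsWeight; split_ifs <;> simp

theorem dependsOn_pottsWeight {N : V → Finset V} (hN : ∀ x y, G.Adj x y → y ∈ N x)
    (Λ : Finset V) : ∃ S : Finset V, DependsOn (pottsWeight (q := q) G Λ) (S : Set V) := by
  classical
  refine ⟨Λ ∪ Λ.biUnion N, fun σ σ' h => ?_⟩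
  unfold pottsWeight
  congr 1
  simp only [eq_iff_iff]
  refine forall₂_congr fun x hx => forall₂_congr fun y hxy => ?_
  rw [h x (by simp [hx]), h y ?_]
  simp only [Finset.coe_union, Finset.coe_biUnion, Set.mem_union, Set.mem_iUnion, Finset.mem_coe]
  exact Or.inr ⟨x, hx, hN x y hxy⟩

/-- Greedy colouring: a vertex with fewer than `q` neighbours always has a free colour. This makes
every partition function positive. -/
theorem exists_coloring {N : V → Finset V} (hN : ∀ x y, G.Adj x y → y ∈ N x)
    (hq : ∀ x, (N x).card < q) (Λ : Finset V) (ω : V → Fin q) :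
    ∃ σ : V → Fin q, (∀ x, x ∉ Λ → σ x = ω x) ∧ ∀ x ∈ Λ, ∀ y, G.Adj x y → σ x ≠ σ y := by
  classical
  induction Λ using Finset.induction_on with
  | empty => exact ⟨ω, fun _ _ => rfl, by simp⟩
  | insert a Λ ha ih =>
    obtain ⟨σ, h1, h2⟩ := ih
    obtain ⟨c, -, hc⟩ : ∃ c ∈ (Finset.univ : Finset (Fin q)), c ∉ (N a).image σ := by
      refine Finset.exists_mem_notMem_of_card_lt_card ?_
      rw [Finset.card_univ, Fintype.card_fin]
      exact Finset.card_image_le.trans_lt (hq a)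
    have hc' : ∀ y, G.Adj a y → c ≠ σ y := fun y hy h =>
      hc (Finset.mem_image.2 ⟨y, hN a y hy, h.symm⟩)
    refine ⟨Function.update σ a c, fun x hx => ?_, fun x hx y hxy => ?_⟩
    · rw [Finset.mem_insert, not_or] at hx
      rw [Function.update_of_ne hx.1, h1 x hx.2]
    · by_cases hxa : x = a
      · subst hxa
        rw [Function.update_self, Function.update_of_ne hxy.ne']
        exact hc' y hxy
      · by_cases hya : y = a
        · subst hya
          rw [Function.update_self, Function.update_of_ne hxa]
          exact (hc' x hxy.symm).symm
        · rw [Function.update_of_ne hxa, Function.update_of_ne hya]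
          exact h2 x ((Finset.mem_insert.1 hx).resolve_left hxa) y hxy

theorem isSpec_pottsWeight {N : V → Finset V} (hN : ∀ x y, G.Adj x y → y ∈ N x)
    (hq : ∀ x, (N x).card < q) : IsSpec (pottsWeight (q := q) G) where
  nonneg := pottsWeight_nonneg G
  finiteRange := dependsOn_pottsWeight hN
  pos Λ ω := by
    classical
    obtain ⟨σ, h1, h2⟩ := exists_coloring hN hq Λ ω
    refine Finset.sum_pos' (fun τ _ => pottsWeight_nonneg _ _ _)
      ⟨fun x => σ x, Finset.mem_univ _, ?_⟩
    have : glue ω Λ (fun x => σ x) = σ := by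
      rw [glue_congr fun x hx => (h1 x hx).symm, glue_self]
    rw [this, pottsWeight, if_pos h2]
    exact zero_lt_one

-- The second factor collects the edges that meet `Λ'` but not `Λ`. It does not depend on the spins
-- in `Λ`, as `avg_avg` requires.
open Classical in
theorem pottsWeight_eq_mul {Λ Λ' : Finset V} (h : Λ ⊆ Λ') (σ : V → Fin q) :
    pottsWeight G Λ' σ = pottsWeight G Λ σ *
      if ∀ x ∈ Λ', x ∉ Λ → ∀ y, y ∉ Λ → G.Adj x y → σ x ≠ σ y then 1 else 0 := by
  unfold pottsWeight
  rw [ite_zero_mul_ite_zero, one_mul]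
  congr 1
  refine propext ⟨fun H => ⟨fun x hx => H x (h hx), fun x hx _ y _ => H x hx y⟩, ?_⟩
  rintro ⟨H1, H2⟩ x hx y hxy
  by_cases hxΛ : x ∈ Λ
  · exact H1 x hxΛ y hxy
  · by_cases hyΛ : y ∈ Λ
    · exact (H1 y hyΛ x hxy.symm).symm
    · exact H2 x hx hxΛ y hyΛ hxy

theorem exists_isGibbs_pottsWeight [Countable V] {N : V → Finset V}
    (hN : ∀ x y, G.Adj x y → y ∈ N x) (hq : ∀ x, (N x).card < q) (hq0 : 0 < q) :
    ∃ μ, IsGibbs (pottsWeight (q := q) G) μ := by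
  classical
  have hS := isSpec_pottsWeight (q := q) hN hq
  refine exists_isGibbs hS (fun _ => ⟨0, hq0⟩) fun Λ Λ' h f ω => ?_
  refine avg_avg h (pottsWeight_eq_mul h) (fun σ σ' hσ => ?_) (hS.sum_kernel Λ) f ω
  refine if_congr ?_ rfl rfl
  refine forall₃_congr fun x _ hx => forall₃_congr fun y hy _ => ?_
  rw [hσ x hx, hσ y hy]

end Potts


/-! ### Summing out non-interacting clusters. -/

section Decimation

variable {V κ : Type} {q : ℕ} {G : SimpleGraph V} {cl : κ → Finset V}

/-- Non-interacting clusters in a locally finite graph whose remaining sites are pairwise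
non-adjacent, each of them touching finitely many clusters. -/
structure IsDecimation (G : SimpleGraph V) (cl : κ → Finset V) : Prop where
  nonInteracting : NonInteracting G cl
  isolated : ∀ x y : Remaining cl, ¬ G.Adj x.1 y.1
  finite_nbr : ∀ x, (G.neighborSet x).Finite
  finite_touch : ∀ y : Remaining cl, {c | y ∈ boundary G cl c}.Finite

namespace IsDecimation

variable (hD : IsDecimation G cl)
include hD

theorem finite_touched (Λ : Finset (Remaining cl)) :
    {c | ∃ y ∈ Λ, y ∈ boundary G cl c}.Finite := by
  have : {c | ∃ y ∈ Λ, y ∈ boundary G cl c} = ⋃ y ∈ Λ, {c | y ∈ boundary G cl c} := by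
    ext c; simp
  rw [this]
  exact Λ.finite_toSet.biUnion fun y _ => hD.finite_touch y

theorem finite_boundary (c : κ) : (boundary G cl c).Finite := by
  have : (Subtype.val '' boundary G cl c) ⊆ ⋃ x ∈ cl c, G.neighborSet x := by
    rintro _ ⟨y, ⟨x, hx, hxy⟩, rfl⟩
    exact Set.mem_biUnion hx hxy
  exact Set.Finite.of_finite_image
    (((cl c).finite_toSet.biUnion fun x _ => hD.finite_nbr x).subset this)
    Subtype.val_injective.injOn

theorem cluster_unique {c c' : κ} {x : V} (h : x ∈ cl c) (h' : x ∈ cl c') : c = c' := by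
  by_contra hne
  exact Finset.disjoint_left.1 (hD.nonInteracting c c' hne).1 h h'

end IsDecimation

/-- The clusters touching `Λ`. -/
noncomputable def touched (hD : IsDecimation G cl) (Λ : Finset (Remaining cl)) : Finset κ :=
  (hD.finite_touched Λ).toFinset

theorem mem_touched {hD : IsDecimation G cl} {Λ : Finset (Remaining cl)} {c : κ} :
    c ∈ touched hD Λ ↔ ∃ y ∈ Λ, y ∈ boundary G cl c := by
  simp [touched]

open Classical in
/-- The set `Λ` together with all clusters touching it. -/
noncomputable def thicken (hD : IsDecimation G cl) (Λ : Finset (Remaining cl)) : Finset V :=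
  Λ.map (Function.Embedding.subtype _) ∪ (touched hD Λ).biUnion cl

theorem mem_thicken {hD : IsDecimation G cl} {Λ : Finset (Remaining cl)} {x : V} :
    x ∈ thicken hD Λ ↔ (∃ h, (⟨x, h⟩ : Remaining cl) ∈ Λ) ∨ ∃ c ∈ touched hD Λ, x ∈ cl c := by
  simp [thicken]

theorem remaining_mem_thicken {hD : IsDecimation G cl} {Λ : Finset (Remaining cl)}
    {y : Remaining cl} : y.1 ∈ thicken hD Λ ↔ y ∈ Λ := by
  rw [mem_thicken]
  constructor
  · rintro (⟨_, h⟩ | ⟨c, -, h⟩)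
    · exact h
    · exact absurd h (y.2 c)
  · exact fun h => Or.inl ⟨y.2, h⟩

open Classical in
/-- The factor of the cluster `c`. -/
noncomputable def clusterFactor (G : SimpleGraph V) (cl : κ → Finset V) (c : κ)
    (s : cl c → Fin q) (t : Remaining cl → Fin q) : ℝ :=
  if (∀ x y : (cl c), G.Adj x y → s x ≠ s y) ∧
    (∀ (x : (cl c)) (y : Remaining cl), G.Adj x y → s x ≠ t y) then 1 else 0

/-- No two remaining sites and no two clusters are joined, so every edge meeting the thickened set
meets exactly one cluster, and this cluster touches `Λ`. -/
theorem pottsWeight_thicken (hD : IsDecimation G cl) (Λ : Finset (Remaining cl))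
    (σ : V → Fin q) : pottsWeight G (thicken hD Λ) σ =
      ∏ c ∈ touched hD Λ, clusterFactor G cl c (fun x => σ x) (restrictRemaining cl σ) := by
  classical
  unfold pottsWeight clusterFactor
  rw [Finset.prod_ite_zero]
  simp only [Finset.prod_const_one]
  refine if_congr ⟨fun H c hc => ⟨fun x y hxy => ?_, fun x y hxy => ?_⟩, fun H x hx y hxy => ?_⟩
    rfl rfl
  · exact H x (mem_thicken.2 (Or.inr ⟨c, hc, x.2⟩)) y hxy
  · exact H x (mem_thicken.2 (Or.inr ⟨c, hc, x.2⟩)) y hxy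
  · rcases mem_thicken.1 hx with ⟨hr, hxΛ⟩ | ⟨c, hc, hxc⟩
    · by_cases hy : ∀ c, y ∉ cl c
      · exact absurd hxy (hD.isolated ⟨x, hr⟩ ⟨y, hy⟩)
      · push Not at hy
        obtain ⟨c, hyc⟩ := hy
        have hc : c ∈ touched hD Λ := mem_touched.2 ⟨_, hxΛ, y, hyc, hxy.symm⟩
        exact ((H c hc).2 ⟨y, hyc⟩ ⟨x, hr⟩ hxy.symm).symm
    · by_cases hy : ∀ c, y ∉ cl c
      · exact (H c hc).2 ⟨x, hxc⟩ ⟨y, hy⟩ hxy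
      · push Not at hy
        obtain ⟨c', hyc⟩ := hy
        by_cases hcc : c = c'
        · subst hcc
          exact (H c hc).1 ⟨x, hxc⟩ ⟨y, hyc⟩ hxy
        · exact absurd hxy ((hD.nonInteracting c c' hcc).2 x hxc y hyc)

theorem effectiveWeight_eq_sum (c : κ) (t : Remaining cl → Fin q) [DecidableEq (cl c)] :
    effectiveWeight G cl c t = ∑ s : cl c → Fin q, clusterFactor G cl c s t := by
  unfold effectiveWeight clusterFactor
  congr!

theorem decimatedWeight_eq_prod (hD : IsDecimation G cl) (Λ : Finset (Remaining cl))
    (t : Remaining cl → Fin q) :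
    decimatedWeight G cl Λ t = ∏ c ∈ touched hD Λ, effectiveWeight G cl c t := by
  unfold decimatedWeight
  have h1 : pottsWeight (G.comap Subtype.val) Λ t = 1 :=
    if_pos fun x _ y hxy => absurd hxy (hD.isolated x y)
  rw [h1, one_mul]
  have : {c | ∃ y ∈ Λ, y ∈ boundary G cl c} = (touched hD Λ : Set κ) := by
    ext c; simp [mem_touched]
  exact (finprod_mem_congr this fun _ _ => rfl).trans (finprod_mem_coe_finset _ _)

theorem restrictRemaining_glue (hD : IsDecimation G cl) (Λ : Finset (Remaining cl)) (ω : V → Fin q)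
    (ρ : thicken hD Λ → Fin q) : restrictRemaining cl (glue ω (thicken hD Λ) ρ) =
      glue (restrictRemaining cl ω) Λ fun y => ρ ⟨y.1.1, remaining_mem_thicken.2 y.2⟩ := by
  funext y
  by_cases hy : y ∈ Λ
  · rw [glue_apply_mem hy]
    exact glue_apply_mem (remaining_mem_thicken.2 hy)
  · rw [glue_apply_notMem hy]
    exact glue_apply_notMem fun h => hy (remaining_mem_thicken.1 h)

open Classical in
/-- Summing out the clusters touching `Λ`. -/
theorem sum_pottsWeight_thicken (hD : IsDecimation G cl) (Λ : Finset (Remaining cl))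
    (ω : V → Fin q) (F : (Remaining cl → Fin q) → ℝ) :
    ∑ ρ : thicken hD Λ → Fin q, pottsWeight G (thicken hD Λ) (glue ω (thicken hD Λ) ρ) *
        F (restrictRemaining cl (glue ω (thicken hD Λ) ρ)) =
      ∑ τ : Λ → Fin q, decimatedWeight G cl Λ (glue (restrictRemaining cl ω) Λ τ) *
        F (glue (restrictRemaining cl ω) Λ τ) := by
  have hmem : ∀ (c : touched hD Λ) (x : cl c.1), x.1 ∈ thicken hD Λ := fun c x =>
    mem_thicken.2 (Or.inr ⟨c.1, c.2, x.2⟩)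
  -- The clusters being disjoint, a configuration of the thickened set is a configuration on `Λ`
  -- together with an independent choice on each touched cluster. The sum of products then
  -- factorises into effective weights.
  let Φ : (thicken hD Λ → Fin q) → (Λ → Fin q) × ((c : touched hD Λ) → cl c.1 → Fin q) := fun ρ =>
    (fun y => ρ ⟨y.1.1, remaining_mem_thicken.2 y.2⟩, fun c x => ρ ⟨x.1, hmem c x⟩)
  have hΦ : Function.Bijective Φ := by
    constructor
    · intro ρ ρ' h
      funext x
      rcases mem_thicken.1 x.2 with ⟨hr, hx⟩ | ⟨c, hc, hx⟩
      · exact congrFun (congrArg Prod.fst h) ⟨⟨x.1, hr⟩, hx⟩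
      · exact congrFun (congrFun (congrArg Prod.snd h) ⟨c, hc⟩) ⟨x.1, hx⟩
    · rintro ⟨τ, s⟩
      have hex : ∀ x : thicken hD Λ, ∃ a : Fin q,
          (∀ y : Λ, y.1.1 = x.1 → τ y = a) ∧
          ∀ (c : touched hD Λ) (z : cl c.1), z.1 = x.1 → s c z = a := by
        intro x
        rcases mem_thicken.1 x.2 with ⟨hr, hx⟩ | ⟨c, hc, hx⟩
        · refine ⟨τ ⟨⟨x.1, hr⟩, hx⟩, fun y hy => ?_, fun c z hz => ?_⟩
          · exact congrArg τ (Subtype.ext (Subtype.ext hy))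
          · exact absurd (hz ▸ z.2) (hr c.1)
        · refine ⟨s ⟨c, hc⟩ ⟨x.1, hx⟩, fun y hy => ?_, fun c' z hz => ?_⟩
          · exact absurd (hy ▸ hx) (y.1.2 c)
          · have : c' = ⟨c, hc⟩ := Subtype.ext (hD.cluster_unique (hz ▸ z.2) hx)
            subst this
            exact congrArg _ (Subtype.ext hz)
      choose ρ h1 h2 using hex
      refine ⟨ρ, Prod.ext ?_ ?_⟩
      · funext y
        exact (h1 _ y rfl).symm
      · funext c x
        exact (h2 _ c x rfl).symm
  calc _ = ∑ p : (Λ → Fin q) × ((c : touched hD Λ) → cl c.1 → Fin q),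
        (∏ c : touched hD Λ, clusterFactor G cl c.1 (p.2 c)
          (glue (restrictRemaining cl ω) Λ p.1)) * F (glue (restrictRemaining cl ω) Λ p.1) := by
        refine Fintype.sum_bijective Φ hΦ _ _ fun ρ => ?_
        rw [restrictRemaining_glue, pottsWeight_thicken, restrictRemaining_glue]
        congr 1
        rw [← Finset.prod_attach]
        refine Finset.prod_congr rfl fun c _ => ?_
        congr 1
        funext x
        exact glue_apply_mem (hmem c x)
    _ = _ := by
        rw [Fintype.sum_prod_type]
        refine Finset.sum_congr rfl fun τ _ => ?_
        dsimp only
        rw [← Finset.sum_mul, decimatedWeight_eq_prod hD]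
        congr 1
        rw [← Finset.prod_attach]
        simp only [effectiveWeight_eq_sum]
        rw [Finset.attach_eq_univ, Finset.prod_univ_sum, Fintype.piFinset_univ]

/-- Decimation intertwines the averages. -/
theorem avg_thicken (hD : IsDecimation G cl) (Λ : Finset (Remaining cl)) (ω : V → Fin q)
    (F : (Remaining cl → Fin q) → ℝ) :
    avg (pottsWeight G) (thicken hD Λ) (fun σ => F (restrictRemaining cl σ)) ω =
      avg (decimatedWeight G cl) Λ F (restrictRemaining cl ω) := by
  classical
  have h1 := sum_pottsWeight_thicken hD Λ ω F
  -- The constant function `1` identifies the two partition functions.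
  have h2 := sum_pottsWeight_thicken hD Λ ω fun _ => 1
  simp only [mul_one] at h2
  unfold avg kernel
  simp only [div_mul_eq_mul_div]
  rw [← Finset.sum_div, ← Finset.sum_div]
  refine congrArg₂ (· / ·) ?_ ?_
  · convert h1
  · convert h2

theorem effectiveWeight_nonneg (c : κ) (t : Remaining cl → Fin q) :
    0 ≤ effectiveWeight G cl c t := by
  classical
  exact Finset.sum_nonneg fun s _ => by split_ifs <;> simp

theorem dependsOn_effectiveWeight (c : κ) :
    DependsOn (effectiveWeight (q := q) G cl c) (boundary G cl c) := by
  intro t t' h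
  classical
  unfold effectiveWeight
  refine Finset.sum_congr rfl fun s _ => if_congr ?_ rfl rfl
  refine and_congr_right fun _ => forall₃_congr fun x y hxy => ?_
  rw [h y ⟨x, x.2, hxy⟩]

theorem decimatedWeight_nonneg (hD : IsDecimation G cl) (Λ : Finset (Remaining cl))
    (t : Remaining cl → Fin q) : 0 ≤ decimatedWeight G cl Λ t := by
  rw [decimatedWeight_eq_prod hD]
  exact Finset.prod_nonneg fun c _ => effectiveWeight_nonneg c t

theorem finiteRange_decimatedWeight (hD : IsDecimation G cl) :
    FiniteRange (decimatedWeight (q := q) G cl) := by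
  classical
  intro Λ
  refine ⟨(touched hD Λ).biUnion fun c => (hD.finite_boundary c).toFinset, fun t t' h => ?_⟩
  rw [decimatedWeight_eq_prod hD, decimatedWeight_eq_prod hD]
  refine Finset.prod_congr rfl fun c hc => dependsOn_effectiveWeight c fun y hy => h y ?_
  simp only [Finset.coe_biUnion, Set.mem_iUnion, Finset.mem_coe, Set.Finite.mem_toFinset]
  exact ⟨c, hc, hy⟩

theorem isSpec_decimatedWeight (hD : IsDecimation G cl) [Nonempty (Fin q)]
    (hpos : ∀ (c : κ) (t : Remaining cl → Fin q), 0 < effectiveWeight G cl c t) :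
    IsSpec (decimatedWeight (q := q) G cl) where
  nonneg := decimatedWeight_nonneg hD
  finiteRange := finiteRange_decimatedWeight hD
  pos Λ ω := by
    have h : ∀ t : Remaining cl → Fin q, 0 < decimatedWeight G cl Λ t := fun t => by
      rw [decimatedWeight_eq_prod hD]
      exact Finset.prod_pos fun c _ => hpos c _
    convert Finset.sum_pos (fun (τ : Λ → Fin q) _ => h (glue ω Λ τ)) Finset.univ_nonempty

theorem measurable_restrictRemaining :
    Measurable (restrictRemaining (q := q) cl) :=
  measurable_pi_iff.2 fun x => measurable_pi_apply x.1

theorem dependsOn_comp_restrict {β : Type} {F : (Remaining cl → Fin q) → β}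
    {S : Finset (Remaining cl)} (hF : DependsOn F (S : Set (Remaining cl))) :
    DependsOn (fun σ : V → Fin q => F (restrictRemaining cl σ))
      ((S.map (Function.Embedding.subtype _) : Finset V) : Set V) := by
  intro σ σ' h
  refine hF fun y hy => h y.1 ?_
  simp only [Finset.coe_map, Set.mem_image, Finset.mem_coe]
  exact ⟨y, hy, rfl⟩

/-- The marginal of a Gibbs measure on the remaining sites is a Gibbs measure of the decimated
system. -/
theorem isGibbs_map_restrictRemaining [Countable V] (hD : IsDecimation G cl)
    (hW : FiniteRange (pottsWeight (q := q) G)) {μ : Measure (V → Fin q)}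
    (hμ : IsGibbs (pottsWeight G) μ) :
    IsGibbs (decimatedWeight G cl) (μ.map (restrictRemaining cl)) := by
  have := hμ.1
  have := Measure.isProbabilityMeasure_map (μ := μ)
    (measurable_restrictRemaining (q := q) (cl := cl)).aemeasurable
  refine isGibbs_of_local (decimatedWeight_nonneg hD) (finiteRange_decimatedWeight hD)
    fun Λ F S hF => ?_
  have hm := measurable_avg (finiteRange_decimatedWeight hD) Λ (measurable_of_dependsOn hF)
  rw [integral_map measurable_restrictRemaining.aemeasurable hm.aestronglyMeasurable,
    integral_map measurable_restrictRemaining.aemeasurable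
      (measurable_of_dependsOn hF).aestronglyMeasurable]
  rw [← hμ.integral_avg_local (pottsWeight_nonneg G) hW (thicken hD Λ)
    (dependsOn_comp_restrict hF)]
  exact integral_congr_ae (.of_forall fun σ => (avg_thicken hD Λ σ F).symm)

end Decimation


/-! ### Effect of a block average on oscillations. -/

section BlockAverage

variable {V : Type} {q : ℕ} {W : Finset V → (V → Fin q) → ℝ}

theorem abs_sum_sub_sum_le {ι : Type*} [Fintype ι] {p p' a b : ι → ℝ} (hp : ∀ x, 0 ≤ p x)
    (hp' : ∀ x, 0 ≤ p' x) (h1 : ∑ x, p x = 1) (h1' : ∑ x, p' x = 1) {D : ℝ}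
    (hD : ∀ x y, |a x - b y| ≤ D) : |∑ x, p x * a x - ∑ x, p' x * b x| ≤ D := by
  have h2 : ∀ x, |a x - ∑ y, p' y * b y| ≤ D := by
    intro x
    have e : a x - ∑ y, p' y * b y = ∑ y, p' y * (a x - b y) := by
      simp only [mul_sub, Finset.sum_sub_distrib, ← Finset.sum_mul, h1', one_mul]
    rw [e]
    refine (Finset.abs_sum_le_sum_abs _ _).trans ?_
    calc _ ≤ ∑ y, p' y * D := Finset.sum_le_sum fun y _ => by
          rw [abs_mul, abs_of_nonneg (hp' y)]
          exact mul_le_mul_of_nonneg_left (hD x y) (hp' y)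
      _ = D := by rw [← Finset.sum_mul, h1', one_mul]
  have e : ∑ x, p x * a x - ∑ x, p' x * b x = ∑ x, p x * (a x - ∑ y, p' y * b y) := by
    simp only [mul_sub, Finset.sum_sub_distrib, ← Finset.sum_mul, h1, one_mul]
  rw [e]
  refine (Finset.abs_sum_le_sum_abs _ _).trans ?_
  calc _ ≤ ∑ x, p x * D := Finset.sum_le_sum fun x _ => by
        rw [abs_mul, abs_of_nonneg (hp x)]
        exact mul_le_mul_of_nonneg_left (h2 x) (hp x)
    _ = D := by rw [← Finset.sum_mul, h1, one_mul]

theorem oscillation_avg_eq_zero (f : (V → Fin q) → ℝ) {Λ : Finset V} {y : V} (hy : y ∈ Λ) :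
    oscillation (avg W Λ f) y = 0 :=
  oscillation_eq_zero (S := {x | x ∉ Λ}) (fun _ _ h => avg_congr W Λ f h) (by simpa using hy)

/-- Any two outcomes are compared, as they differ only on `Λ` and at `y`. This bound does not
contract, which is harmless because each cluster is averaged only once. -/
theorem oscillation_avg_le_add (hS : IsSpec W) (Λ : Finset V) {f : (V → Fin q) → ℝ}
    {C : ℝ} (hC : ∀ σ, |f σ| ≤ C) (y : V) :
    oscillation (avg W Λ f) y ≤ oscillation f y + ∑ x ∈ Λ, oscillation f x := by
  classical
  have hfin : ∑ x ∈ insert y Λ, oscillation f x ≠ ∞ :=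
    (ENNReal.sum_lt_top.2 fun i _ => oscillation_lt_top hC i).ne
  have hle : ∑ x ∈ insert y Λ, oscillation f x ≤ oscillation f y + ∑ x ∈ Λ, oscillation f x := by
    by_cases hy : y ∈ Λ
    · rw [Finset.insert_eq_of_mem hy]; exact le_add_self
    · rw [Finset.sum_insert hy]
  refine oscillation_le fun ω ω' h => le_trans ?_ hle
  refine (ENNReal.ofReal_le_iff_le_toReal hfin).2 ?_
  refine abs_sum_sub_sum_le (fun _ => kernel_nonneg hS.nonneg _ _ _)
    (fun _ => kernel_nonneg hS.nonneg _ _ _) (hS.sum_kernel _ _) (hS.sum_kernel _ _)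
    fun τ τ' => (ENNReal.ofReal_le_iff_le_toReal hfin).1
      (ofReal_abs_sub_le_sum_oscillation f _ fun k hk => ?_)
  rw [Finset.mem_insert, not_or] at hk
  rw [glue_apply_notMem hk.2, glue_apply_notMem hk.2, h k hk.1]

theorem oscillation_avg_le_self (hS : IsSpec W) (Λ : Finset V) {f : (V → Fin q) → ℝ}
    {C : ℝ} (hC : ∀ σ, |f σ| ≤ C) {y : V} (hk : ∀ (ω ω' : V → Fin q) (τ : Λ → Fin q),
      (∀ x, x ≠ y → ω x = ω' x) → kernel W Λ ω τ = kernel W Λ ω' τ) :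
    oscillation (avg W Λ f) y ≤ oscillation f y := by
  classical
  have hfin : oscillation f y ≠ ∞ := (oscillation_lt_top hC y).ne
  refine oscillation_le fun ω ω' h => (ENNReal.ofReal_le_iff_le_toReal hfin).2 ?_
  unfold avg
  simp only [fun τ => hk ω ω' τ h]
  rw [← Finset.sum_sub_distrib]
  refine (Finset.abs_sum_le_sum_abs _ _).trans ?_
  calc _ ≤ ∑ τ : Λ → Fin q, kernel W Λ ω' τ * (oscillation f y).toReal := by
        refine Finset.sum_le_sum fun τ _ => ?_
        rw [← mul_sub, abs_mul, abs_of_nonneg (kernel_nonneg hS.nonneg _ _ _)]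
        refine mul_le_mul_of_nonneg_left ?_ (kernel_nonneg hS.nonneg _ _ _)
        refine (ENNReal.ofReal_le_iff_le_toReal hfin).1 (le_oscillation f fun k hk => ?_)
        by_cases hkΛ : k ∈ Λ
        · rw [glue_apply_mem hkΛ, glue_apply_mem hkΛ]
        · rw [glue_apply_notMem hkΛ, glue_apply_notMem hkΛ, h k hk]
    _ = _ := by rw [← Finset.sum_mul, hS.sum_kernel, one_mul]

end BlockAverage

/-! ### From Dobrushin's condition after decimation to the original system. -/

section Transfer

variable {V κ : Type} {q : ℕ} {G : SimpleGraph V} {cl : κ → Finset V}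

theorem kernel_pottsWeight_congr (Λ : Finset V) {y : V} (hy : y ∉ Λ)
    (hadj : ∀ x ∈ Λ, ¬ G.Adj x y) (ω ω' : V → Fin q) (τ : Λ → Fin q)
    (h : ∀ x, x ≠ y → ω x = ω' x) :
    kernel (pottsWeight G) Λ ω τ = kernel (pottsWeight G) Λ ω' τ := by
  have key : ∀ τ : Λ → Fin q, pottsWeight G Λ (glue ω Λ τ) = pottsWeight G Λ (glue ω' Λ τ) := by
    intro τ
    have hg : ∀ x, x ≠ y → glue ω Λ τ x = glue ω' Λ τ x := fun x hx => by
      by_cases hxΛ : x ∈ Λ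
      · rw [glue_apply_mem hxΛ, glue_apply_mem hxΛ]
      · rw [glue_apply_notMem hxΛ, glue_apply_notMem hxΛ, h x hx]
    classical
    unfold pottsWeight
    refine if_congr (forall₂_congr fun x hx => forall₂_congr fun z hxz => ?_) rfl rfl
    rw [hg x fun e => hy (e ▸ hx), hg z fun e => hadj x hx (e ▸ hxz)]
  simp only [kernel, key]

open Classical in
theorem tsum_ite_mem_add (T : Finset V) (F : V → ℝ≥0∞) :
    ∑' x, (if x ∈ T then 0 else F x) + ∑ x ∈ T, F x = ∑' x, F x := by
  have h : ∑ x ∈ T, F x = ∑' x, if x ∈ T then F x else 0 := by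
    rw [tsum_eq_sum (s := T) fun x hx => by simp [hx]]
    exact Finset.sum_congr rfl fun x hx => by simp [hx]
  rw [h, ← ENNReal.tsum_add]
  refine tsum_congr fun x => ?_
  split_ifs <;> simp

/-- The neighbours of the cluster `c` outside it. -/
noncomputable def outerBoundary (hD : IsDecimation G cl) (c : κ) : Finset V :=
  (hD.finite_boundary c).toFinset.map (Function.Embedding.subtype _)

theorem mem_outerBoundary {hD : IsDecimation G cl} {c : κ} {y : V} :
    y ∈ outerBoundary hD c ↔ ∃ h : ∀ c, y ∉ cl c, (⟨y, h⟩ : Remaining cl) ∈ boundary G cl c := by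
  simp [outerBoundary]

theorem oscillation_avg_cluster_le (hD : IsDecimation G cl)
    (hS : IsSpec (pottsWeight (q := q) G)) (c : κ) {f : (V → Fin q) → ℝ} {C : ℝ}
    (hC : ∀ σ, |f σ| ≤ C) {y : V} (hy : y ∉ outerBoundary hD c) :
    oscillation (avg (pottsWeight G) (cl c) f) y ≤ oscillation f y := by
  by_cases hyc : y ∈ cl c
  · rw [oscillation_avg_eq_zero f hyc]; exact bot_le
  · refine oscillation_avg_le_self hS (cl c) hC (kernel_pottsWeight_congr (cl c) hyc ?_)
    intro x hx hxy
    by_cases hr : ∀ c, y ∉ cl c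
    · exact hy (mem_outerBoundary.2 ⟨hr, x, hx, hxy⟩)
    · push Not at hr
      obtain ⟨c', hyc'⟩ := hr
      have hne : c ≠ c' := fun e => hyc (e ▸ hyc')
      exact (hD.nonInteracting c c' hne).2 x hx y hyc' hxy

/-- Averaging over a cluster moves its oscillation to each site of the outer boundary with
coefficient at most one. So `w` on the cluster has to dominate the sum of `w` over that boundary,
plus the error rate `B`. -/
theorem tsum_oscillation_avg_cluster_le (hD : IsDecimation G cl)
    (hS : IsSpec (pottsWeight (q := q) G)) (c : κ) {f : (V → Fin q) → ℝ} {C : ℝ}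
    (hC : ∀ σ, |f σ| ≤ C) {B : ℝ≥0∞} {w : V → ℝ≥0∞}
    (hw : ∀ x ∈ cl c, B + ∑ y ∈ outerBoundary hD c, w y ≤ w x) :
    B * ∑ x ∈ cl c, oscillation f x +
      ∑' y, oscillation (avg (pottsWeight G) (cl c) f) y * w y ≤ ∑' y, oscillation f y * w y := by
  classical
  set s := ∑ x ∈ cl c, oscillation f x with hs
  have h1 : ∀ y, oscillation (avg (pottsWeight G) (cl c) f) y * w y ≤
      (if y ∈ cl c then 0 else oscillation f y * w y) +
        if y ∈ outerBoundary hD c then s * w y else 0 := by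
    intro y
    by_cases hyc : y ∈ cl c
    · rw [oscillation_avg_eq_zero f hyc]; simp
    · rw [if_neg hyc]
      by_cases hyb : y ∈ outerBoundary hD c
      · rw [if_pos hyb, ← add_mul]
        gcongr
        exact oscillation_avg_le_add hS _ hC y
      · rw [if_neg hyb, add_zero]
        gcongr
        exact oscillation_avg_cluster_le hD hS c hC hyb
  have h2 : ∑' y, (if y ∈ outerBoundary hD c then s * w y else 0) =
      s * ∑ y ∈ outerBoundary hD c, w y := by
    rw [tsum_eq_sum (s := outerBoundary hD c) fun x hx => by simp [hx], Finset.mul_sum]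
    exact Finset.sum_congr rfl fun x hx => by simp [hx]
  calc B * s + ∑' y, oscillation (avg (pottsWeight G) (cl c) f) y * w y
      ≤ B * s + (∑' y, (if y ∈ cl c then 0 else oscillation f y * w y) +
          s * ∑ y ∈ outerBoundary hD c, w y) := by
        rw [← h2, ← ENNReal.tsum_add]
        gcongr
        exact h1 _
    _ = ∑' y, (if y ∈ cl c then 0 else oscillation f y * w y) +
          ∑ x ∈ cl c, oscillation f x * (B + ∑ y ∈ outerBoundary hD c, w y) := by
        rw [← Finset.sum_mul, ← hs]; ring
    _ ≤ ∑' y, (if y ∈ cl c then 0 else oscillation f y * w y) +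
          ∑ x ∈ cl c, oscillation f x * w x := by
        gcongr with x hx
        exact hw x hx
    _ = _ := tsum_ite_mem_add _ _

/-- The outer boundary of a cluster consists of remaining sites, so averaging over one cluster
raises no oscillation inside another: a cluster once cleared stays clear. -/
theorem exists_cluster_sweep (hD : IsDecimation G cl) (hS : IsSpec (pottsWeight (q := q) G))
    {B : κ → ℝ≥0∞} {w : V → ℝ≥0∞}
    (hw : ∀ c, ∀ x ∈ cl c, B c + ∑ y ∈ outerBoundary hD c, w y ≤ w x)
    {E : ((V → Fin q) → ℝ) → ℝ}
    (hE : ∀ (c : κ) (f : (V → Fin q) → ℝ) (S : Finset V), DependsOn f (S : Set V) →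
      ENNReal.ofReal |E f| ≤ ENNReal.ofReal |E (avg (pottsWeight G) (cl c) f)| +
        B c * ∑ x ∈ cl c, oscillation f x)
    {f : (V → Fin q) → ℝ} {S : Finset V} (hf : DependsOn f (S : Set V)) (T : Finset κ) :
    ∃ (g : (V → Fin q) → ℝ) (S' : Finset V) (e : ℝ≥0∞), DependsOn g (S' : Set V) ∧
      (∀ c ∈ T, ∀ x ∈ cl c, oscillation g x = 0) ∧
      (∀ c, ∀ x ∈ cl c, oscillation g x ≤ oscillation f x) ∧
      ENNReal.ofReal |E f| ≤ ENNReal.ofReal |E g| + e ∧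
      e + ∑' x, oscillation g x * w x ≤ ∑' x, oscillation f x * w x := by
  classical
  induction T using Finset.induction_on with
  | empty => exact ⟨f, S, 0, hf, by simp, fun _ _ _ => le_rfl, by simp, by simp⟩
  | insert a T ha ih =>
    obtain ⟨g, S', e, hg, h0, hle, hEg, he⟩ := ih
    obtain ⟨S'', hS''⟩ := dependsOn_avg hS.finiteRange (cl a) hg
    obtain ⟨C, hC⟩ := bounded_of_dependsOn hg
    have hmono : ∀ c, ∀ x ∈ cl c,
        oscillation (avg (pottsWeight G) (cl a) g) x ≤ oscillation g x := fun c x hx =>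
      oscillation_avg_cluster_le hD hS a hC fun h => (mem_outerBoundary.1 h).1 c hx
    refine ⟨avg (pottsWeight G) (cl a) g, S'', B a * ∑ x ∈ cl a, oscillation g x + e, hS'',
      fun c hc x hx => ?_, fun c x hx => (hmono c x hx).trans (hle c x hx), ?_, ?_⟩
    · rcases Finset.mem_insert.1 hc with rfl | hc
      · exact oscillation_avg_eq_zero g hx
      · exact le_antisymm ((hmono c x hx).trans (h0 c hc x hx).le) bot_le
    · refine hEg.trans ?_
      rw [← add_assoc]
      gcongr
      exact hE a g S' hg
    · refine le_trans ?_ he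
      rw [add_right_comm, add_comm]
      gcongr
      exact tsum_oscillation_avg_cluster_le hD hS a hC (hw a)

theorem oscillation_comp_restrict_eq_zero {F : (Remaining cl → Fin q) → ℝ} {c : κ} {x : V}
    (hx : x ∈ cl c) : oscillation (fun σ : V → Fin q => F (restrictRemaining cl σ)) x = 0 := by
  refine le_antisymm (oscillation_le fun σ σ' h => ?_) bot_le
  have : restrictRemaining cl σ = restrictRemaining cl σ' :=
    funext fun y => h y.1 fun e => y.2 c (e ▸ hx)
  simp [this]

theorem oscillation_comp_restrict_le (F : (Remaining cl → Fin q) → ℝ) (i : Remaining cl) :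
    oscillation (fun σ : V → Fin q => F (restrictRemaining cl σ)) i.1 ≤ oscillation F i :=
  oscillation_le fun _ _ h => le_oscillation F fun k hk => h k.1 fun e => hk (Subtype.ext e)

theorem tsum_oscillation_comp_restrict_le (F : (Remaining cl → Fin q) → ℝ) :
    ∑' x, oscillation (fun σ : V → Fin q => F (restrictRemaining cl σ)) x ≤
      ∑' i, oscillation F i := by
  rw [← tsum_subtype_eq_of_support_subset (s := {x | ∀ c, x ∉ cl c})]
  · exact ENNReal.tsum_le_tsum fun i => oscillation_comp_restrict_le F i
  · intro x hx c hxc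
    exact hx (oscillation_comp_restrict_eq_zero hxc)

-- Cluster spins are filled in from `ω`. As `g` is local only finitely many of them matter, and each
-- can be changed without effect.
open Classical in
theorem exists_eq_comp_restrict {g : (V → Fin q) → ℝ} {S : Finset V}
    (hg : DependsOn g (S : Set V)) (h0 : ∀ c, ∀ x ∈ cl c, oscillation g x = 0) (ω : V → Fin q) :
    ∃ (F : (Remaining cl → Fin q) → ℝ) (S' : Finset (Remaining cl)),
      DependsOn F (S' : Set (Remaining cl)) ∧ (∀ σ, g σ = F (restrictRemaining cl σ)) ∧
      ∀ i, oscillation F i ≤ oscillation g i.1 := by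
  let ext : (Remaining cl → Fin q) → V → Fin q := fun t x =>
    if h : ∀ c, x ∉ cl c then t ⟨x, h⟩ else ω x
  have hext : ∀ (t : Remaining cl → Fin q) (y : Remaining cl), ext t y.1 = t y := fun t y =>
    dif_pos y.2
  refine ⟨fun t => g (ext t), S.subtype _, fun t t' h => hg fun x hx => ?_, fun σ => ?_,
    fun i => oscillation_le fun t t' h => le_oscillation g fun x hx => ?_⟩
  · by_cases hr : ∀ c, x ∉ cl c
    · simp only [ext, dif_pos hr]
      exact h _ (by simpa using hx)
    · simp only [ext, dif_neg hr]
  · have e1 : g σ = g (glue (ext (restrictRemaining cl σ)) S fun x => σ x) :=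
      hg fun x hx => (glue_apply_mem (τ := fun x => σ x) (Finset.mem_coe.1 hx)).symm
    have e2 := ofReal_abs_sub_le_sum_oscillation g (S.filter fun x => ¬ ∀ c, x ∉ cl c)
      (σ := glue (ext (restrictRemaining cl σ)) S fun x => σ x)
      (σ' := ext (restrictRemaining cl σ)) fun k hk => by
        by_cases hkS : k ∈ S
        · rw [glue_apply_mem hkS]
          have hr : ∀ c, k ∉ cl c := by
            by_contra hr
            exact hk (Finset.mem_filter.2 ⟨hkS, hr⟩)
          exact (hext (restrictRemaining cl σ) ⟨k, hr⟩).symm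
        · exact glue_apply_notMem hkS
    rw [Finset.sum_eq_zero fun x hx => ?_] at e2
    · rw [e1]
      have e3 := ENNReal.ofReal_eq_zero.1 (le_antisymm e2 bot_le)
      exact sub_eq_zero.1 (abs_eq_zero.1 (le_antisymm e3 (abs_nonneg _)))
    · have := (Finset.mem_filter.1 hx).2
      push Not at this
      obtain ⟨c, hc⟩ := this
      exact h0 c x hc
  · by_cases hr : ∀ c, x ∉ cl c
    · simp only [ext, dif_pos hr]
      exact h _ fun e => hx (congrArg Subtype.val e)
    · simp only [ext, dif_neg hr]

/-- The sweeping bound for the original system, through the decimated one. -/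
theorem ofReal_abs_le_of_decimation (hD : IsDecimation G cl) (hS : IsSpec (pottsWeight (q := q) G))
    (hSd : IsSpec (decimatedWeight (q := q) G cl)) {k : Remaining cl → Remaining cl → ℝ≥0∞}
    {α : ℝ≥0∞} (hk : Dominates (decimatedWeight (q := q) G cl) k α) (hα : α < 1)
    {B : κ → ℝ≥0∞} {b : Remaining cl → ℝ≥0∞} {w : V → ℝ≥0∞}
    (hwB : ∀ c, ∀ x ∈ cl c, B c + ∑ y ∈ outerBoundary hD c, w y ≤ w x)
    (hwb : ∀ i, b i + ∑' j, k i j * w j.1 ≤ w i.1)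
    {E : ((V → Fin q) → ℝ) → ℝ}
    (hEB : ∀ (c : κ) (f : (V → Fin q) → ℝ) (S : Finset V), DependsOn f (S : Set V) →
      ENNReal.ofReal |E f| ≤ ENNReal.ofReal |E (avg (pottsWeight G) (cl c) f)| +
        B c * ∑ x ∈ cl c, oscillation f x)
    (hEb : ∀ (i : Remaining cl) (F : (Remaining cl → Fin q) → ℝ) (S : Finset (Remaining cl)),
      DependsOn F (S : Set (Remaining cl)) →
      ENNReal.ofReal |E fun σ => F (restrictRemaining cl σ)| ≤
        ENNReal.ofReal |E fun σ => avg (decimatedWeight G cl) {i} F (restrictRemaining cl σ)| +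
        b i * oscillation F i)
    {K : ℝ≥0∞} (hK : K ≠ ∞)
    (hEK : ∀ (f : (V → Fin q) → ℝ) (S : Finset V), DependsOn f (S : Set V) →
      ENNReal.ofReal |E f| ≤ K * ∑' i, oscillation f i) (ω : V → Fin q)
    {f : (V → Fin q) → ℝ} {S : Finset V} (hf : DependsOn f (S : Set V)) :
    ENNReal.ofReal |E f| ≤ ∑' x, oscillation f x * w x := by
  classical
  have hfin : {c | ∃ x ∈ S, x ∈ cl c}.Finite := by
    have : {c | ∃ x ∈ S, x ∈ cl c} ⊆ ⋃ x ∈ S, {c | x ∈ cl c} := by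
      rintro c ⟨x, hx, hxc⟩
      exact Set.mem_biUnion (Finset.mem_coe.2 hx) hxc
    refine Set.Finite.subset (S.finite_toSet.biUnion fun x _ => ?_) this
    exact Set.Subsingleton.finite fun c hc c' hc' => hD.cluster_unique hc hc'
  -- Once the clusters meeting the support are averaged out, no cluster spin matters, and the sweep
  -- of the decimated system takes over.
  obtain ⟨g, S', e, hg, h0, hle, hEg, he⟩ :=
    exists_cluster_sweep hD hS hwB hEB hf hfin.toFinset
  have hg0 : ∀ c, ∀ x ∈ cl c, oscillation g x = 0 := by
    intro c x hx
    by_cases hc : c ∈ hfin.toFinset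
    · exact h0 c hc x hx
    · refine le_antisymm ((hle c x hx).trans (oscillation_eq_zero hf fun hxS => hc ?_).le) bot_le
      exact hfin.mem_toFinset.2 ⟨x, hxS, hx⟩
  obtain ⟨F, S'', hF, hgF, hosc⟩ := exists_eq_comp_restrict hg hg0 ω
  obtain rfl : g = fun σ => F (restrictRemaining cl σ) := funext hgF
  have h1 := ofReal_abs_le_of_sweep hSd hk hα hwb
    (E := fun F => E fun σ => F (restrictRemaining cl σ)) hEb hK
    (fun F S hF => (hEK _ _ (dependsOn_comp_restrict hF)).trans
      (mul_le_mul_right (tsum_oscillation_comp_restrict_le F) K)) hF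
  calc ENNReal.ofReal |E f| ≤ _ := hEg
    _ ≤ ∑' i, oscillation F i * w i.1 + e := by gcongr
    _ ≤ ∑' i : Remaining cl, oscillation (fun σ => F (restrictRemaining cl σ)) i.1 * w i.1 + e := by
        gcongr with i
        exact hosc i
    _ ≤ ∑' x, oscillation (fun σ => F (restrictRemaining cl σ)) x * w x + e := by
        gcongr
        exact ENNReal.tsum_comp_le_tsum_of_injective Subtype.val_injective _
    _ ≤ _ := by rw [add_comm]; exact he

theorem eq_of_isGibbs_pottsWeight [Countable V] (hD : IsDecimation G cl)
    (hS : IsSpec (pottsWeight (q := q) G)) (hSd : IsSpec (decimatedWeight (q := q) G cl))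
    (hα : dobrushinConstant (decimatedWeight (q := q) G cl) < 1) {μ ν : Measure (V → Fin q)}
    (hμ : IsGibbs (pottsWeight G) μ) (hν : IsGibbs (pottsWeight G) ν) : μ = ν := by
  have := hμ.1
  have := hν.1
  obtain ⟨ω⟩ := nonempty_config (μ := μ)
  refine measure_ext_of_local fun f S hf => ?_
  have hgib : ∀ (Λ : Finset V) {f : (V → Fin q) → ℝ} {S : Finset V}, DependsOn f (S : Set V) →
      ∫ σ, avg (pottsWeight G) Λ f σ ∂μ - ∫ σ, avg (pottsWeight G) Λ f σ ∂ν =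
        ∫ σ, f σ ∂μ - ∫ σ, f σ ∂ν := fun Λ f S hf => by
    rw [hμ.integral_avg_local hS.nonneg hS.finiteRange Λ hf,
      hν.integral_avg_local hS.nonneg hS.finiteRange Λ hf]
  have h := ofReal_abs_le_of_decimation hD hS hSd (dominates_offDiag _) hα (B := 0) (b := 0)
    (w := 0) (by simp) (by simp) (E := fun f => ∫ σ, f σ ∂μ - ∫ σ, f σ ∂ν)
    (fun c f S hf => by simp only [hgib (cl c) hf]; simp)
    (fun i F S hF => by
      simp only [← avg_thicken hD {i}, hgib _ (dependsOn_comp_restrict hF)]; simp) (K := 2)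
    (by simp) (fun f S hf => ofReal_abs_integral_sub_le hf) ω hf
  simp only [Pi.zero_apply, mul_zero, tsum_zero, nonpos_iff_eq_zero, ENNReal.ofReal_eq_zero] at h
  exact sub_eq_zero.1 (abs_eq_zero.1 (le_antisymm h (abs_nonneg _)))

theorem sum_oscillation_thicken_le (hD : IsDecimation G cl) (i : Remaining cl)
    (F : (Remaining cl → Fin q) → ℝ) :
    ∑ x ∈ thicken hD {i}, oscillation (fun σ : V → Fin q => F (restrictRemaining cl σ)) x ≤
      oscillation F i := by
  classical
  rw [Finset.sum_eq_single i.1]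
  · exact oscillation_comp_restrict_le F i
  · intro x hx hxi
    rcases mem_thicken.1 hx with ⟨hr, h⟩ | ⟨c, -, hc⟩
    · exact absurd (congrArg Subtype.val (Finset.mem_singleton.1 h)) hxi
    · exact oscillation_comp_restrict_eq_zero hc
  · exact fun h => absurd (remaining_mem_thicken.2 (Finset.mem_singleton_self i)) h

open Classical in
/-- If the decimated system satisfies Dobrushin's condition, then the original system has a unique
Gibbs measure, with exponentially decaying correlations. -/
theorem uniqueGibbsWithDecay_of_decimation [Countable V] (hD : IsDecimation G cl)
    (hS : IsSpec (pottsWeight (q := q) G)) (hSd : IsSpec (decimatedWeight (q := q) G cl))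
    (hα : dobrushinConstant (decimatedWeight (q := q) G cl) < 1)
    (hex : ∃ μ, IsGibbs (pottsWeight (q := q) G) μ) {d : V → V → ℕ}
    (htri : ∀ i j l, d i l ≤ d i j + d j l) {R N : ℕ}
    (hR : ∀ i j, interdependence (decimatedWeight (q := q) G cl) i j ≠ 0 → d i.1 j.1 ≤ R)
    (hRc : ∀ c, ∀ x ∈ cl c, ∀ y ∈ cl c, d x y ≤ R)
    (hRb : ∀ c, ∀ x ∈ cl c, ∀ y ∈ boundary G cl c, d x y.1 ≤ R)
    (hRt : ∀ i, ∀ x ∈ thicken hD {i}, d i.1 x ≤ R)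
    (hN : ∀ c, (outerBoundary hD c).card ≤ N) :
    UniqueGibbsWithDecay (pottsWeight (q := q) G) d := by
  obtain ⟨μ, hμ⟩ := hex
  have := hμ.1
  obtain ⟨ω⟩ := nonempty_config (μ := μ)
  have huniq : ∀ μ', IsGibbs (pottsWeight G) μ' → μ' = μ := fun μ' hμ' =>
    eq_of_isGibbs_pottsWeight hD hS hSd hα hμ' hμ
  refine ⟨μ, hμ, huniq, ?_⟩
  obtain ⟨m, hm, hθ⟩ := exists_rate hα R
  set r := ENNReal.ofReal (Real.exp (m * R)) with hr
  obtain ⟨C, hC, hCeq⟩ := exists_const hθ (B := r) ENNReal.ofReal_ne_top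
  have hC' : C + (r + N * (r * C)) ≠ ∞ := by finiteness
  refine exponentialDecay_of_local hS hμ huniq hC' hm fun f g S T hf hg => ?_
  obtain ⟨K, hK, hKf⟩ := exists_ofReal_abs_cov_le (μ := μ) hg
  set h := expPotential d m (oscillation g) with hh
  -- On remaining sites `C` solves `r + α r C = C`, the source `r h` covering the oscillations of
  -- `g` on the thickened site. A cluster site must pay for its own cluster, `r h`, and for up to
  -- `N` boundary sites, each at most `r C h`.
  let w : V → ℝ≥0∞ := fun x => (if ∀ c, x ∉ cl c then C else r + N * (r * C)) * h x
  have hwle : ∀ x, w x ≤ (C + (r + N * (r * C))) * h x := fun x => by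
    simp only [w]
    gcongr
    split_ifs
    · exact le_self_add
    · exact le_add_self
  have hwr : ∀ i : Remaining cl, w i.1 = C * h i.1 := fun i => by
    simp only [w, if_pos i.2]
  refine (ofReal_abs_le_of_decimation hD hS hSd (dominates_offDiag _) hα
    (B := fun c => ∑ x ∈ cl c, oscillation g x)
    (b := fun i => ∑ x ∈ thicken hD {i}, oscillation g x) (w := w) (fun c x hx => ?_)
    (fun i => ?_) (E := fun f => cov μ f g)
    (fun c f S hf => ofReal_abs_cov_le_avg hS hμ (cl c) hf hg)
    (fun i F S hF => ?_) hK hKf ω hf).trans ?_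
  · have hw : w x = (r + N * (r * C)) * h x := by
      simp only [w]; rw [if_neg fun H => H c hx]
    rw [hw]
    have h1 : ∑ x ∈ cl c, oscillation g x ≤ r * h x :=
      le_mul_expPotential hm.le _ fun y hy => hRc c x hx y hy
    have h2 : ∑ y ∈ outerBoundary hD c, w y ≤ N * (r * C * h x) := by
      calc ∑ y ∈ outerBoundary hD c, w y ≤ ∑ y ∈ outerBoundary hD c, r * C * h x := by
            refine Finset.sum_le_sum fun y hy => ?_
            obtain ⟨hyr, hyb⟩ := mem_outerBoundary.1 hy
            have e := hwr ⟨y, hyr⟩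
            simp only at e
            rw [e, mul_comm r C, mul_assoc]
            gcongr
            exact expPotential_le htri hm.le _ (hRb c x hx _ hyb)
        _ ≤ _ := by
            rw [Finset.sum_const, nsmul_eq_mul]
            gcongr
            exact_mod_cast hN c
    calc _ ≤ r * h x + N * (r * C * h x) := add_le_add h1 h2
      _ = _ := by ring
  · have h1 : ∑ x ∈ thicken hD {i}, oscillation g x ≤ r * h i.1 :=
      le_mul_expPotential hm.le _ fun y hy => hRt i y hy
    have h2 : ∑' j, offDiag (decimatedWeight (q := q) G cl) i j * w j.1 ≤
        C * (dobrushinConstant (decimatedWeight (q := q) G cl) * r * h i.1) := by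
      simp only [hwr, mul_left_comm _ C]
      rw [ENNReal.tsum_mul_left, mul_assoc _ r]
      gcongr
      calc ∑' j, offDiag (decimatedWeight (q := q) G cl) i j * h j.1
          ≤ ∑' j, offDiag (decimatedWeight (q := q) G cl) i j * (r * h i.1) := by
            refine ENNReal.tsum_le_tsum fun j => ?_
            by_cases hj : offDiag (decimatedWeight (q := q) G cl) i j = 0
            · simp [hj]
            · gcongr
              refine expPotential_le htri hm.le _ (hR i j ?_)
              intro h0
              exact hj (by unfold offDiag; split_ifs <;> simp [h0])
        _ ≤ _ := by
            rw [ENNReal.tsum_mul_right]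
            gcongr
            exact (dominates_offDiag _).sum_le i
    rw [hwr]
    calc _ ≤ r * h i.1 + C * (dobrushinConstant (decimatedWeight (q := q) G cl) * r * h i.1) :=
          add_le_add h1 h2
      _ = (r + dobrushinConstant (decimatedWeight (q := q) G cl) * r * C) * h i.1 := by ring
      _ = _ := by rw [hCeq]
  · have h1 := ofReal_abs_cov_le_avg hS hμ (thicken hD {i}) (dependsOn_comp_restrict hF) hg
    have e : avg (pottsWeight G) (thicken hD {i}) (fun σ => F (restrictRemaining cl σ)) =
        fun σ => avg (decimatedWeight G cl) {i} F (restrictRemaining cl σ) :=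
      funext fun σ => avg_thicken hD {i} σ F
    rw [e] at h1
    refine h1.trans ?_
    gcongr
    exact sum_oscillation_thicken_le hD i F
  · refine ENNReal.tsum_le_tsum fun x => ?_
    gcongr
    exact hwle x

end Transfer


/-! ### Interdependence of kernels that depend on finitely many spins. -/

section LocalStructure

variable {V : Type} {q n : ℕ} {W : Finset V → (V → Fin q) → ℝ}

/-- The interdependence of a single-site kernel on its `m`-th argument. -/
noncomputable def localDep (K : (Fin n → Fin q) → Fin q → ℝ) (m : Fin n) : ℝ≥0∞ :=
  ⨆ (x : Fin n → Fin q) (x' : Fin n → Fin q) (_ : ∀ l, l ≠ m → x l = x' l),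
    ENNReal.ofReal (varDist (K x) (K x'))

theorem le_localDep (K : (Fin n → Fin q) → Fin q → ℝ) {m : Fin n} {x x' : Fin n → Fin q}
    (h : ∀ l, l ≠ m → x l = x' l) : ENNReal.ofReal (varDist (K x) (K x')) ≤ localDep K m :=
  le_iSup_of_le x (le_iSup_of_le x' (le_iSup_of_le h le_rfl))

theorem localDep_le {K : (Fin n → Fin q) → Fin q → ℝ} {m : Fin n} {c : ℝ}
    (h : ∀ x x' : Fin n → Fin q, (∀ l, l ≠ m → x l = x' l) → varDist (K x) (K x') ≤ c) :
    localDep K m ≤ ENNReal.ofReal c :=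
  iSup_le fun x => iSup_le fun x' => iSup_le fun hx => ENNReal.ofReal_le_ofReal (h x x' hx)

theorem localDep_perm {K : (Fin n → Fin q) → Fin q → ℝ} (π : Fin n ≃ Fin n)
    (hπ : ∀ x, K (x ∘ π) = K x) (m : Fin n) : localDep K (π m) = localDep K m := by
  refine le_antisymm ?_ ?_
  · refine iSup_le fun x => iSup_le fun x' => iSup_le fun h => ?_
    rw [← hπ x, ← hπ x']
    exact le_localDep K fun l hl => h _ fun e => hl (π.injective e)
  · refine iSup_le fun x => iSup_le fun x' => iSup_le fun h => ?_
    have h1 : ∀ x : Fin n → Fin q, K x = K (x ∘ π.symm) := fun x => by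
      rw [← hπ (x ∘ π.symm)]; congr 1; funext l; simp
    rw [h1 x, h1 x']
    exact le_localDep K fun l hl => h _ fun e => hl (by rw [← e, π.apply_symm_apply])

variable {K : (Fin n → Fin q) → Fin q → ℝ} {i : V} {nb : Fin n → V}

theorem interdependence_eq_zero (hK : ∀ t, siteKernel W i t = K (t ∘ nb)) {j : V}
    (hj : ∀ m, nb m ≠ j) : interdependence W i j = 0 := by
  refine le_antisymm (interdependence_le fun σ σ' h => ?_) bot_le
  have : σ ∘ nb = σ' ∘ nb := funext fun m => h _ (hj m)
  rw [hK, hK, this]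
  have : varDist (K (σ' ∘ nb)) (K (σ' ∘ nb)) = 0 := by simp [varDist]
  rw [this, ENNReal.ofReal_zero]

theorem interdependence_eq_localDep (hK : ∀ t, siteKernel W i t = K (t ∘ nb))
    (hnb : Function.Injective nb) (m : Fin n) : interdependence W i (nb m) = localDep K m := by
  refine le_antisymm (interdependence_le fun σ σ' h => ?_) ?_
  · rw [hK, hK]
    exact le_localDep K fun l hl => h _ fun e => hl (hnb e)
  · refine iSup_le fun x => iSup_le fun x' => iSup_le fun h => ?_
    -- Any tuple of arguments extends to a configuration; the common default colour makes the
    -- extensions of `x` and `x'` agree away from `nb m`.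
    have e : ∀ y : Fin n → Fin q, Function.extend nb y (fun _ => x m) ∘ nb = y := fun y =>
      funext fun l => hnb.extend_apply _ _ l
    rw [← e x, ← e x', ← hK, ← hK]
    refine le_interdependence W i fun k hk => ?_
    by_cases hkr : ∃ l, nb l = k
    · obtain ⟨l, rfl⟩ := hkr
      rw [hnb.extend_apply, hnb.extend_apply]
      exact h l fun e => hk (e ▸ rfl)
    · rw [Function.extend_apply' _ _ _ hkr, Function.extend_apply' _ _ _ hkr]

theorem tsum_interdependence (hK : ∀ t, siteKernel W i t = K (t ∘ nb))
    (hnb : Function.Injective nb) (hne : ∀ m, nb m ≠ i) :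
    ∑' j : {j : V // j ≠ i}, interdependence W i j = ∑ m, localDep K m := by
  have hinj : Function.Injective fun m => (⟨nb m, hne m⟩ : {j : V // j ≠ i}) := fun a b h =>
    hnb (congrArg Subtype.val h)
  rw [← hinj.tsum_eq, tsum_fintype]
  · exact Finset.sum_congr rfl fun m _ => interdependence_eq_localDep hK hnb m
  · intro j hj
    by_contra hj'
    exact hj (interdependence_eq_zero hK fun m h => hj' ⟨m, Subtype.ext h⟩)

theorem dobrushinConstant_eq [Nonempty V] {nb : V → Fin n → V}
    (hK : ∀ i t, siteKernel W i t = K (t ∘ nb i)) (hnb : ∀ i, Function.Injective (nb i))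
    (hne : ∀ i m, nb i m ≠ i) : dobrushinConstant W = ∑ m, localDep K m := by
  unfold dobrushinConstant
  simp only [fun i => tsum_interdependence (hK i) (hnb i) (hne i), ciSup_const]

end LocalStructure

/-! ### Six-cycle weights and hexagonal faces. -/

section HexSites

open Classical in
/-- The weight of a six-cycle whose `k`-th vertex avoids the colour `t k`. -/
noncomputable def hexWeight {q : ℕ} (t : Fin 6 → Fin q) : ℝ :=
  ∑ s : Fin 6 → Fin q, if (∀ k, s k ≠ s (k + 1)) ∧ ∀ k, s k ≠ t k then 1 else 0

theorem hexWeight_rotate {q : ℕ} (t : Fin 6 → Fin q) (a : Fin 6) :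
    hexWeight (fun k => t (k + a)) = hexWeight t := by
  classical
  unfold hexWeight
  refine (Fintype.sum_equiv ((Equiv.addRight a).arrowCongr (Equiv.refl _)).symm _ _
    fun s => ?_).symm
  refine if_congr (and_congr ?_ ?_) rfl rfl
  · rw [← (Equiv.addRight a).forall_congr_right]
    simp [Equiv.arrowCongr, add_right_comm]
  · rw [← (Equiv.addRight a).forall_congr_right]
    simp [Equiv.arrowCongr]

theorem hexWeight_reflect {q : ℕ} (t : Fin 6 → Fin q) :
    hexWeight (fun k => t (-k)) = hexWeight t := by
  classical
  unfold hexWeight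
  refine (Fintype.sum_equiv ((Equiv.neg (Fin 6)).arrowCongr (Equiv.refl _)).symm _ _
    fun s => ?_).symm
  refine if_congr (and_congr ?_ ?_) rfl rfl
  · rw [← ((Equiv.neg (Fin 6)).trans (Equiv.subRight 1)).forall_congr_right]
    simp only [Equiv.arrowCongr, Equiv.trans_apply, Equiv.neg_apply, Equiv.subRight_apply,
      sub_add_cancel, Equiv.coe_fn_symm_mk, Equiv.coe_refl, Function.comp_apply, neg_add_rev]
    refine forall_congr' fun k => ?_
    rw [ne_comm]
    exact Iff.rfl
  · rw [← (Equiv.neg (Fin 6)).forall_congr_right]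
    simp [Equiv.arrowCongr]

theorem hexWeight_nonneg {q : ℕ} (t : Fin 6 → Fin q) : 0 ≤ hexWeight t := by
  classical
  exact Finset.sum_nonneg fun s _ => by split_ifs <;> simp

/-- The sites of a hexagonal face in cyclic order. -/
def faceSite (p : ℤ × ℤ) : Fin 6 → HexSite :=
  ![(p, true), (p + (1, 0), false), (p + (1, 0), true), (p + (1, 1), false), (p + (0, 1), true),
    (p + (0, 1), false)]

theorem mem_hexFace {p : ℤ × ℤ} {x : HexSite} : x ∈ hexFace p ↔ ∃ k, faceSite p k = x := by
  simp only [hexFace, Finset.mem_insert, Finset.mem_singleton, faceSite, Fin.exists_fin_succ]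
  simp [eq_comm]

theorem faceSite_injective (p : ℤ × ℤ) : Function.Injective (faceSite p) := by
  intro k l h
  obtain ⟨a, b⟩ := p
  fin_cases k <;> fin_cases l <;> simp [faceSite] at h ⊢

theorem hexLattice_adj_ft {a b c d : ℤ} : hexLattice.Adj ((a, b), false) ((c, d), true) ↔
    (c = a ∧ d = b) ∨ (c = a - 1 ∧ d = b) ∨ (c = a ∧ d = b - 1) := by
  simp [hexLattice, SimpleGraph.fromRel_adj]

theorem hexLattice_adj_tf {a b c d : ℤ} : hexLattice.Adj ((c, d), true) ((a, b), false) ↔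
    (c = a ∧ d = b) ∨ (c = a - 1 ∧ d = b) ∨ (c = a ∧ d = b - 1) := by
  rw [SimpleGraph.adj_comm, hexLattice_adj_ft]

theorem hexLattice_not_adj {p p' : ℤ × ℤ} (b : Bool) : ¬ hexLattice.Adj (p, b) (p', b) := by
  cases b <;> simp [hexLattice, SimpleGraph.fromRel_adj]

theorem faceSite_adj (p : ℤ × ℤ) (k l : Fin 6) :
    hexLattice.Adj (faceSite p k) (faceSite p l) ↔ l = k + 1 ∨ k = l + 1 := by
  obtain ⟨a, b⟩ := p
  fin_cases k <;> fin_cases l <;>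
    simp [faceSite, hexLattice_adj_ft, hexLattice_adj_tf, hexLattice_not_adj]

end HexSites


/-! ### Geometry and kernel of the hexagonal decimation. -/

section HexDecimation

/-- The neighbours of a site of the hexagonal lattice. -/
def hexNbr : HexSite → Finset HexSite
  | ((a, b), false) => {((a, b), true), ((a - 1, b), true), ((a, b - 1), true)}
  | ((a, b), true) => {((a, b), false), ((a + 1, b), false), ((a, b + 1), false)}

theorem hexLattice_adj_iff {x y : HexSite} : hexLattice.Adj x y ↔ y ∈ hexNbr x := by
  obtain ⟨⟨a, b⟩, _ | _⟩ := x <;> obtain ⟨⟨c, d⟩, _ | _⟩ := y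
  · simp [hexLattice_not_adj, hexNbr]
  · simp [hexLattice_adj_ft, hexNbr]
  · simp [hexLattice_adj_tf, hexNbr]
    omega
  · simp [hexLattice_not_adj, hexNbr]

theorem card_hexNbr_le (x : HexSite) : (hexNbr x).card ≤ 3 := by
  obtain ⟨⟨a, b⟩, _ | _⟩ := x <;> exact Finset.card_le_three

theorem hexLattice_finite_nbr (x : HexSite) : (hexLattice.neighborSet x).Finite :=
  (hexNbr x).finite_toSet.subset fun _ hy => hexLattice_adj_iff.1 hy

theorem mem_hexFace_iff {a b c d : ℤ} {s : Bool} : ((c, d), s) ∈ hexFace (a, b) ↔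
    if s then (c = a ∧ d = b) ∨ (c = a + 1 ∧ d = b) ∨ (c = a ∧ d = b + 1)
    else (c = a + 1 ∧ d = b) ∨ (c = a + 1 ∧ d = b + 1) ∨ (c = a ∧ d = b + 1) := by
  cases s <;> simp [hexFace]

theorem remaining_hexCluster_iff {a b : ℤ} {s : Bool} :
    (∀ c, ((a, b), s) ∉ hexCluster c) ↔
      if s then a % 2 = 1 ∧ b % 2 = 1 else a % 2 = 0 ∧ b % 2 = 0 := by
  constructor
  · intro h
    have h1 := h (a / 2, b / 2)
    cases s <;> simp [hexCluster, mem_hexFace_iff] at h1 ⊢ <;> omega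
  · rintro h ⟨c, d⟩
    cases s <;> simp [hexCluster, mem_hexFace_iff] at h ⊢ <;> omega

/-- The remaining sites form again a hexagonal lattice. -/
def hexEquiv : Remaining hexCluster ≃ HexSite where
  -- Remaining sites have both coordinates even on the sublattice `false` and both odd on `true`.
  -- The sublattices are exchanged and the shift is chosen so that face `c` of the new lattice
  -- surrounds cluster `c`.
  toFun x := match x.1 with
    | ((a, b), false) => ((a / 2, b / 2), true)
    | ((a, b), true) => ((a / 2 + 1, b / 2 + 1), false)
  invFun x := match x with
    | ((a, b), true) => ⟨((2 * a, 2 * b), false), remaining_hexCluster_iff.2 (by simp)⟩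
    | ((a, b), false) => ⟨((2 * a - 1, 2 * b - 1), true), remaining_hexCluster_iff.2 (by
        simp only [if_true]; omega)⟩
  left_inv x := by
    obtain ⟨⟨⟨a, b⟩, _ | _⟩, hx⟩ := x
    · have := remaining_hexCluster_iff.1 hx
      simp only [Bool.false_eq_true, if_false] at this
      simp only [Subtype.mk.injEq, Prod.mk.injEq, and_true]
      omega
    · have := remaining_hexCluster_iff.1 hx
      simp only [if_true] at this
      simp only [Subtype.mk.injEq, Prod.mk.injEq, and_true]
      omega
  right_inv x := by
    obtain ⟨⟨a, b⟩, _ | _⟩ := x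
    · simp
      omega
    · simp

theorem hexEquiv_symm_true (a b : ℤ) :
    (hexEquiv.symm ((a, b), true)).1 = ((2 * a, 2 * b), false) := rfl

theorem hexEquiv_symm_false (a b : ℤ) :
    (hexEquiv.symm ((a, b), false)).1 = ((2 * a - 1, 2 * b - 1), true) := rfl

/-- Each cluster site has exactly one remaining neighbour, the site with the same index on the
surrounding face. Hence the effective weight counts colourings of a six-cycle with one forbidden
colour at each vertex. -/
theorem adj_symm_faceSite (c : ℤ × ℤ) (k : Fin 6) (h : HexSite) :
    hexLattice.Adj (faceSite (2 * c.1, 2 * c.2) k) (hexEquiv.symm h).1 ↔ h = faceSite c k := by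
  obtain ⟨a, b⟩ := c
  obtain ⟨⟨x, y⟩, _ | _⟩ := h
  · rw [hexEquiv_symm_false]
    fin_cases k <;>
      simp [faceSite, hexLattice_adj_ft, hexLattice_not_adj] <;> omega
  · rw [hexEquiv_symm_true]
    fin_cases k <;>
      simp [faceSite, hexLattice_adj_tf, hexLattice_not_adj] <;> omega

theorem mem_boundary_hexCluster {c : ℤ × ℤ} {h : HexSite} :
    hexEquiv.symm h ∈ boundary hexLattice hexCluster c ↔ h ∈ hexFace c := by
  constructor
  · rintro ⟨x, hx, hxy⟩
    obtain ⟨k, rfl⟩ := mem_hexFace.1 hx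
    exact mem_hexFace.2 ⟨k, ((adj_symm_faceSite c k h).1 hxy).symm⟩
  · intro hh
    obtain ⟨k, hk⟩ := mem_hexFace.1 hh
    exact ⟨_, mem_hexFace.2 ⟨k, rfl⟩, (adj_symm_faceSite c k h).2 hk.symm⟩

theorem mem_boundary_hexCluster_iff {c : ℤ × ℤ} {y : Remaining hexCluster} :
    y ∈ boundary hexLattice hexCluster c ↔ hexEquiv y ∈ hexFace c := by
  rw [← mem_boundary_hexCluster, Equiv.symm_apply_apply]

theorem image_boundary_hexCluster (c : ℤ × ℤ) :
    hexEquiv '' boundary hexLattice hexCluster c = (hexFace c : Set HexSite) := by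
  ext h
  rw [Finset.mem_coe, ← mem_boundary_hexCluster, Equiv.image_eq_preimage_symm, Set.mem_preimage]

/-- The three faces containing a site. -/
def siteFace : HexSite → Fin 3 → ℤ × ℤ
  | ((a, b), true) => ![(a, b), (a - 1, b), (a, b - 1)]
  | ((a, b), false) => ![(a - 1, b), (a - 1, b - 1), (a, b - 1)]

theorem mem_hexFace_iff_siteFace {h : HexSite} {c : ℤ × ℤ} :
    h ∈ hexFace c ↔ ∃ k, siteFace h k = c := by
  obtain ⟨⟨x, y⟩, _ | _⟩ := h <;> obtain ⟨a, b⟩ := c <;>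
    simp [mem_hexFace_iff, siteFace, Fin.exists_fin_succ] <;> omega

theorem siteFace_injective (h : HexSite) : Function.Injective (siteFace h) := by
  obtain ⟨⟨x, y⟩, _ | _⟩ := h <;> intro k l <;> fin_cases k <;> fin_cases l <;>
    simp [siteFace] <;> omega

theorem nonInteracting_hexCluster : NonInteracting hexLattice hexCluster := by
  rintro ⟨a, b⟩ ⟨c, d⟩ hne
  have hne' : ¬ (a = c ∧ b = d) := fun h => hne (Prod.ext h.1 h.2)
  constructor
  · rw [Finset.disjoint_left]
    rintro ⟨⟨x, y⟩, _ | _⟩ h1 h2 <;> simp [hexCluster, mem_hexFace_iff] at h1 h2 <;> omega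
  · rintro ⟨⟨x, y⟩, _ | _⟩ h1 ⟨⟨z, w⟩, _ | _⟩ h2 <;> simp [hexCluster, mem_hexFace_iff] at h1 h2
    · exact hexLattice_not_adj _
    · rw [hexLattice_adj_ft]; omega
    · rw [hexLattice_adj_tf]; omega
    · exact hexLattice_not_adj _

theorem isDecimation_hexCluster : IsDecimation hexLattice hexCluster where
  nonInteracting := nonInteracting_hexCluster
  isolated := by
    rintro ⟨⟨⟨a, b⟩, _ | _⟩, hx⟩ ⟨⟨⟨c, d⟩, _ | _⟩, hy⟩ <;> simp only
    · exact hexLattice_not_adj _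
    · have h1 := remaining_hexCluster_iff.1 hx
      have h2 := remaining_hexCluster_iff.1 hy
      simp at h1 h2
      rw [hexLattice_adj_ft]; omega
    · have h1 := remaining_hexCluster_iff.1 hx
      have h2 := remaining_hexCluster_iff.1 hy
      simp at h1 h2
      rw [hexLattice_adj_tf]; omega
    · exact hexLattice_not_adj _
  finite_nbr := hexLattice_finite_nbr
  finite_touch y := by
    refine (Set.finite_range (siteFace (hexEquiv y))).subset fun c hc => ?_
    exact mem_hexFace_iff_siteFace.1 (mem_boundary_hexCluster_iff.1 hc)

open Classical in
theorem effectiveWeight_reindex {V κ ι : Type} {q : ℕ} {G : SimpleGraph V} {cl : κ → Finset V}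
    {c : κ} [Fintype ι] [DecidableEq ι] (e : ι ≃ cl c) (t : Remaining cl → Fin q) :
    effectiveWeight G cl c t = ∑ s : ι → Fin q,
      if (∀ x y, G.Adj (e x) (e y) → s x ≠ s y) ∧
        (∀ x (y : Remaining cl), G.Adj (e x) y → s x ≠ t y) then 1 else 0 := by
  unfold effectiveWeight
  refine (Fintype.sum_equiv (e.arrowCongr (Equiv.refl _)) _ _ fun s => ?_).symm
  refine if_congr (and_congr ?_ ?_) rfl rfl
  · rw [← e.forall_congr_right]
    refine forall_congr' fun x => ?_
    rw [← e.forall_congr_right]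
    simp [Equiv.arrowCongr_apply]
  · rw [← e.forall_congr_right]
    simp [Equiv.arrowCongr_apply]

theorem effectiveWeight_hexCluster {q : ℕ} (c : ℤ × ℤ) (t : Remaining hexCluster → Fin q) :
    effectiveWeight hexLattice hexCluster c t =
      hexWeight fun k => t (hexEquiv.symm (faceSite c k)) := by
  classical
  obtain ⟨e, he⟩ : ∃ e : Fin 6 ≃ hexCluster c, ∀ k, (e k).1 = faceSite (2 * c.1, 2 * c.2) k :=
    ⟨Equiv.ofBijective (fun k => ⟨faceSite (2 * c.1, 2 * c.2) k, mem_hexFace.2 ⟨k, rfl⟩⟩)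
      ⟨fun k l h => faceSite_injective _ (congrArg Subtype.val h), fun x => by
        obtain ⟨k, hk⟩ := mem_hexFace.1 x.2
        exact ⟨k, Subtype.ext hk⟩⟩, fun _ => rfl⟩
  rw [effectiveWeight_reindex e]
  unfold hexWeight
  refine Finset.sum_congr rfl fun s _ => ?_
  have h1 : (∀ x y, hexLattice.Adj (e x) (e y) → s x ≠ s y) ↔ ∀ k, s k ≠ s (k + 1) := by
    simp only [he, faceSite_adj]
    constructor
    · exact fun h k => h _ _ (Or.inl rfl)
    · rintro h k l (rfl | rfl)
      · exact h k
      · exact (h l).symm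
  have h2 : (∀ x (y : Remaining hexCluster), hexLattice.Adj (e x) y → s x ≠ t y) ↔
      ∀ k, s k ≠ t (hexEquiv.symm (faceSite c k)) := by
    simp only [he, ← hexEquiv.symm.forall_congr_right, adj_symm_faceSite, forall_eq]
  simp only [h1, h2]

/-- The twelve other sites of the three faces around a site, in cyclic order. -/
def hexRing : HexSite → Fin 12 → HexSite
  | ((a, b), true) => ![((a + 1, b), false), ((a + 1, b), true), ((a + 1, b + 1), false),
      ((a, b + 1), true), ((a, b + 1), false), ((a - 1, b + 1), true), ((a - 1, b + 1), false),
      ((a - 1, b), true), ((a, b), false), ((a, b - 1), true), ((a + 1, b - 1), false),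
      ((a + 1, b - 1), true)]
  | ((a, b), false) => ![((a, b), true), ((a, b + 1), false), ((a - 1, b + 1), true),
      ((a - 1, b + 1), false), ((a - 1, b), true), ((a - 1, b), false), ((a - 1, b - 1), true),
      ((a, b - 1), false), ((a, b - 1), true), ((a + 1, b - 1), false), ((a + 1, b - 1), true),
      ((a + 1, b), false)]

/-- The position of a site in each of the faces containing it. -/
def hexStart : HexSite → Fin 3 → Fin 6
  | (_, true) => ![0, 2, 4]
  | (_, false) => ![1, 3, 5]

/-- A face around a vertex, as a function of the colour of that vertex and of the ring. -/
def ringFace {α : Type} (a : α) (x : Fin 12 → α) : Fin 3 → Fin 6 → α :=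
  ![![a, x 0, x 1, x 2, x 3, x 4], ![a, x 4, x 5, x 6, x 7, x 8], ![a, x 8, x 9, x 10, x 11, x 0]]

/-- Read cyclically from `h`, each face through `h` is an arc of the ring. Positions `0, 4, 8` are
the nearest neighbours, each shared by two faces, odd positions are second neighbours, and `2, 6,
10` are opposite to `h`. -/
theorem faceSite_siteFace (h : HexSite) (k : Fin 3) (m : Fin 6) :
    faceSite (siteFace h k) (m + hexStart h k) = ringFace h (hexRing h) k m := by
  obtain ⟨⟨a, b⟩, _ | _⟩ := h <;> fin_cases k <;> fin_cases m <;>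
    simp [faceSite, siteFace, hexStart, ringFace, hexRing]

theorem comp_ringFace {α β : Type} (f : α → β) (a : α) (x : Fin 12 → α) (k : Fin 3) (m : Fin 6) :
    f (ringFace a x k m) = ringFace (f a) (f ∘ x) k m := by
  fin_cases k <;> fin_cases m <;> rfl

/-- Translation reduces the claim to the two sites of the cell at the origin, a finite check. -/
theorem hexRing_injective (h : HexSite) : Function.Injective (hexRing h) := by
  obtain ⟨⟨a, b⟩, s⟩ := h
  have h0 : ∀ (s : Bool) (k l : Fin 12), hexRing ((0, 0), s) k = hexRing ((0, 0), s) l → k = l := by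
    decide
  have h1 : ∀ k, (((hexRing ((a, b), s) k).1.1 - a, (hexRing ((a, b), s) k).1.2 - b),
      (hexRing ((a, b), s) k).2) = hexRing ((0, 0), s) k := by
    intro k
    cases s <;> fin_cases k <;> simp [hexRing]
  intro k l hkl
  refine h0 s k l ?_
  rw [← h1, ← h1, hkl]

theorem hexRing_ne (h : HexSite) (m : Fin 12) : hexRing h m ≠ h := by
  obtain ⟨⟨a, b⟩, _ | _⟩ := h <;> fin_cases m <;> simp [hexRing]

/-- The single-site kernel of the hexagonal decimation, as a function of the spins on the ring. -/
noncomputable def hexKernel {q : ℕ} (x : Fin 12 → Fin q) (a : Fin q) : ℝ :=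
  (∏ k, hexWeight (ringFace a x k)) / ∑ b, ∏ k, hexWeight (ringFace b x k)

theorem siteKernel_eq_div {V : Type} {q : ℕ} (W : Finset V → (V → Fin q) → ℝ) (i : V)
    (ω : V → Fin q) (a : Fin q) : siteKernel W i ω a =
      W {i} (glue ω {i} fun _ => a) / ∑ b, W {i} (glue ω {i} fun _ => b) := by
  classical
  unfold siteKernel kernel
  congr 1
  convert sum_singleton i fun τ => W {i} (glue ω {i} τ)

theorem hexDecimated_singleton {q : ℕ} (i : Remaining hexCluster)
    (t : Remaining hexCluster → Fin q) (a : Fin q) :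
    hexDecimated q {i} (glue t {i} fun _ => a) =
      ∏ k, hexWeight (ringFace a (t ∘ hexEquiv.symm ∘ hexRing (hexEquiv i)) k) := by
  classical
  have htouch : touched isDecimation_hexCluster {i} =
      Finset.univ.map ⟨siteFace (hexEquiv i), siteFace_injective _⟩ := by
    ext c
    simp [mem_touched, mem_boundary_hexCluster_iff, mem_hexFace_iff_siteFace]
  rw [hexDecimated, decimatedWeight_eq_prod isDecimation_hexCluster, htouch, Finset.prod_map]
  refine Finset.prod_congr rfl fun k _ => ?_
  rw [Function.Embedding.coeFn_mk, effectiveWeight_hexCluster,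
    ← hexWeight_rotate _ (hexStart (hexEquiv i) k)]
  congr 1
  funext m
  rw [faceSite_siteFace, comp_ringFace hexEquiv.symm, comp_ringFace (glue t {i} fun _ => a)]
  congr 1
  · rw [Equiv.symm_apply_apply, glue_apply_mem (Finset.mem_singleton_self i)]
  · funext l
    refine glue_apply_notMem fun h => hexRing_ne (hexEquiv i) l ?_
    simpa using congrArg hexEquiv (Finset.mem_singleton.1 h)

theorem siteKernel_hexDecimated {q : ℕ} (i : Remaining hexCluster)
    (t : Remaining hexCluster → Fin q) : siteKernel (hexDecimated q) i t =
      hexKernel (t ∘ (hexEquiv.symm ∘ hexRing (hexEquiv i))) := by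
  funext a
  rw [siteKernel_eq_div]
  simp only [hexDecimated_singleton, hexKernel]

theorem hexKernel_comp {q : ℕ} (π : Fin 12 ≃ Fin 12) (ρ : Fin 3 ≃ Fin 3)
    (h : ∀ (a : Fin q) x k, hexWeight (ringFace a (x ∘ π) k) = hexWeight (ringFace a x (ρ k)))
    (x : Fin 12 → Fin q) : hexKernel (x ∘ π) = hexKernel x := by
  have h' : ∀ a, ∏ k, hexWeight (ringFace a (x ∘ π) k) = ∏ k, hexWeight (ringFace a x k) :=
    fun a => by
      simp only [h]
      exact Equiv.prod_comp ρ fun k => hexWeight (ringFace a x k)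
  funext a
  simp only [hexKernel, h']

/-- The rotation permutes the three faces. This is decided symbolically, with `none` for the centre
and `some k` for the ring, and then transported to arbitrary colours. -/
theorem hexKernel_rotate {q : ℕ} (x : Fin 12 → Fin q) :
    hexKernel (x ∘ Equiv.addRight 4) = hexKernel x := by
  have key : ∀ k m, ringFace none (some ∘ Equiv.addRight (4 : Fin 12)) k m =
      ringFace none some (k + 1) m := by decide
  refine hexKernel_comp (Equiv.addRight 4) (Equiv.addRight 1) (fun a x k => ?_) x
  congr 1
  funext m
  have := congrArg (fun o => Option.elim o a x) (key k m)
  rwa [comp_ringFace fun o => Option.elim o a x, comp_ringFace fun o => Option.elim o a x] at this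

theorem hexKernel_reflect {q : ℕ} (x : Fin 12 → Fin q) :
    hexKernel (x ∘ Equiv.neg (Fin 12)) = hexKernel x := by
  have key : ∀ k m, ringFace none (some ∘ Equiv.neg (Fin 12)) k m =
      ringFace none some (2 - k) (-m) := by decide
  refine hexKernel_comp (Equiv.neg _) (Equiv.subLeft 2) (fun a x k => ?_) x
  rw [← hexWeight_reflect (ringFace a x _)]
  congr 1
  funext m
  have := congrArg (fun o => Option.elim o a x) (key k m)
  rwa [comp_ringFace fun o => Option.elim o a x, comp_ringFace fun o => Option.elim o a x] at this

end HexDecimation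


/-! ### Positivity and the three interaction constants. -/

section HexConstants

theorem exists_ne_ne {q : ℕ} (hq : 3 ≤ q) (a b : Fin q) : ∃ c, c ≠ a ∧ c ≠ b := by
  have h : ({a, b} : Finset (Fin q)).card < (Finset.univ : Finset (Fin q)).card := by
    rw [Finset.card_univ, Fintype.card_fin]
    exact Finset.card_le_two.trans_lt hq
  obtain ⟨c, -, hc⟩ := Finset.exists_mem_notMem_of_card_lt_card h
  exact ⟨c, by simpa using hc⟩

theorem hexWeight_pos_of_exists {q : ℕ} {t : Fin 6 → Fin q}
    (h : ∃ s : Fin 6 → Fin q, (∀ k, s k ≠ s (k + 1)) ∧ ∀ k, s k ≠ t k) : 0 < hexWeight t := by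
  classical
  obtain ⟨s, hs⟩ := h
  refine Finset.sum_pos' (fun s _ => by split_ifs <;> simp) ⟨s, Finset.mem_univ s, ?_⟩
  rw [if_pos hs]
  exact one_pos

/-- If all forbidden colours agree, two other colours alternate around the cycle. Otherwise rotate
so that `u 0 ≠ u 5` and give the last vertex the colour `u 0`. Going backwards each vertex avoids
two colours, and the first one, which has to avoid `u 0` anyway, closes the cycle for free. -/
theorem hexWeight_pos {q : ℕ} (hq : 3 ≤ q) (t : Fin 6 → Fin q) : 0 < hexWeight t := by
  by_cases ht : ∀ k, t (k + 1) = t k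
  · obtain ⟨b, hb, -⟩ := exists_ne_ne hq (t 0) (t 0)
    obtain ⟨c, hc, hcb⟩ := exists_ne_ne hq (t 0) b
    have h1 : t 1 = t 0 := ht 0
    have h2 : t 2 = t 0 := (ht 1).trans h1
    have h3 : t 3 = t 0 := (ht 2).trans h2
    have h4 : t 4 = t 0 := (ht 3).trans h3
    have h5 : t 5 = t 0 := (ht 4).trans h4
    refine hexWeight_pos_of_exists ⟨![b, c, b, c, b, c], fun k => ?_, fun k => ?_⟩ <;>
      fin_cases k <;> simp [h1, h2, h3, h4, h5, hb, hc, hcb, hcb.symm]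
  · push Not at ht
    obtain ⟨k, hk⟩ := ht
    rw [← hexWeight_rotate t (k + 1)]
    set u : Fin 6 → Fin q := fun l => t (l + (k + 1)) with hu
    have h50 : u 0 ≠ u 5 := by
      have e : ∀ k : Fin 6, 5 + (k + 1) = k := by decide
      simpa [hu, e k] using hk
    obtain ⟨s4, h4, h45⟩ := exists_ne_ne hq (u 4) (u 0)
    obtain ⟨s3, h3, h34⟩ := exists_ne_ne hq (u 3) s4
    obtain ⟨s2, h2, h23⟩ := exists_ne_ne hq (u 2) s3
    obtain ⟨s1, h1, h12⟩ := exists_ne_ne hq (u 1) s2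
    obtain ⟨s0, h0, h01⟩ := exists_ne_ne hq (u 0) s1
    refine hexWeight_pos_of_exists ⟨![s0, s1, s2, s3, s4, u 0], fun k => ?_, fun k => ?_⟩ <;>
      fin_cases k <;> simp [h0, h1, h2, h3, h4, h01, h12, h23, h34, h45, h50, h0.symm]

theorem effectiveWeight_hexCluster_pos {q : ℕ} (hq : 3 ≤ q) (c : ℤ × ℤ)
    (t : Remaining hexCluster → Fin q) : 0 < effectiveWeight hexLattice hexCluster c t := by
  rw [effectiveWeight_hexCluster]
  exact hexWeight_pos hq _

/-- The sites that interact with a remaining site of the hexagonal decimation. -/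
def hexRemainingRing (i : Remaining hexCluster) : Fin 12 → Remaining hexCluster :=
  hexEquiv.symm ∘ hexRing (hexEquiv i)

theorem hexRemainingRing_injective (i : Remaining hexCluster) :
    Function.Injective (hexRemainingRing i) :=
  hexEquiv.symm.injective.comp (hexRing_injective _)

theorem hexEquiv_hexRemainingRing (i : Remaining hexCluster) (m : Fin 12) :
    hexEquiv (hexRemainingRing i m) = hexRing (hexEquiv i) m :=
  hexEquiv.apply_symm_apply _

theorem hexRemainingRing_ne (i : Remaining hexCluster) (m : Fin 12) : hexRemainingRing i m ≠ i := by
  intro h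
  have := congrArg hexEquiv h
  rw [hexEquiv_hexRemainingRing] at this
  exact hexRing_ne _ _ this

theorem interdependence_hexDecimated {q : ℕ} {i j : Remaining hexCluster} {m : Fin 12}
    (h : hexEquiv j = hexRing (hexEquiv i) m) :
    interdependence (hexDecimated q) i j = localDep (hexKernel (q := q)) m := by
  have hj : j = hexRemainingRing i m := by
    rw [hexRemainingRing, Function.comp_apply, ← h, Equiv.symm_apply_apply]
  rw [hj]
  exact interdependence_eq_localDep (siteKernel_hexDecimated i) (hexRemainingRing_injective i) m

theorem interdependence_hexDecimated_eq_zero {q : ℕ} {i j : Remaining hexCluster}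
    (h : ∀ m, hexRing (hexEquiv i) m ≠ hexEquiv j) : interdependence (hexDecimated q) i j = 0 :=
  interdependence_eq_zero (siteKernel_hexDecimated i) fun m hm => h m (by
    rw [← hm, Function.comp_apply, Equiv.apply_symm_apply])

theorem localDep_hexKernel_four {q : ℕ} (m : Fin 12) :
    localDep (hexKernel (q := q)) (m + 4) = localDep (hexKernel (q := q)) m :=
  localDep_perm (Equiv.addRight 4) hexKernel_rotate m

theorem localDep_hexKernel_neg {q : ℕ} (m : Fin 12) :
    localDep (hexKernel (q := q)) (-m) = localDep (hexKernel (q := q)) m :=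
  localDep_perm (Equiv.neg _) hexKernel_reflect m

/-- Rotations by four and the reflection have three orbits on the ring, represented by `0, 1, 2`. -/
theorem localDep_hexKernel {q : ℕ} (m : Fin 12) : localDep (hexKernel (q := q)) m =
    localDep (hexKernel (q := q)) (![0, 1, 2, 1, 0, 1, 2, 1, 0, 1, 2, 1] m) := by
  have h4 : localDep (hexKernel (q := q)) 4 = localDep (hexKernel (q := q)) 0 :=
    localDep_hexKernel_four 0
  have h8 : localDep (hexKernel (q := q)) 8 = localDep (hexKernel (q := q)) 0 :=
    (localDep_hexKernel_four 4).trans h4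
  have h5 : localDep (hexKernel (q := q)) 5 = localDep (hexKernel (q := q)) 1 :=
    localDep_hexKernel_four 1
  have h9 : localDep (hexKernel (q := q)) 9 = localDep (hexKernel (q := q)) 1 :=
    (localDep_hexKernel_four 5).trans h5
  have h6 : localDep (hexKernel (q := q)) 6 = localDep (hexKernel (q := q)) 2 :=
    localDep_hexKernel_four 2
  have h10 : localDep (hexKernel (q := q)) 10 = localDep (hexKernel (q := q)) 2 :=
    (localDep_hexKernel_four 6).trans h6
  have h11 : localDep (hexKernel (q := q)) 11 = localDep (hexKernel (q := q)) 1 :=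
    localDep_hexKernel_neg 1
  have h3 : localDep (hexKernel (q := q)) 3 = localDep (hexKernel (q := q)) 1 :=
    (localDep_hexKernel_four 11).trans h11
  have h7 : localDep (hexKernel (q := q)) 7 = localDep (hexKernel (q := q)) 1 :=
    (localDep_hexKernel_four 3).trans h3
  fin_cases m <;> first | rfl | assumption

theorem dobrushinConstant_hexDecimated (q : ℕ) : dobrushinConstant (hexDecimated q) =
    3 * localDep (hexKernel (q := q)) 0 + 6 * localDep (hexKernel (q := q)) 1 +
      3 * localDep (hexKernel (q := q)) 2 := by
  have : Nonempty (Remaining hexCluster) := ⟨hexEquiv.symm ((0, 0), true)⟩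
  rw [dobrushinConstant_eq siteKernel_hexDecimated hexRemainingRing_injective hexRemainingRing_ne,
    Finset.sum_congr rfl fun m _ => localDep_hexKernel m]
  simp [Fin.sum_univ_succ]
  ring

end HexConstants

/-! ### Graph distance on the hexagonal lattice. -/

section HexDistance

theorem hexLattice_reachable_origin (x : HexSite) : hexLattice.Reachable ((0, 0), false) x := by
  have h1 : ∀ a b : ℤ, hexLattice.Reachable ((a, b), false) ((a, b), true) := fun a b =>
    (hexLattice_adj_ft.2 (by simp)).reachable
  have h2 : ∀ a b : ℤ, hexLattice.Reachable ((a, b), false) ((a + 1, b), false) := fun a b =>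
    (h1 a b).trans (hexLattice_adj_tf.2 (by simp)).reachable
  have h3 : ∀ a b : ℤ, hexLattice.Reachable ((a, b), false) ((a, b + 1), false) := fun a b =>
    (h1 a b).trans (hexLattice_adj_tf.2 (by simp)).reachable
  have h4 : ∀ a : ℤ, hexLattice.Reachable ((0, 0), false) ((a, 0), false) := by
    intro a
    induction a using Int.induction_on with
    | zero => exact SimpleGraph.Reachable.refl _
    | succ a ih => exact ih.trans (h2 _ _)
    | pred a ih =>
      refine ih.trans ?_
      have := (h2 (-a - 1) 0).symm
      rwa [sub_add_cancel] at this
  have h5 : ∀ a b : ℤ, hexLattice.Reachable ((0, 0), false) ((a, b), false) := by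
    intro a b
    induction b using Int.induction_on with
    | zero => exact h4 a
    | succ b ih => exact ih.trans (h3 _ _)
    | pred b ih =>
      refine ih.trans ?_
      have := (h3 a (-b - 1)).symm
      rwa [sub_add_cancel] at this
  obtain ⟨⟨a, b⟩, _ | _⟩ := x
  · exact h5 a b
  · exact (h5 a b).trans (h1 a b)

theorem hexLattice_connected : hexLattice.Connected :=
  ⟨fun x y => (hexLattice_reachable_origin x).symm.trans (hexLattice_reachable_origin y)⟩

theorem hexLattice_dist_triangle (x y z : HexSite) :
    hexLattice.dist x z ≤ hexLattice.dist x y + hexLattice.dist y z :=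
  hexLattice_connected.dist_triangle

theorem exists_adj_adj_of_dist_eq_two {V : Type} {G : SimpleGraph V} {x y : V}
    (h : G.dist x y = 2) : x ≠ y ∧ ∃ z, G.Adj x z ∧ G.Adj z y := by
  refine ⟨fun e => by simp [e] at h, ?_⟩
  obtain ⟨w, hw⟩ := SimpleGraph.exists_walk_of_dist_ne_zero (G := G) (u := x) (v := y) (by omega)
  rw [h] at hw
  match w, hw with
  | .cons h1 (.cons h2 .nil), _ => exact ⟨_, h1, h2⟩

theorem hexLattice_adj_hexRing (h y : HexSite) : hexLattice.Adj h y ↔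
    y = hexRing h 0 ∨ y = hexRing h 4 ∨ y = hexRing h 8 := by
  rw [hexLattice_adj_iff]
  obtain ⟨⟨a, b⟩, _ | _⟩ := h
  · simp [hexNbr, hexRing]
  · simp [hexNbr, hexRing]
    tauto

theorem exists_hexRing_of_adj_adj {h z y : HexSite} (hz : hexLattice.Adj h z)
    (hy : hexLattice.Adj z y) (hne : h ≠ y) :
    ∃ m : Fin 12, (m : ℕ) % 2 = 1 ∧ y = hexRing h m := by
  rw [hexLattice_adj_iff] at hz hy
  have key : (y = hexRing h 1 ∨ y = hexRing h 3 ∨ y = hexRing h 5) ∨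
      y = hexRing h 7 ∨ y = hexRing h 9 ∨ y = hexRing h 11 := by
    obtain ⟨⟨a, b⟩, _ | _⟩ := h <;> obtain ⟨⟨c, d⟩, _ | _⟩ := z <;>
      obtain ⟨⟨e, f⟩, _ | _⟩ := y <;> simp [hexNbr, hexRing] at hz hy hne ⊢ <;> omega
  rcases key with (h | h | h) | h | h | h
  exacts [⟨1, rfl, h⟩, ⟨3, rfl, h⟩, ⟨5, rfl, h⟩, ⟨7, rfl, h⟩, ⟨9, rfl, h⟩, ⟨11, rfl, h⟩]

theorem hexRing_adj_succ (h : HexSite) (m : Fin 12) :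
    hexLattice.Adj (hexRing h m) (hexRing h (m + 1)) := by
  obtain ⟨⟨a, b⟩, _ | _⟩ := h <;> fin_cases m <;>
    simp [hexRing, hexLattice_adj_ft, hexLattice_adj_tf]

theorem hexLattice_dist_adj {x y : HexSite} (h : hexLattice.Adj x y) : hexLattice.dist x y = 1 :=
  SimpleGraph.dist_eq_one_iff_adj.2 h

/-- Walking along the ring from the nearest neighbours gives the bounds. Upper bounds suffice later:
a site at distance three on a common face can only occupy position `2`, `6` or `10`. -/
theorem dist_hexRing_le (h : HexSite) (m : Fin 12) : hexLattice.dist h (hexRing h m) ≤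
    (![1, 2, 3, 2, 1, 2, 3, 2, 1, 2, 3, 2] : Fin 12 → ℕ) m := by
  have h0 := hexLattice_dist_adj ((hexLattice_adj_hexRing h _).2 (Or.inl rfl))
  have h4 := hexLattice_dist_adj ((hexLattice_adj_hexRing h _).2 (Or.inr (Or.inl rfl)))
  have h8 := hexLattice_dist_adj ((hexLattice_adj_hexRing h _).2 (Or.inr (Or.inr rfl)))
  have succ : ∀ m, hexLattice.dist h (hexRing h (m + 1)) ≤ hexLattice.dist h (hexRing h m) + 1 :=
    fun m => by
      rw [← hexLattice_dist_adj (hexRing_adj_succ h m)]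
      exact hexLattice_dist_triangle _ _ _
  have pred : ∀ m, hexLattice.dist h (hexRing h m) ≤ hexLattice.dist h (hexRing h (m + 1)) + 1 :=
    fun m => by
      rw [← hexLattice_dist_adj (hexRing_adj_succ h m).symm]
      exact hexLattice_dist_triangle _ _ _
  have s0 := succ 0
  have s1 := succ 1
  have s4 := succ 4
  have s5 := succ 5
  have s8 := succ 8
  have s9 := succ 9
  have p3 := pred 3
  have p7 := pred 7
  have p11 := pred 11
  simp only [Fin.isValue, Fin.reduceAdd] at s0 s1 s4 s5 s8 s9 p3 p7 p11
  fin_cases m <;> simp <;> omega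

theorem exists_hexRing_of_mem_hexFace {p : ℤ × ℤ} {h y : HexSite} (hh : h ∈ hexFace p)
    (hy : y ∈ hexFace p) (hne : h ≠ y) : ∃ m, y = hexRing h m := by
  obtain ⟨k, rfl⟩ := mem_hexFace_iff_siteFace.1 hh
  obtain ⟨l, rfl⟩ := mem_hexFace.1 hy
  rw [← sub_add_cancel l (hexStart h k), faceSite_siteFace] at hne ⊢
  generalize l - hexStart h k = m at hne ⊢
  fin_cases k <;> fin_cases m <;> first | exact absurd rfl hne | exact ⟨_, rfl⟩

theorem exists_hexFace_hexRing (h : HexSite) (m : Fin 12) :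
    ∃ p, h ∈ hexFace p ∧ hexRing h m ∈ hexFace p := by
  have key : ∀ m : Fin 12, ∃ k l, ringFace none (some : Fin 12 → _) k l = some m := by decide
  obtain ⟨k, l, hkl⟩ := key m
  refine ⟨siteFace h k, mem_hexFace_iff_siteFace.2 ⟨k, rfl⟩, mem_hexFace.2 ⟨l + hexStart h k, ?_⟩⟩
  rw [faceSite_siteFace]
  have := congrArg (fun o => Option.elim o h (hexRing h)) hkl
  rwa [comp_ringFace fun o => Option.elim o h (hexRing h)] at this

end HexDistance

/-! ### Interdependence matrix of the hexagonal decimation. -/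

section HexInterdependence

variable {q : ℕ} {i j : Remaining hexCluster}

theorem interdependence_hexDecimated_of_dist_one
    (h : hexLattice.dist (hexEquiv i) (hexEquiv j) = 1) :
    interdependence (hexDecimated q) i j = localDep (hexKernel (q := q)) 0 := by
  rcases (hexLattice_adj_hexRing _ _).1 (SimpleGraph.dist_eq_one_iff_adj.1 h) with h | h | h <;>
    exact (interdependence_hexDecimated h).trans (localDep_hexKernel _)

theorem interdependence_hexDecimated_of_dist_two
    (h : hexLattice.dist (hexEquiv i) (hexEquiv j) = 2) :
    interdependence (hexDecimated q) i j = localDep (hexKernel (q := q)) 1 := by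
  obtain ⟨hne, z, hz, hy⟩ := exists_adj_adj_of_dist_eq_two h
  obtain ⟨m, hm, h⟩ := exists_hexRing_of_adj_adj hz hy hne
  rw [interdependence_hexDecimated h, localDep_hexKernel]
  fin_cases m <;> first | rfl | simp at hm

theorem interdependence_hexDecimated_of_dist_three
    (h : hexLattice.dist (hexEquiv i) (hexEquiv j) = 3)
    (hp : ∃ p, hexEquiv i ∈ hexFace p ∧ hexEquiv j ∈ hexFace p) :
    interdependence (hexDecimated q) i j = localDep (hexKernel (q := q)) 2 := by
  obtain ⟨p, hi, hj⟩ := hp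
  obtain ⟨m, hm⟩ := exists_hexRing_of_mem_hexFace hi hj fun e => by simp [e] at h
  rw [interdependence_hexDecimated hm, localDep_hexKernel]
  have hd := dist_hexRing_le (hexEquiv i) m
  rw [← hm, h] at hd
  fin_cases m <;> first | rfl | simp at hd

theorem interdependence_hexDecimated_of_not_mem
    (h : ¬ ∃ p, hexEquiv i ∈ hexFace p ∧ hexEquiv j ∈ hexFace p) :
    interdependence (hexDecimated q) i j = 0 :=
  interdependence_hexDecimated_eq_zero fun m hm => h (by
    rw [← hm]; exact exists_hexFace_hexRing _ m)

theorem dist_le_of_interdependence_hexDecimated (h : interdependence (hexDecimated q) i j ≠ 0) :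
    hexLattice.dist (hexEquiv i) (hexEquiv j) ≤ 3 := by
  by_contra hd
  refine h (interdependence_hexDecimated_eq_zero fun m hm => hd ?_)
  rw [← hm]
  refine (dist_hexRing_le _ m).trans ?_
  fin_cases m <;> simp

theorem isSpec_hexDecimated (hq : 3 ≤ q) : IsSpec (hexDecimated q) :=
  have : Nonempty (Fin q) := ⟨⟨0, by omega⟩⟩
  isSpec_decimatedWeight isDecimation_hexCluster (effectiveWeight_hexCluster_pos hq)

end HexInterdependence


/-! ### Variation distance from bounds on cross ratios. -/

section CrossRatio

variable {q : ℕ} {p p' : Fin q → ℝ}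

/-- With `P = p(A)` and `P' = p'(A)`, the difference `τ = P' - P` equals `P' (1 - P) - P (1 - P')`,
a sum of the cross differences over `A × Aᶜ`. The corresponding sum with a plus sign is at most `(1
+ τ²) / 2`, the gap being `(P + P' - 1)² / 2`. So `τ ≤ ε + t (1 + τ²) / 2`, and since `t` and `τ`
are at most one, `hc` excludes `τ > c`. -/
theorem varDist_le_of_cross (hp : ∑ a, p a = 1) (hp' : ∑ a, p' a = 1) (h0 : ∀ a, 0 ≤ p a)
    (h0' : ∀ a, 0 ≤ p' a) {t ε c : ℝ} (ht0 : 0 ≤ t) (ht1 : t ≤ 1)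
    {E : Fin q → Fin q → ℝ}
    (hcross : ∀ a b, p' a * p b - p a * p' b ≤ t * (p' a * p b + p a * p' b) + E a b)
    (hE : ∀ A : Finset (Fin q), ∑ a ∈ A, ∑ b ∈ Aᶜ, E a b ≤ ε)
    (hc : ε + t * (1 + c ^ 2) / 2 ≤ c) : varDist p p' ≤ c := by
  have key : ∀ A : Finset (Fin q), ∑ a ∈ A, p' a - ∑ a ∈ A, p a ≤ c := by
    intro A
    have hA := Finset.sum_add_sum_compl A p
    have hA' := Finset.sum_add_sum_compl A p'
    rw [hp] at hA
    rw [hp'] at hA'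
    have hcr : ∑ a ∈ A, ∑ b ∈ Aᶜ, (p' a * p b - p a * p' b) ≤
        ∑ a ∈ A, ∑ b ∈ Aᶜ, (t * (p' a * p b + p a * p' b) + E a b) :=
      Finset.sum_le_sum fun a _ => Finset.sum_le_sum fun b _ => hcross a b
    simp only [Finset.sum_add_distrib, Finset.sum_sub_distrib, ← Finset.mul_sum,
      ← Finset.sum_mul] at hcr
    have hEA := hE A
    set P := ∑ a ∈ A, p a
    set P' := ∑ a ∈ A, p' a
    have e1 : ∑ b ∈ Aᶜ, p b = 1 - P := by linarith
    have e2 : ∑ b ∈ Aᶜ, p' b = 1 - P' := by linarith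
    rw [e1, e2] at hcr
    have hP : 0 ≤ P := Finset.sum_nonneg fun a _ => h0 a
    have hP' : P' ≤ 1 := by
      have : 0 ≤ ∑ b ∈ Aᶜ, p' b := Finset.sum_nonneg fun a _ => h0' a
      linarith
    have h1 : P' * (1 - P) + P * (1 - P') ≤ (1 + (P' - P) ^ 2) / 2 := by
      nlinarith [sq_nonneg (P + P' - 1)]
    have h2 : P' - P ≤ t * ((1 + (P' - P) ^ 2) / 2) + ε := by
      have := mul_le_mul_of_nonneg_left h1 ht0
      linarith
    by_contra! hlt
    set τ := P' - P with hτ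
    have h3 : (τ - c) * (1 - t * ((τ + c) / 2)) ≤ 0 := by linarith
    have h4 : 0 < 1 - t * ((τ + c) / 2) := by
      by_cases hs : 0 ≤ (τ + c) / 2
      · have := mul_le_mul_of_nonneg_right ht1 hs
        linarith
      · have := mul_nonpos_of_nonneg_of_nonpos ht0 (not_le.1 hs).le
        linarith
    exact absurd h3 (not_le.2 (mul_pos (sub_pos.2 hlt) h4))
  refine ciSup_le fun A => abs_le.2 ⟨by linarith [key A], ?_⟩
  have h := key Aᶜ
  have hA := Finset.sum_add_sum_compl A p
  have hA' := Finset.sum_add_sum_compl A p'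
  linarith

theorem sub_le_of_le_mul {u v r : ℝ} (hr : 1 ≤ r) (h : u ≤ r * v) :
    u - v ≤ (r - 1) / (r + 1) * (u + v) := by
  rw [div_mul_eq_mul_div, le_div_iff₀ (by linarith)]
  nlinarith

/-- For `c ≤ 1` the condition `hc` amounts to `c ≥ (√r - 1) / (√r + 1)`, put in a form that avoids
square roots. -/
theorem varDist_le_of_cross_ratio (hp : ∑ a, p a = 1) (hp' : ∑ a, p' a = 1) (h0 : ∀ a, 0 ≤ p a)
    (h0' : ∀ a, 0 ≤ p' a) {r c : ℝ} (hr : 1 ≤ r)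
    (hcross : ∀ a b, p' a * p b ≤ r * (p a * p' b))
    (hc : (r - 1) / (r + 1) * (1 + c ^ 2) / 2 ≤ c) : varDist p p' ≤ c := by
  refine varDist_le_of_cross (t := (r - 1) / (r + 1)) (E := fun _ _ => 0) (ε := 0) hp hp' h0 h0'
    (div_nonneg (by linarith) (by linarith)) ((div_le_one (by linarith)).2 (by linarith))
    (fun a b => ?_) (by simp) (by linarith)
  rw [add_zero]
  exact sub_le_of_le_mul hr (hcross a b)

/-- Two further colours have total mass at least `8/27` of that of `x` and `y`, and `1 / (1 + 8/27)
= 27/35`. -/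
theorem add_le_of_pairwise_ratio (hq : 4 ≤ q) (hp : ∑ a, p a = 1)
    (hκ : ∀ a b, p a ≤ 27 / 8 * p b) {x y : Fin q} (hxy : x ≠ y) : p x + p y ≤ 27 / 35 := by
  have h0 : ∀ a, 0 ≤ p a := fun a => by linarith [hκ a a]
  obtain ⟨z, hzx, hzy⟩ := exists_ne_ne (by omega : 3 ≤ q) x y
  have h : ({x, y, z} : Finset (Fin q)).card < (Finset.univ : Finset (Fin q)).card := by
    rw [Finset.card_univ, Fintype.card_fin]
    exact Finset.card_le_three.trans_lt hq
  obtain ⟨w, -, hw⟩ := Finset.exists_mem_notMem_of_card_lt_card h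
  simp only [Finset.mem_insert, Finset.mem_singleton, not_or] at hw
  have hsum : p x + (p y + (p z + p w)) ≤ 1 := by
    rw [← hp, ← Finset.sum_pair (Ne.symm hw.2.2), ← Finset.sum_insert, ← Finset.sum_insert]
    · exact Finset.sum_le_univ_sum_of_nonneg h0
    · simp [hxy, hzx.symm, Ne.symm hw.1]
    · simp [hzy.symm, Ne.symm hw.2.1]
  linarith [hκ x z, hκ y z, hκ x w, hκ y w]

/-- The product `(p x + p y) (p' x + p' y)` contains, besides the two cross terms `M` and `N`, the
diagonal terms `X` and `Y` with `X Y = M N`. As `M` and `N` are comparable, the diagonal terms take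
a definite share of the product. -/
theorem cross_le_third (hq : 4 ≤ q) (hp : ∑ a, p a = 1) (hp' : ∑ a, p' a = 1)
    (hκ : ∀ a b, p a ≤ 27 / 8 * p b) (hκ' : ∀ a b, p' a ≤ 27 / 8 * p' b) {x y : Fin q}
    (hxy : x ≠ y) (h1 : p' x * p y ≤ 5 / 2 * (p x * p' y))
    (h2 : p x * p' y ≤ 5 / 2 * (p' x * p y)) : p' x * p y + p x * p' y ≤ 1 / 3 := by
  have h0 : ∀ a, 0 ≤ p a := fun a => by linarith [hκ a a]
  have h0' : ∀ a, 0 ≤ p' a := fun a => by linarith [hκ' a a]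
  have s := add_le_of_pairwise_ratio hq hp hκ hxy
  have s' := add_le_of_pairwise_ratio hq hp' hκ' hxy
  have hprod : (p x + p y) * (p' x + p' y) ≤ 27 / 35 * (27 / 35) :=
    mul_le_mul s s' (add_nonneg (h0' _) (h0' _)) (by norm_num)
  have hM : 0 ≤ p' x * p y := mul_nonneg (h0' _) (h0 _)
  have hN : 0 ≤ p x * p' y := mul_nonneg (h0 _) (h0' _)
  have hX : 0 ≤ p x * p' x := mul_nonneg (h0 _) (h0' _)
  have hY : 0 ≤ p y * p' y := mul_nonneg (h0 _) (h0' _)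
  have hXY : (p x * p' x) * (p y * p' y) = (p' x * p y) * (p x * p' y) := by ring
  have hexp : (p x + p y) * (p' x + p' y) =
      p x * p' x + p y * p' y + (p' x * p y + p x * p' y) := by ring
  rw [hexp] at hprod
  generalize p' x * p y = M at *
  generalize p x * p' y = N at *
  generalize p x * p' x = X at *
  generalize p y * p' y = Y at *
  -- By the arithmetic-geometric inequality `(X + Y)² ≥ 4 M N`, and ratios of at most `5/2` give `4
  -- M N ≥ (16/25) (M + N)²`. Then `9/5 * (M + N) ≤ (27/35)²`, which is enough for `1/3`.
  have hge : 4 / 5 * (M + N) ≤ X + Y := by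
    refine abs_le_of_sq_le_sq' ?_ (by linarith) |>.2
    nlinarith [mul_nonneg (sub_nonneg.2 h1) (sub_nonneg.2 h2), sq_nonneg (X - Y)]
  linarith

/-- When a neighbour changes from `x` to `y`, the worst cross ratio occurs for the pair `x, y`
alone. Using `s` there and `r` elsewhere adds an error of `(t' - t) / 3` only once, since at most
one of `(x, y)` and `(y, x)` lies in `A × Aᶜ`. -/
theorem varDist_le_of_cross_ratio_pair (hq : 4 ≤ q) (hp : ∑ a, p a = 1) (hp' : ∑ a, p' a = 1)
    (hκ : ∀ a b, p a ≤ 27 / 8 * p b) (hκ' : ∀ a b, p' a ≤ 27 / 8 * p' b) {x y : Fin q}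
    (hxy : x ≠ y) {r s c : ℝ} (hr : 1 ≤ r) (hrs : r ≤ s) (hs : s ≤ 5 / 2)
    (hcross : ∀ a b, p' a * p b ≤ s * (p a * p' b))
    (hcross' : ∀ a b, ¬ (a = x ∧ b = y) → ¬ (a = y ∧ b = x) → p' a * p b ≤ r * (p a * p' b))
    (hc : ((s - 1) / (s + 1) - (r - 1) / (r + 1)) / 3 + (r - 1) / (r + 1) * (1 + c ^ 2) / 2 ≤ c) :
    varDist p p' ≤ c := by
  have h0 : ∀ a, 0 ≤ p a := fun a => by linarith [hκ a a]
  have h0' : ∀ a, 0 ≤ p' a := fun a => by linarith [hκ' a a]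
  have hS : p' x * p y + p x * p' y ≤ 1 / 3 := by
    refine cross_le_third hq hp hp' hκ hκ' hxy ?_ ?_
    · exact (hcross x y).trans (mul_le_mul_of_nonneg_right hs (mul_nonneg (h0 _) (h0' _)))
    · have h := (hcross y x).trans (mul_le_mul_of_nonneg_right hs (mul_nonneg (h0 _) (h0' _)))
      linarith
  set t := (r - 1) / (r + 1) with ht
  set t' := (s - 1) / (s + 1) with ht'
  have htt : 0 ≤ t' - t := by
    rw [ht, ht', sub_nonneg, div_le_div_iff₀ (by linarith) (by linarith)]
    nlinarith
  classical
  refine varDist_le_of_cross (t := t) (E := fun a b => if a = x ∧ b = y ∨ a = y ∧ b = x then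
    (t' - t) / 3 else 0) (ε := (t' - t) / 3) hp hp' h0 h0'
    (div_nonneg (by linarith) (by linarith)) ((div_le_one (by linarith)).2 (by linarith))
    (fun a b => ?_) (fun A => ?_) hc
  · split_ifs with h
    · have h1 := sub_le_of_le_mul (hr.trans hrs) (hcross a b)
      rw [← ht'] at h1
      have h2 : p' a * p b + p a * p' b ≤ 1 / 3 := by
        rcases h with ⟨rfl, rfl⟩ | ⟨rfl, rfl⟩
        · exact hS
        · linarith
      have := mul_le_mul_of_nonneg_left h2 htt
      linarith
    · push Not at h
      rw [add_zero]
      exact sub_le_of_le_mul hr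
        (hcross' a b (fun e => h.1 e.1 e.2) (fun e => h.2 e.1 e.2))
  · have hsingle : ∀ u v : Fin q, ∑ a ∈ A, ∑ b ∈ Aᶜ, (if a = u ∧ b = v then (t' - t) / 3 else 0) ≤
        (t' - t) / 3 := by
      intro u v
      calc _ ≤ ∑ a, ∑ b, (if a = u ∧ b = v then (t' - t) / 3 else 0) := by
            refine (Finset.sum_le_sum fun a _ => Finset.sum_le_univ_sum_of_nonneg fun b => ?_).trans
              (Finset.sum_le_univ_sum_of_nonneg fun a => Finset.sum_nonneg fun b _ => ?_) <;>
            split_ifs <;> linarith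
        _ = (t' - t) / 3 := by simp [ite_and]
    by_cases hx : x ∈ A
    · refine le_trans (Finset.sum_le_sum fun a ha => Finset.sum_le_sum fun b hb => ?_) (hsingle x y)
      rw [if_congr (or_iff_left fun e : a = y ∧ b = x => Finset.mem_compl.1 hb (e.2 ▸ hx)) rfl rfl]
    · refine le_trans (Finset.sum_le_sum fun a ha => Finset.sum_le_sum fun b hb => ?_) (hsingle y x)
      rw [if_congr (or_iff_right fun e : a = x ∧ b = y => hx (e.1 ▸ ha)) rfl rfl]

end CrossRatio


/-! ### Computation of the hexagon weights for four colours. -/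

section HexCount

/-- One step of the transfer-matrix count of the colourings of a path by four colours, at a vertex
that avoids the colour `t`. -/
def transferStep (t : ℕ) (g : ℕ × ℕ × ℕ × ℕ) : ℕ × ℕ × ℕ × ℕ :=
  (fun a b c d => (b + (c + d), a + (c + d), a + (b + d), a + (b + c)))
    (bif t == 0 then 0 else g.1) (bif t == 1 then 0 else g.2.1) (bif t == 2 then 0 else g.2.2.1)
    (bif t == 3 then 0 else g.2.2.2)

/-- The number of colourings of a six-cycle by four colours whose vertices avoid prescribed
colours. -/
def hexCount (t₀ t₁ t₂ t₃ t₄ t₅ : ℕ) : ℕ :=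
  (fun T => (bif t₀ == 0 then 0 else (T (0, 1, 1, 1)).1) +
    ((bif t₀ == 1 then 0 else (T (1, 0, 1, 1)).2.1) +
    ((bif t₀ == 2 then 0 else (T (1, 1, 0, 1)).2.2.1) +
      (bif t₀ == 3 then 0 else (T (1, 1, 1, 0)).2.2.2))))
    (fun g => transferStep t₁ (transferStep t₂ (transferStep t₃ (transferStep t₄
      (transferStep t₅ g)))))

/-- A quadruple as a function on the four colours. -/
def quad (g : ℕ × ℕ × ℕ × ℕ) : Fin 4 → ℕ := ![g.1, g.2.1, g.2.2.1, g.2.2.2]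

theorem quad_transferStep (t : Fin 4) (g : ℕ × ℕ × ℕ × ℕ) (s : Fin 4) :
    quad (transferStep t g) s = ∑ s', if s ≠ s' ∧ s' ≠ t then quad g s' else 0 := by
  fin_cases t <;> fin_cases s <;> simp [quad, transferStep, Fin.sum_univ_four] <;> ring

theorem hexCount_eq (t : Fin 6 → Fin 4) : hexCount (t 0) (t 1) (t 2) (t 3) (t 4) (t 5) =
    ∑ s₀, if s₀ ≠ t 0 then quad (transferStep (t 1) (transferStep (t 2) (transferStep (t 3)
      (transferStep (t 4) (transferStep (t 5) (if s₀ = 0 then 0 else 1, if s₀ = 1 then 0 else 1,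
        if s₀ = 2 then 0 else 1, if s₀ = 3 then 0 else 1)))))) s₀ else 0 := by
  generalize t 0 = t₀
  rw [Fin.sum_univ_four]
  fin_cases t₀ <;> simp [hexCount, quad] <;> ring

theorem sum_fin_six {q : ℕ} (f : (Fin 6 → Fin q) → ℝ) :
    ∑ s, f s = ∑ a, ∑ b, ∑ c, ∑ d, ∑ e, ∑ g, f ![a, b, c, d, e, g] := by
  let e : ((((Fin q × Fin q) × Fin q) × Fin q) × Fin q) × Fin q ≃ (Fin 6 → Fin q) :=
    { toFun := fun u => ![u.1.1.1.1.1, u.1.1.1.1.2, u.1.1.1.2, u.1.1.2, u.1.2, u.2]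
      invFun := fun s => (((((s 0, s 1), s 2), s 3), s 4), s 5)
      left_inv := fun u => rfl
      right_inv := fun s => by
        funext k
        fin_cases k <;> rfl }
  rw [← Equiv.sum_comp e]
  simp only [Fintype.sum_prod_type]
  rfl

/-- The cycle is cut at its first vertex. For a fixed colour `s₀`, the starting vector forbids `s₀`
at the last vertex, which accounts for the closing edge, and five transfer steps lead back to `s₀`.
-/
theorem hexWeight_eq_hexCount (t : Fin 6 → Fin 4) :
    hexWeight t = hexCount (t 0) (t 1) (t 2) (t 3) (t 4) (t 5) := by
  rw [hexCount_eq, hexWeight, sum_fin_six]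
  push_cast
  refine Finset.sum_congr rfl fun s₀ _ => ?_
  have h0 : ∀ s : Fin 4, quad (if s₀ = 0 then 0 else 1, if s₀ = 1 then 0 else 1,
      if s₀ = 2 then 0 else 1, if s₀ = 3 then 0 else 1) s = if s ≠ s₀ then 1 else 0 := by
    intro s
    revert s₀ s
    decide
  simp only [quad_transferStep, h0]
  push_cast
  simp only [Finset.ite_sum_zero, ← ite_and]
  refine Finset.sum_congr rfl fun s₁ _ => Finset.sum_congr rfl fun s₂ _ =>
    Finset.sum_congr rfl fun s₃ _ => Finset.sum_congr rfl fun s₄ _ =>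
    Finset.sum_congr rfl fun s₅ _ => ?_
  refine if_congr ?_ rfl rfl
  simp [Fin.forall_fin_succ]
  tauto

theorem hexWeight_comp_perm {q : ℕ} (π : Fin q ≃ Fin q) (t : Fin 6 → Fin q) :
    hexWeight (π ∘ t) = hexWeight t := by
  classical
  unfold hexWeight
  refine (Fintype.sum_equiv ((Equiv.refl (Fin 6)).arrowCongr π) _ _ fun s => ?_).symm
  simp [Equiv.arrowCongr_apply]

/-- Conjunction over the four colours. -/
def all4 (f : ℕ → Bool) : Bool := f 0 && (f 1 && (f 2 && f 3))

theorem of_all4 {f : ℕ → Bool} (h : all4 f = true) (a : Fin 4) : f a = true := by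
  simp only [all4, Bool.and_eq_true] at h
  fin_cases a
  exacts [h.1, h.2.1, h.2.2.1, h.2.2.2]

/-- Comparison of the weights `F a x`, where the colours `a` and `x = 0` avoided at two vertices
vary. -/
def crossCheck (n r s : ℕ) (F : ℕ → ℕ → ℕ) : Bool :=
  all4 fun y => all4 fun a => all4 fun b => Nat.ble (n * (F a y * F b 0))
    ((bif (a == 0 && b == y) || (a == y && b == 0) then s else r) * (F a 0 * F b y))

/-- Finite checks for a changed vertex next to, two steps from, or opposite to the central one. The
ratios are rational bounds good enough to give `α < 1`. -/
theorem crossCheck_one : (all4 fun a => all4 fun b => all4 fun c => all4 fun d =>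
    crossCheck 25 34 39 fun i j => hexCount i j a b c d) = true := by
  decide +kernel

theorem crossCheck_two : (all4 fun a => all4 fun b => all4 fun c => all4 fun d =>
    crossCheck 50 61 61 fun i j => hexCount i a j b c d) = true := by
  decide +kernel

theorem crossCheck_three : (all4 fun a => all4 fun b => all4 fun c => all4 fun d =>
    crossCheck 8 9 9 fun i j => hexCount i a b j c d) = true := by
  decide +kernel

theorem ratioCheck : (all4 fun b => all4 fun c => all4 fun d => all4 fun e => all4 fun x =>
    all4 fun y => Nat.ble (2 * hexCount x 0 b c d e) (3 * hexCount y 0 b c d e)) = true := by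
  decide +kernel

theorem hexWeight_le_of_ratio (v : Fin 5 → Fin 4) (x y : Fin 4) :
    hexWeight ![x, v 0, v 1, v 2, v 3, v 4] ≤ 3 / 2 * hexWeight ![y, v 0, v 1, v 2, v 3, v 4] := by
  have h : ∀ (x : Fin 4), hexWeight ![x, v 0, v 1, v 2, v 3, v 4] =
      hexCount (Equiv.swap (v 0) 0 x) 0 (Equiv.swap (v 0) 0 (v 1)) (Equiv.swap (v 0) 0 (v 2))
        (Equiv.swap (v 0) 0 (v 3)) (Equiv.swap (v 0) 0 (v 4)) := fun x => by
    rw [← hexWeight_comp_perm (Equiv.swap (v 0) 0), hexWeight_eq_hexCount]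
    simp
  have := Nat.le_of_ble_eq_true (of_all4 (of_all4 (of_all4 (of_all4 (of_all4 (of_all4 ratioCheck
    (Equiv.swap (v 0) 0 (v 1))) (Equiv.swap (v 0) 0 (v 2))) (Equiv.swap (v 0) 0 (v 3)))
      (Equiv.swap (v 0) 0 (v 4))) (Equiv.swap (v 0) 0 x)) (Equiv.swap (v 0) 0 y))
  have h' := (Nat.cast_le (α := ℝ)).2 this
  push_cast at h'
  rw [← h, ← h] at h'
  linarith

/-- The weights `F a x` change by a ratio of at most `r`, or `s` for the two colours concerned,
under a change of the second argument, relative to each other. -/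
def CrossBound {q : ℕ} (r s : ℝ) (F : Fin q → Fin q → ℝ) : Prop :=
  ∀ a b x y, F a y * F b x ≤
    (if (a = x ∧ b = y) ∨ (a = y ∧ b = x) then s else r) * (F a x * F b y)

/-- A transposition of colours moves `x` to `0`, so the check may keep one of the two compared
colours fixed at `0`. -/
theorem crossBound_of_check {n r s : ℕ} (hn : 0 < n) {F : Fin 4 → Fin 4 → ℝ}
    (h : ∀ x : Fin 4, ∃ G : ℕ → ℕ → ℕ, crossCheck n r s G = true ∧
      ∀ a y, F a y = G (Equiv.swap x 0 a) (Equiv.swap x 0 y)) : CrossBound (r / n) (s / n) F := by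
  have e : ∀ a b x y : Fin 4, ((((Equiv.swap x 0 a : Fin 4) : ℕ) == 0 &&
      ((Equiv.swap x 0 b : Fin 4) : ℕ) == ((Equiv.swap x 0 y : Fin 4) : ℕ)) ||
      (((Equiv.swap x 0 a : Fin 4) : ℕ) == ((Equiv.swap x 0 y : Fin 4) : ℕ) &&
      ((Equiv.swap x 0 b : Fin 4) : ℕ) == 0)) = decide ((a = x ∧ b = y) ∨ (a = y ∧ b = x)) := by
    decide +kernel
  intro a b x y
  obtain ⟨G, hG, hF⟩ := h x
  have := Nat.le_of_ble_eq_true (of_all4 (of_all4 (of_all4 hG (Equiv.swap x 0 y))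
    (Equiv.swap x 0 a)) (Equiv.swap x 0 b))
  rw [e] at this
  simp only [hF, Equiv.swap_apply_left]
  have hn' : (0 : ℝ) < n := by exact_mod_cast hn
  have h' : (n : ℝ) * (G (Equiv.swap x 0 a) (Equiv.swap x 0 y) * G (Equiv.swap x 0 b) 0) ≤
    (if (a = x ∧ b = y) ∨ (a = y ∧ b = x) then (s : ℝ) else r) *
      (G (Equiv.swap x 0 a) 0 * G (Equiv.swap x 0 b) (Equiv.swap x 0 y)) := by
    have h2 := (Nat.cast_le (α := ℝ)).2 this
    push_cast at h2
    refine h2.trans_eq ?_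
    congr 1
    split_ifs with hc <;> simp [hc]
  rw [← mul_le_mul_iff_right₀ hn']
  refine h'.trans_eq ?_
  split_ifs <;> field_simp <;> simp only [Fin.val_zero] <;> ring

theorem crossBound_hexWeight_one (u : Fin 4 → Fin 4) :
    CrossBound (34 / 25) (39 / 25) fun a x : Fin 4 => hexWeight ![a, x, u 0, u 1, u 2, u 3] :=
  crossBound_of_check (n := 25) (r := 34) (s := 39) (by norm_num) fun x =>
    ⟨_, of_all4 (of_all4 (of_all4 (of_all4 crossCheck_one (Equiv.swap x 0 (u 0)))
      (Equiv.swap x 0 (u 1))) (Equiv.swap x 0 (u 2))) (Equiv.swap x 0 (u 3)), fun a y => by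
        rw [← hexWeight_comp_perm (Equiv.swap x 0), hexWeight_eq_hexCount]
        rfl⟩

theorem crossBound_hexWeight_two (u : Fin 4 → Fin 4) :
    CrossBound (61 / 50) (61 / 50) fun a x : Fin 4 => hexWeight ![a, u 0, x, u 1, u 2, u 3] :=
  crossBound_of_check (n := 50) (r := 61) (s := 61) (by norm_num) fun x =>
    ⟨_, of_all4 (of_all4 (of_all4 (of_all4 crossCheck_two (Equiv.swap x 0 (u 0)))
      (Equiv.swap x 0 (u 1))) (Equiv.swap x 0 (u 2))) (Equiv.swap x 0 (u 3)), fun a y => by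
        rw [← hexWeight_comp_perm (Equiv.swap x 0), hexWeight_eq_hexCount]
        rfl⟩

theorem crossBound_hexWeight_three (u : Fin 4 → Fin 4) :
    CrossBound (9 / 8) (9 / 8) fun a x : Fin 4 => hexWeight ![a, u 0, u 1, x, u 2, u 3] :=
  crossBound_of_check (n := 8) (r := 9) (s := 9) (by norm_num) fun x =>
    ⟨_, of_all4 (of_all4 (of_all4 (of_all4 crossCheck_three (Equiv.swap x 0 (u 0)))
      (Equiv.swap x 0 (u 1))) (Equiv.swap x 0 (u 2))) (Equiv.swap x 0 (u 3)), fun a y => by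
        rw [← hexWeight_comp_perm (Equiv.swap x 0), hexWeight_eq_hexCount]
        rfl⟩

/-- A nearest neighbour is the second vertex of one face and the last of another; reversal lets one
check serve both. -/
theorem hexWeight_reverse {q : ℕ} (a b c d e g : Fin q) :
    hexWeight ![a, b, c, d, e, g] = hexWeight ![a, g, e, d, c, b] := by
  rw [← hexWeight_reflect]
  congr 1
  funext k
  fin_cases k <;> rfl

end HexCount


/-! ### Passage from weights to probabilities. -/

section Normalized

variable {q : ℕ} {N N' : Fin q → ℝ}

theorem sum_normalized [Nonempty (Fin q)] (hN : ∀ a, 0 < N a) : ∑ a, N a / ∑ b, N b = 1 := by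
  rw [← Finset.sum_div, div_self]
  exact (Finset.sum_pos (fun a _ => hN a) Finset.univ_nonempty).ne'

/-- Normalising constants cancel in cross ratios, so they are never computed. -/
theorem normalized_cross_le [Nonempty (Fin q)] (hN : ∀ a, 0 < N a) (hN' : ∀ a, 0 < N' a) {r : ℝ}
    {a b : Fin q} (h : N' a * N b ≤ r * (N a * N' b)) :
    (N' a / ∑ c, N' c) * (N b / ∑ c, N c) ≤ r * ((N a / ∑ c, N c) * (N' b / ∑ c, N' c)) := by
  have hZ : 0 < ∑ c, N c := Finset.sum_pos (fun a _ => hN a) Finset.univ_nonempty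
  have hZ' : 0 < ∑ c, N' c := Finset.sum_pos (fun a _ => hN' a) Finset.univ_nonempty
  rw [div_mul_div_comm, div_mul_div_comm, ← mul_div_assoc, mul_comm (∑ c, N' c)]
  exact (div_le_div_iff_of_pos_right (mul_pos hZ hZ')).2 h

theorem varDist_normalized_le [Nonempty (Fin q)] (hN : ∀ a, 0 < N a) (hN' : ∀ a, 0 < N' a)
    {r c : ℝ} (hr : 1 ≤ r) (hcross : ∀ a b, N' a * N b ≤ r * (N a * N' b))
    (hc : (r - 1) / (r + 1) * (1 + c ^ 2) / 2 ≤ c) :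
    varDist (fun a => N a / ∑ b, N b) (fun a => N' a / ∑ b, N' b) ≤ c :=
  varDist_le_of_cross_ratio (sum_normalized hN) (sum_normalized hN')
    (fun a => div_nonneg (hN a).le (Finset.sum_nonneg fun b _ => (hN b).le))
    (fun a => div_nonneg (hN' a).le (Finset.sum_nonneg fun b _ => (hN' b).le)) hr
    (fun a b => normalized_cross_le hN hN' (hcross a b)) hc

theorem varDist_normalized_le_pair (hq : 4 ≤ q) (hN : ∀ a, 0 < N a) (hN' : ∀ a, 0 < N' a)
    (hκ : ∀ a b, N a ≤ 27 / 8 * N b) (hκ' : ∀ a b, N' a ≤ 27 / 8 * N' b) {x y : Fin q}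
    (hxy : x ≠ y) {r s c : ℝ} (hr : 1 ≤ r) (hrs : r ≤ s) (hs : s ≤ 5 / 2)
    (hcross : ∀ a b, N' a * N b ≤
      (if (a = x ∧ b = y) ∨ (a = y ∧ b = x) then s else r) * (N a * N' b))
    (hc : ((s - 1) / (s + 1) - (r - 1) / (r + 1)) / 3 + (r - 1) / (r + 1) * (1 + c ^ 2) / 2 ≤ c) :
    varDist (fun a => N a / ∑ b, N b) (fun a => N' a / ∑ b, N' b) ≤ c := by
  have : Nonempty (Fin q) := ⟨x⟩
  have hle : ∀ {M : Fin q → ℝ}, (∀ a, 0 < M a) → (∀ a b, M a ≤ 27 / 8 * M b) → ∀ a b,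
      M a / ∑ c, M c ≤ 27 / 8 * (M b / ∑ c, M c) := fun hM h a b => by
    rw [← mul_div_assoc]
    exact div_le_div_of_nonneg_right (h a b) (Finset.sum_nonneg fun b _ => (hM b).le)
  refine varDist_le_of_cross_ratio_pair hq (sum_normalized hN) (sum_normalized hN') (hle hN hκ)
    (hle hN' hκ') hxy hr hrs hs (fun a b => normalized_cross_le hN hN' ?_)
    (fun a b h1 h2 => normalized_cross_le hN hN' ?_) hc
  · refine (hcross a b).trans (mul_le_mul_of_nonneg_right ?_ (mul_pos (hN a) (hN' b)).le)
    split_ifs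
    exacts [le_rfl, hrs]
  · have := hcross a b
    rwa [if_neg (not_or.2 ⟨h1, h2⟩)] at this

end Normalized

/-! ### Dobrushin's condition for the hexagonal decimation at four colours. -/

section FourColours

theorem prod_ringFace {q : ℕ} (a : Fin q) (x : Fin 12 → Fin q) :
    ∏ k, hexWeight (ringFace a x k) = hexWeight ![a, x 0, x 1, x 2, x 3, x 4] *
      hexWeight ![a, x 4, x 5, x 6, x 7, x 8] * hexWeight ![a, x 8, x 9, x 10, x 11, x 0] :=
  Fin.prod_univ_three _

theorem prod_ringFace_pos {q : ℕ} (hq : 3 ≤ q) (a : Fin q) (x : Fin 12 → Fin q) :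
    0 < ∏ k, hexWeight (ringFace a x k) :=
  Finset.prod_pos fun _ _ => hexWeight_pos hq _

/-- Here `27/8 = (3/2)^3`, one factor for each of the three faces. -/
theorem prod_ringFace_le (a b : Fin 4) (x : Fin 12 → Fin 4) :
    ∏ k, hexWeight (ringFace a x k) ≤ 27 / 8 * ∏ k, hexWeight (ringFace b x k) := by
  rw [prod_ringFace, prod_ringFace]
  have h0 := hexWeight_le_of_ratio ![x 0, x 1, x 2, x 3, x 4] a b
  have h1 := hexWeight_le_of_ratio ![x 4, x 5, x 6, x 7, x 8] a b
  have h2 := hexWeight_le_of_ratio ![x 8, x 9, x 10, x 11, x 0] a b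
  refine (mul_le_mul (mul_le_mul h0 h1 (hexWeight_nonneg _) (mul_nonneg (by norm_num)
    (hexWeight_nonneg _))) h2 (hexWeight_nonneg _) (mul_nonneg (mul_nonneg (by norm_num)
    (hexWeight_nonneg _)) (mul_nonneg (by norm_num) (hexWeight_nonneg _)))).trans_eq ?_
  simp
  ring

theorem localDep_hexKernel_zero_le :
    localDep (hexKernel (q := 4)) 0 ≤ ENNReal.ofReal (1 / 5) := by
  refine localDep_le fun x x' h => ?_
  by_cases h0 : x 0 = x' 0
  · have : x = x' := funext fun l => by
      by_cases hl : l = 0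
      exacts [hl ▸ h0, h l hl]
    rw [this]
    exact ciSup_le fun A => by simp
  -- The nearest neighbour lies on two of the three faces, so the bounds for one face are squared.
  refine varDist_normalized_le_pair (r := (34 / 25) * (34 / 25)) (s := (39 / 25) * (39 / 25)) le_rfl
    (fun a => prod_ringFace_pos (by norm_num) a x)
    (fun a => prod_ringFace_pos (by norm_num) a x') (fun a b => prod_ringFace_le a b x)
    (fun a b => prod_ringFace_le a b x') h0 (by norm_num) (by norm_num) (by norm_num)
    (fun a b => ?_) (by norm_num)
  have h1 := crossBound_hexWeight_one ![x 1, x 2, x 3, x 4] a b (x 0) (x' 0)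
  have h2 := crossBound_hexWeight_one ![x 11, x 10, x 9, x 8] a b (x 0) (x' 0)
  simp only [Matrix.cons_val_zero, Matrix.cons_val_one, Matrix.cons_val] at h1 h2
  simp only [hexWeight_reverse _ _ (x 11)] at h2
  simp only [prod_ringFace, ← h _ (by decide : (1 : Fin 12) ≠ 0),
    ← h _ (by decide : (2 : Fin 12) ≠ 0), ← h _ (by decide : (3 : Fin 12) ≠ 0),
    ← h _ (by decide : (4 : Fin 12) ≠ 0), ← h _ (by decide : (5 : Fin 12) ≠ 0),
    ← h _ (by decide : (6 : Fin 12) ≠ 0), ← h _ (by decide : (7 : Fin 12) ≠ 0),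
    ← h _ (by decide : (8 : Fin 12) ≠ 0), ← h _ (by decide : (9 : Fin 12) ≠ 0),
    ← h _ (by decide : (10 : Fin 12) ≠ 0), ← h _ (by decide : (11 : Fin 12) ≠ 0)]
  have hw : ∀ t : Fin 6 → Fin 4, 0 ≤ hexWeight t := hexWeight_nonneg
  have hmul := mul_le_mul_of_nonneg_right (mul_le_mul h1 h2 (mul_nonneg (hw _) (hw _))
    (mul_nonneg (by split_ifs <;> norm_num) (mul_nonneg (hw _) (hw _))))
    (mul_nonneg (hw ![a, x 4, x 5, x 6, x 7, x 8]) (hw ![b, x 4, x 5, x 6, x 7, x 8]))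
  refine le_trans (le_of_eq ?_) (hmul.trans_eq ?_)
  · ring
  · split_ifs <;> ring

/-- Positions `1, 2, 3` belong to the first face only, so the factors of the other two faces cancel
in the cross ratio. -/
theorem varDist_hexKernel_le {x x' : Fin 12 → Fin 4} {r c : ℝ} (hr : 1 ≤ r)
    (hx : ∀ l : Fin 12, l = 0 ∨ 4 ≤ l → x l = x' l)
    (hcross : ∀ a b, hexWeight ![a, x' 0, x' 1, x' 2, x' 3, x' 4] *
      hexWeight ![b, x 0, x 1, x 2, x 3, x 4] ≤ r * (hexWeight ![a, x 0, x 1, x 2, x 3, x 4] *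
        hexWeight ![b, x' 0, x' 1, x' 2, x' 3, x' 4]))
    (hc : (r - 1) / (r + 1) * (1 + c ^ 2) / 2 ≤ c) : varDist (hexKernel x) (hexKernel x') ≤ c := by
  refine varDist_normalized_le (fun a => prod_ringFace_pos (by norm_num) a x)
    (fun a => prod_ringFace_pos (by norm_num) a x') hr (fun a b => ?_) hc
  simp only [prod_ringFace, ← hx 0 (by decide), ← hx 4 (by decide), ← hx 5 (by decide),
    ← hx 6 (by decide), ← hx 7 (by decide), ← hx 8 (by decide), ← hx 9 (by decide),
    ← hx 10 (by decide), ← hx 11 (by decide)] at hcross ⊢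
  have hw : ∀ t : Fin 6 → Fin 4, 0 ≤ hexWeight t := hexWeight_nonneg
  have hmul := mul_le_mul_of_nonneg_right (hcross a b) (mul_nonneg
    (mul_nonneg (hw ![a, x 4, x 5, x 6, x 7, x 8]) (hw ![b, x 4, x 5, x 6, x 7, x 8]))
    (mul_nonneg (hw ![a, x 8, x 9, x 10, x 11, x 0]) (hw ![b, x 8, x 9, x 10, x 11, x 0])))
  refine le_trans (le_of_eq ?_) (hmul.trans_eq ?_) <;> ring

theorem localDep_hexKernel_one_le :
    localDep (hexKernel (q := 4)) 1 ≤ ENNReal.ofReal (1 / 20) := by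
  refine localDep_le fun x x' h => varDist_hexKernel_le (r := 61 / 50) (by norm_num)
    (fun l hl => h l fun e => by subst e; revert hl; decide) (fun a b => ?_) (by norm_num)
  have h1 := crossBound_hexWeight_two ![x 0, x 2, x 3, x 4] a b (x 1) (x' 1)
  rw [ite_self] at h1
  rw [← h 0 (by decide), ← h 2 (by decide), ← h 3 (by decide), ← h 4 (by decide)]
  exact h1

theorem localDep_hexKernel_two_le :
    localDep (hexKernel (q := 4)) 2 ≤ ENNReal.ofReal (3 / 100) := by
  refine localDep_le fun x x' h => varDist_hexKernel_le (r := 9 / 8) (by norm_num)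
    (fun l hl => h l fun e => by subst e; revert hl; decide) (fun a b => ?_) (by norm_num)
  have h1 := crossBound_hexWeight_three ![x 0, x 1, x 3, x 4] a b (x 2) (x' 2)
  rw [ite_self] at h1
  rw [← h 0 (by decide), ← h 1 (by decide), ← h 3 (by decide), ← h 4 (by decide)]
  exact h1

theorem dobrushinConstant_hexDecimated_four_lt_one : dobrushinConstant (hexDecimated 4) < 1 := by
  rw [dobrushinConstant_hexDecimated]
  calc _ ≤ 3 * ENNReal.ofReal (1 / 5) + 6 * ENNReal.ofReal (1 / 20) +
      3 * ENNReal.ofReal (3 / 100) := by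
        gcongr
        exacts [localDep_hexKernel_zero_le, localDep_hexKernel_one_le, localDep_hexKernel_two_le]
    -- The three contributions are `3/5`, `3/10` and `9/100`.
    _ = ENNReal.ofReal (99 / 100) := by
        rw [← ENNReal.ofReal_ofNat 3, ← ENNReal.ofReal_ofNat 6, ← ENNReal.ofReal_mul (by norm_num),
          ← ENNReal.ofReal_mul (by norm_num), ← ENNReal.ofReal_mul (by norm_num),
          ← ENNReal.ofReal_add (by norm_num) (by norm_num),
          ← ENNReal.ofReal_add (by norm_num) (by norm_num)]
        norm_num
    _ < 1 := by rw [ENNReal.ofReal_lt_one]; norm_num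

end FourColours


/-! ### The single-site decimation and its Dobrushin constant. -/

section SiteDecimation

theorem remaining_siteCluster_iff {x : HexSite} : (∀ c, x ∉ siteCluster c) ↔ x.2 = false := by
  obtain ⟨p, _ | _⟩ := x <;> simp [siteCluster]

/-- The remaining sites form a triangular lattice. -/
def siteEquiv : Remaining siteCluster ≃ ℤ × ℤ where
  toFun x := x.1.1
  invFun p := ⟨(p, false), remaining_siteCluster_iff.2 rfl⟩
  left_inv x := Subtype.ext (Prod.ext rfl (remaining_siteCluster_iff.1 x.2).symm)
  right_inv _ := rfl

theorem siteEquiv_symm (p : ℤ × ℤ) : (siteEquiv.symm p).1 = (p, false) := rfl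

/-- The sites of an upward triangle. -/
def triSite (p : ℤ × ℤ) : Fin 3 → ℤ × ℤ := ![p, p + (1, 0), p + (0, 1)]

theorem mem_triFace {p x : ℤ × ℤ} : x ∈ triFace p ↔ ∃ k, triSite p k = x := by
  simp [triFace, triSite, Fin.exists_fin_succ, eq_comm]

theorem adj_siteEquiv_symm (c p : ℤ × ℤ) :
    hexLattice.Adj (c, true) (siteEquiv.symm p).1 ↔ p ∈ triFace c := by
  obtain ⟨a, b⟩ := c
  obtain ⟨x, y⟩ := p
  rw [siteEquiv_symm, hexLattice_adj_tf]
  simp [triFace]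
  omega

theorem mem_boundary_siteCluster_iff_adj {c : ℤ × ℤ} {y : Remaining siteCluster} :
    y ∈ boundary hexLattice siteCluster c ↔ hexLattice.Adj (c, true) y.1 := by
  simp [boundary, siteCluster]

theorem mem_boundary_siteCluster {c : ℤ × ℤ} {y : Remaining siteCluster} :
    y ∈ boundary hexLattice siteCluster c ↔ siteEquiv y ∈ triFace c := by
  obtain ⟨p, rfl⟩ := siteEquiv.symm.surjective y
  rw [Equiv.apply_symm_apply, ← adj_siteEquiv_symm, mem_boundary_siteCluster_iff_adj]

theorem image_boundary_siteCluster (c : ℤ × ℤ) :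
    siteEquiv '' boundary hexLattice siteCluster c = (triFace c : Set (ℤ × ℤ)) := by
  ext p
  rw [Equiv.image_eq_preimage_symm, Set.mem_preimage, mem_boundary_siteCluster,
    Equiv.apply_symm_apply, Finset.mem_coe]

theorem nonInteracting_siteCluster : NonInteracting hexLattice siteCluster := by
  intro c c' hne
  refine ⟨by simpa [siteCluster] using hne, ?_⟩
  simp only [siteCluster, Finset.mem_singleton]
  rintro _ rfl _ rfl
  exact hexLattice_not_adj _

/-- The three upward triangles containing a site. -/
def triSiteFace : ℤ × ℤ → Fin 3 → ℤ × ℤ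
  | (a, b) => ![(a, b), (a - 1, b), (a, b - 1)]

theorem mem_triFace_iff_triSiteFace {p c : ℤ × ℤ} : p ∈ triFace c ↔ ∃ k, triSiteFace p k = c := by
  obtain ⟨x, y⟩ := p
  obtain ⟨a, b⟩ := c
  simp [triFace, triSiteFace, Fin.exists_fin_succ]
  omega

theorem triSiteFace_injective (p : ℤ × ℤ) : Function.Injective (triSiteFace p) := by
  obtain ⟨x, y⟩ := p
  intro k l
  fin_cases k <;> fin_cases l <;> simp [triSiteFace] <;> omega

theorem remaining_siteCluster_not_adj (x y : Remaining siteCluster) :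
    ¬ hexLattice.Adj x.1 y.1 := by
  obtain ⟨p, rfl⟩ := siteEquiv.symm.surjective x
  obtain ⟨p', rfl⟩ := siteEquiv.symm.surjective y
  exact hexLattice_not_adj _

theorem isDecimation_siteCluster : IsDecimation hexLattice siteCluster where
  nonInteracting := nonInteracting_siteCluster
  isolated := remaining_siteCluster_not_adj
  finite_nbr := hexLattice_finite_nbr
  finite_touch y := by
    refine (Set.finite_range (triSiteFace (siteEquiv y))).subset fun c hc => ?_
    exact mem_triFace_iff_triSiteFace.1 (mem_boundary_siteCluster.1 hc)

/-- The summed spin may take any colour that does not occur on the boundary. -/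
theorem effectiveWeight_siteCluster {q : ℕ} (c : ℤ × ℤ) (t : Remaining siteCluster → Fin q) :
    effectiveWeight hexLattice siteCluster c t =
      (q : ℝ) - (t '' boundary hexLattice siteCluster c).ncard := by
  classical
  obtain ⟨e, he⟩ : ∃ e : Unit ≃ siteCluster c, ∀ u, (e u).1 = (c, true) :=
    ⟨⟨fun _ => ⟨(c, true), Finset.mem_singleton_self _⟩, fun _ => (), fun _ => rfl, fun x =>
      Subtype.ext (Finset.mem_singleton.1 x.2).symm⟩, fun _ => rfl⟩
  have hs : ∀ s : Unit → Fin q, ((∀ x y, hexLattice.Adj (e x) (e y) → s x ≠ s y) ∧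
      ∀ x (y : Remaining siteCluster), hexLattice.Adj (e x) y → s x ≠ t y) ↔
      s () ∉ t '' boundary hexLattice siteCluster c := by
    intro s
    simp only [he, hexLattice_not_adj, Set.mem_image, mem_boundary_siteCluster_iff_adj]
    constructor
    · rintro ⟨-, h⟩ ⟨y, hy, hys⟩
      exact h () y hy hys.symm
    · exact fun h => ⟨fun _ _ h' => h'.elim, fun _ y hy hys => h ⟨y, hy, hys.symm⟩⟩
  rw [effectiveWeight_reindex e]
  simp only [hs]
  rw [← Equiv.sum_comp (Equiv.funUnique Unit (Fin q)).symm]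
  simp only [Equiv.funUnique_symm_apply, uniqueElim_const]
  rw [Finset.sum_boole, eq_sub_iff_add_eq, ← Nat.cast_add, ← Set.ncard_coe_finset]
  congr 1
  have := Set.ncard_add_ncard_compl (t '' boundary hexLattice siteCluster c)
  rw [Nat.card_eq_fintype_card, Fintype.card_fin, add_comm] at this
  refine Eq.trans ?_ this
  congr 2
  ext a
  simp

/-- The effective weight of an upward triangle. -/
noncomputable def triWeight {q : ℕ} (a b c : Fin q) : ℝ :=
  (q : ℝ) - ({a, b, c} : Finset (Fin q)).card

theorem effectiveWeight_eq_triWeight {q : ℕ} (c : ℤ × ℤ) (t : Remaining siteCluster → Fin q) :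
    effectiveWeight hexLattice siteCluster c t = triWeight (t (siteEquiv.symm c))
      (t (siteEquiv.symm (c + (1, 0)))) (t (siteEquiv.symm (c + (0, 1)))) := by
  rw [effectiveWeight_siteCluster, triWeight, ← Set.ncard_coe_finset]
  congr 3
  have : boundary hexLattice siteCluster c = siteEquiv.symm '' (triFace c : Set (ℤ × ℤ)) := by
    rw [← image_boundary_siteCluster, Equiv.symm_image_image]
  rw [this]
  simp [triFace, Set.image_insert_eq]

theorem triWeight_eq {q : ℕ} (a b c : Fin q) : triWeight a b c =
    if b = c then (if a = b then (q : ℝ) - 1 else q - 2)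
    else (if a = b ∨ a = c then (q : ℝ) - 2 else q - 3) := by
  unfold triWeight
  split_ifs with h1 h2 h2
  · subst h1 h2; simp
  · subst h1; simp [h2]
  · rcases h2 with rfl | rfl
    · simp [h1]
    · rw [Finset.insert_comm, Finset.pair_eq_singleton, Finset.card_pair h1]; norm_num
  · push Not at h2
    rw [Finset.card_insert_of_notMem (by simp [h2]), Finset.card_pair h1]
    norm_num

theorem triWeight_pos {q : ℕ} (hq : 4 ≤ q) (a b c : Fin q) : 0 < triWeight a b c := by
  have : (4 : ℝ) ≤ q := by exact_mod_cast hq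
  rw [triWeight_eq]
  split_ifs <;> linarith

theorem effectiveWeight_siteCluster_pos {q : ℕ} (hq : 4 ≤ q) (c : ℤ × ℤ)
    (t : Remaining siteCluster → Fin q) : 0 < effectiveWeight hexLattice siteCluster c t := by
  rw [effectiveWeight_eq_triWeight]
  exact triWeight_pos hq _ _ _

theorem isSpec_siteDecimated {q : ℕ} (hq : 4 ≤ q) : IsSpec (siteDecimated q) :=
  have : Nonempty (Fin q) := ⟨⟨0, by omega⟩⟩
  isSpec_decimatedWeight isDecimation_siteCluster (effectiveWeight_siteCluster_pos hq)

/-- The six neighbours of a site of the triangular lattice; the sites `2 k`, `2 k + 1` form an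
upward triangle with the central site. -/
def triRing : ℤ × ℤ → Fin 6 → ℤ × ℤ
  | (a, b) => ![(a + 1, b), (a, b + 1), (a - 1, b + 1), (a - 1, b), (a, b - 1), (a + 1, b - 1)]

theorem triRing_injective (p : ℤ × ℤ) : Function.Injective (triRing p) := by
  obtain ⟨x, y⟩ := p
  intro k l
  fin_cases k <;> fin_cases l <;> simp [triRing] <;> omega

theorem triLattice_adj_iff {x y : ℤ × ℤ} : triLattice.Adj x y ↔ ∃ m, triRing x m = y := by
  obtain ⟨a, b⟩ := x
  obtain ⟨c, d⟩ := y
  simp [triLattice, SimpleGraph.fromRel_adj, triRing, Fin.exists_fin_succ]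
  omega

/-- The weight of the three triangles around a site, as a function of the spins. -/
noncomputable def triProd {q : ℕ} (x : Fin 6 → Fin q) (a : Fin q) : ℝ :=
  triWeight a (x 0) (x 1) * triWeight a (x 2) (x 3) * triWeight a (x 4) (x 5)

/-- The single-site kernel of the single-site decimation, as a function of the six neighbours. -/
noncomputable def triKernel {q : ℕ} (x : Fin 6 → Fin q) (a : Fin q) : ℝ :=
  triProd x a / ∑ b, triProd x b

theorem triWeight_swap {q : ℕ} (a b c : Fin q) : triWeight a b c = triWeight a c b := by
  unfold triWeight
  rw [Finset.pair_comm]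

theorem triWeight_rotate {q : ℕ} (a b c : Fin q) : triWeight a b c = triWeight b c a := by
  unfold triWeight
  rw [Finset.insert_comm, Finset.pair_comm]

theorem siteDecimated_singleton {q : ℕ} (i : Remaining siteCluster)
    (t : Remaining siteCluster → Fin q) (a : Fin q) :
    siteDecimated q {i} (glue t {i} fun _ => a) =
      triProd (t ∘ siteEquiv.symm ∘ triRing (siteEquiv i)) a := by
  classical
  have htouch : touched isDecimation_siteCluster {i} =
      Finset.univ.map ⟨triSiteFace (siteEquiv i), triSiteFace_injective _⟩ := by
    ext c
    simp [mem_touched, mem_boundary_siteCluster, mem_triFace_iff_triSiteFace]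
  obtain ⟨⟨x, y⟩, rfl⟩ := siteEquiv.symm.surjective i
  rw [siteDecimated, decimatedWeight_eq_prod isDecimation_siteCluster, htouch, Finset.prod_map,
    Fin.prod_univ_three]
  simp only [Function.Embedding.coeFn_mk, effectiveWeight_eq_triWeight, Equiv.apply_symm_apply]
  have hi : glue t {siteEquiv.symm (x, y)} (fun _ => a) (siteEquiv.symm (x, y)) = a :=
    glue_apply_mem (Finset.mem_singleton_self _)
  have hn : ∀ p, p ≠ (x, y) → glue t {siteEquiv.symm (x, y)} (fun _ => a) (siteEquiv.symm p) =
      t (siteEquiv.symm p) := fun p hp =>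
    glue_apply_notMem fun h => hp (siteEquiv.symm.injective (Finset.mem_singleton.1 h))
  simp only [triSiteFace, Matrix.cons_val_zero, Matrix.cons_val_one, Matrix.cons_val,
    Prod.mk_add_mk, sub_add_cancel, add_zero, triProd, Function.comp_apply, triRing]
  rw [hi, hn (x + 1, y) (by simp), hn (x, y + 1) (by simp), hn (x - 1, y) (by simp),
    hn (x - 1, y + 1) (by simp), hn (x, y - 1) (by simp), hn (x + 1, y - 1) (by simp),
    triWeight_rotate (t (siteEquiv.symm (x - 1, y))),
    triWeight_rotate (t (siteEquiv.symm (x, y - 1))),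
    triWeight_rotate (t (siteEquiv.symm (x + 1, y - 1)))]

theorem siteKernel_siteDecimated {q : ℕ} (i : Remaining siteCluster)
    (t : Remaining siteCluster → Fin q) : siteKernel (siteDecimated q) i t =
      triKernel (t ∘ (siteEquiv.symm ∘ triRing (siteEquiv i))) := by
  funext a
  rw [siteKernel_eq_div]
  simp only [siteDecimated_singleton, triKernel]

theorem triKernel_congr {q : ℕ} {x x' : Fin 6 → Fin q} (h : ∀ a, triProd x a = triProd x' a) :
    triKernel x = triKernel x' := by
  funext a
  simp only [triKernel, h]

theorem localDep_triKernel_add_two {q : ℕ} (m : Fin 6) :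
    localDep (triKernel (q := q)) (m + 2) = localDep (triKernel (q := q)) m :=
  localDep_perm (Equiv.addRight 2) (fun x => triKernel_congr fun a => by
    simp [triProd]
    ring) m

theorem localDep_triKernel_one {q : ℕ} :
    localDep (triKernel (q := q)) 1 = localDep (triKernel (q := q)) 0 :=
  localDep_perm (Equiv.swap 0 1) (fun x => triKernel_congr fun a => by
    have h : ∀ m : Fin 6, 2 ≤ m → Equiv.swap (0 : Fin 6) 1 m = m := by decide
    simp only [triProd, Function.comp_apply, h 2 (by decide), h 3 (by decide), h 4 (by decide),
      h 5 (by decide), Equiv.swap_apply_left, Equiv.swap_apply_right, triWeight_swap a (x 1)]) 0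

theorem localDep_triKernel {q : ℕ} (m : Fin 6) :
    localDep (triKernel (q := q)) m = localDep (triKernel (q := q)) 0 := by
  have h1 := localDep_triKernel_one (q := q)
  have h2 : localDep (triKernel (q := q)) 2 = localDep (triKernel (q := q)) 0 :=
    localDep_triKernel_add_two 0
  have h3 : localDep (triKernel (q := q)) 3 = localDep (triKernel (q := q)) 0 :=
    (localDep_triKernel_add_two 1).trans h1
  have h4 : localDep (triKernel (q := q)) 4 = localDep (triKernel (q := q)) 0 :=
    (localDep_triKernel_add_two 2).trans h2
  have h5 : localDep (triKernel (q := q)) 5 = localDep (triKernel (q := q)) 0 :=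
    (localDep_triKernel_add_two 3).trans h3
  fin_cases m <;> first | rfl | assumption

variable {q : ℕ} {i j : Remaining siteCluster}

theorem interdependence_siteDecimated_of_adj (h : triLattice.Adj (siteEquiv i) (siteEquiv j)) :
    interdependence (siteDecimated q) i j = localDep (triKernel (q := q)) 0 := by
  obtain ⟨m, hm⟩ := triLattice_adj_iff.1 h
  have hj : j = (siteEquiv.symm ∘ triRing (siteEquiv i)) m := by
    rw [Function.comp_apply, hm, Equiv.symm_apply_apply]
  rw [hj, interdependence_eq_localDep (siteKernel_siteDecimated i)
    (siteEquiv.symm.injective.comp (triRing_injective _)), localDep_triKernel]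

theorem interdependence_siteDecimated_of_not_adj
    (h : ¬ triLattice.Adj (siteEquiv i) (siteEquiv j)) :
    interdependence (siteDecimated q) i j = 0 :=
  interdependence_eq_zero (siteKernel_siteDecimated i) fun m hm =>
    h (triLattice_adj_iff.2 ⟨m, by rw [← hm, Function.comp_apply, Equiv.apply_symm_apply]⟩)

theorem dobrushinConstant_siteDecimated (q : ℕ) :
    dobrushinConstant (siteDecimated q) = 6 * localDep (triKernel (q := q)) 0 := by
  have : Nonempty (Remaining siteCluster) := ⟨siteEquiv.symm (0, 0)⟩
  rw [dobrushinConstant_eq siteKernel_siteDecimated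
    (fun i => siteEquiv.symm.injective.comp (triRing_injective _)) fun i m hm => ?_,
    Finset.sum_congr rfl fun m _ => localDep_triKernel m]
  · simp
  · refine triLattice.irrefl (v := siteEquiv i) (triLattice_adj_iff.2 ⟨m, ?_⟩)
    nth_rw 2 [← hm]
    rw [Function.comp_apply, Equiv.apply_symm_apply]

theorem triWeight_le (hq : 5 ≤ q) (a b x z : Fin q) :
    triWeight a x z ≤ 3 / 2 * triWeight b x z := by
  have : (5 : ℝ) ≤ q := by exact_mod_cast hq
  rw [triWeight_eq, triWeight_eq]
  split_ifs <;> linarith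

/-- For `q ≥ 5` consecutive values among `q - 1`, `q - 2`, `q - 3` have quotients of at most `3/2`.
A case check shows that the square `9/4` is needed at most for the pair `x, y`. -/
theorem crossBound_triWeight (hq : 5 ≤ q) (z : Fin q) :
    CrossBound (3 / 2) (9 / 4) fun a x : Fin q => triWeight a x z := by
  have h5 : (5 : ℝ) ≤ q := by exact_mod_cast hq
  intro a b x y
  simp only [triWeight_eq]
  generalize (q : ℝ) = Q at h5
  by_cases hx : x = z
  · subst hx
    by_cases hy : y = x
    · subst hy
      simp only [if_true]
      split_ifs <;> nlinarith
    · simp only [if_true, if_neg hy]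
      split_ifs <;> first | nlinarith | (exfalso; grind)
  · by_cases hy : y = z
    · subst hy
      simp only [if_true, if_neg hx]
      split_ifs <;> first | nlinarith | (exfalso; grind)
    · simp only [if_neg hx, if_neg hy]
      by_cases hxy : x = y
      · subst hxy
        split_ifs <;> nlinarith
      · split_ifs <;> first | nlinarith | (exfalso; grind)

theorem triProd_pos (hq : 4 ≤ q) (x : Fin 6 → Fin q) (a : Fin q) : 0 < triProd x a :=
  mul_pos (mul_pos (triWeight_pos hq _ _ _) (triWeight_pos hq _ _ _)) (triWeight_pos hq _ _ _)

theorem triProd_le (hq : 5 ≤ q) (x : Fin 6 → Fin q) (a b : Fin q) :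
    triProd x a ≤ 27 / 8 * triProd x b := by
  have h0 : ∀ a b c : Fin q, 0 ≤ triWeight a b c := fun a b c => (triWeight_pos (by omega) _ _ _).le
  refine (mul_le_mul (mul_le_mul (triWeight_le hq a b (x 0) (x 1)) (triWeight_le hq a b (x 2) (x 3))
    (h0 _ _ _) (mul_nonneg (by norm_num) (h0 _ _ _))) (triWeight_le hq a b (x 4) (x 5)) (h0 _ _ _)
    (mul_nonneg (mul_nonneg (by norm_num) (h0 _ _ _)) (mul_nonneg (by norm_num)
    (h0 _ _ _)))).trans_eq ?_
  rw [triProd]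
  ring

/-- A neighbour lies on one upward triangle around the site, so the other two cancel. The bound
`33/200` is just below the required `1/6`. -/
theorem localDep_triKernel_le (hq : 5 ≤ q) :
    localDep (triKernel (q := q)) 0 ≤ ENNReal.ofReal (33 / 200) := by
  refine localDep_le fun x x' h => ?_
  by_cases h0 : x 0 = x' 0
  · have : x = x' := funext fun l => by
      by_cases hl : l = 0
      exacts [hl ▸ h0, h l hl]
    rw [this]
    exact ciSup_le fun A => by simp; norm_num
  refine varDist_normalized_le_pair (r := 3 / 2) (s := 9 / 4) (by omega) (triProd_pos (by omega) x)
    (triProd_pos (by omega) x') (triProd_le hq x) (triProd_le hq x') h0 (by norm_num) (by norm_num)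
    (by norm_num) (fun a b => ?_) (by norm_num)
  have h1 := crossBound_triWeight hq (x 1) a b (x 0) (x' 0)
  simp only [triProd, ← h 1 (by decide), ← h 2 (by decide), ← h 3 (by decide), ← h 4 (by decide),
    ← h 5 (by decide)]
  have hw : ∀ a b c : Fin q, 0 ≤ triWeight a b c := fun a b c => (triWeight_pos (by omega) _ _ _).le
  have hmul := mul_le_mul_of_nonneg_right h1 (mul_nonneg
    (mul_nonneg (hw a (x 2) (x 3)) (hw b (x 2) (x 3)))
    (mul_nonneg (hw a (x 4) (x 5)) (hw b (x 4) (x 5))))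
  refine le_trans (le_of_eq ?_) (hmul.trans_eq ?_) <;> ring

/-- For the chosen spins the colours have weights `8, 4, 2, 1`; the change at position `0` exchanges
the first two. The resulting lower bound for `α` is `6 * 4/15 = 8/5 > 1`. -/
theorem le_localDep_triKernel_four : ENNReal.ofReal (4 / 15) ≤ localDep (triKernel (q := 4)) 0 := by
  have hle := le_localDep (triKernel (q := 4)) (m := 0) (x := ![0, 2, 0, 1, 0, 1])
    (x' := ![1, 2, 0, 1, 0, 1]) (by decide)
  refine le_trans (ENNReal.ofReal_le_ofReal ?_) hle
  refine le_trans ?_ (le_varDist _ _ {0})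
  have h1 : triKernel (q := 4) ![0, 2, 0, 1, 0, 1] 0 = 8 / 15 := by
    simp [triKernel, triProd, triWeight_eq, Fin.sum_univ_four]
    norm_num
  have h2 : triKernel (q := 4) ![1, 2, 0, 1, 0, 1] 0 = 4 / 15 := by
    simp [triKernel, triProd, triWeight_eq, Fin.sum_univ_four]
    norm_num
  rw [Finset.sum_singleton, Finset.sum_singleton, h1, h2]
  norm_num [abs_of_pos]

theorem dobrushinConstant_siteDecimated_lt_one_iff (hq : 4 ≤ q) :
    dobrushinConstant (siteDecimated q) < 1 ↔ 5 ≤ q := by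
  rw [dobrushinConstant_siteDecimated]
  constructor
  · intro h
    by_contra hq'
    obtain rfl : q = 4 := by omega
    have h1 : 6 * ENNReal.ofReal (4 / 15) < 1 :=
      (mul_le_mul_right le_localDep_triKernel_four 6).trans_lt h
    rw [← ENNReal.ofReal_ofNat 6, ← ENNReal.ofReal_mul (by norm_num), ENNReal.ofReal_lt_one] at h1
    norm_num at h1
  · intro h
    refine (mul_le_mul_right (localDep_triKernel_le h) 6).trans_lt ?_
    rw [← ENNReal.ofReal_ofNat 6, ← ENNReal.ofReal_mul (by norm_num), ENNReal.ofReal_lt_one]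
    norm_num

theorem triLattice_connected : triLattice.Connected := by
  have h1 : ∀ a b : ℤ, triLattice.Reachable (a, b) (a + 1, b) := fun a b =>
    (triLattice_adj_iff.2 ⟨0, rfl⟩).reachable
  have h2 : ∀ a b : ℤ, triLattice.Reachable (a, b) (a, b + 1) := fun a b =>
    (triLattice_adj_iff.2 ⟨1, rfl⟩).reachable
  have h3 : ∀ a : ℤ, triLattice.Reachable (0, 0) (a, 0) := by
    intro a
    induction a using Int.induction_on with
    | zero => exact SimpleGraph.Reachable.refl _
    | succ a ih => exact ih.trans (h1 _ _)
    | pred a ih =>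
      refine ih.trans ?_
      have := (h1 (-a - 1) 0).symm
      rwa [sub_add_cancel] at this
  have h4 : ∀ a b : ℤ, triLattice.Reachable (0, 0) (a, b) := by
    intro a b
    induction b using Int.induction_on with
    | zero => exact h3 a
    | succ b ih => exact ih.trans (h2 _ _)
    | pred b ih =>
      refine ih.trans ?_
      have := (h2 a (-b - 1)).symm
      rwa [sub_add_cancel] at this
  exact ⟨fun x y => (h4 x.1 x.2).symm.trans (h4 y.1 y.2)⟩

end SiteDecimation


/-! ### Application of the criteria to the hexagonal lattice. -/

section Assembly

variable {V κ : Type} {q : ℕ} {G : SimpleGraph V} {cl : κ → Finset V}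

theorem uniqueGibbsWithDecay_dist_of_decimation [Countable V] (hD : IsDecimation G cl)
    (hS : IsSpec (pottsWeight (q := q) G)) (hSd : IsSpec (decimatedWeight (q := q) G cl))
    (hα : dobrushinConstant (decimatedWeight (q := q) G cl) < 1)
    (hex : ∃ μ, IsGibbs (pottsWeight (q := q) G) μ) (hG : G.Connected) {D N : ℕ}
    (hDc : ∀ c, ∀ x ∈ cl c, ∀ y ∈ cl c, G.dist x y ≤ D)
    (hI : ∀ i j, interdependence (decimatedWeight (q := q) G cl) i j ≠ 0 →
      ∃ c, i ∈ boundary G cl c ∧ j ∈ boundary G cl c)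
    (hN : ∀ c, (outerBoundary hD c).card ≤ N) :
    UniqueGibbsWithDecay (pottsWeight (q := q) G) G.dist := by
  have hb : ∀ c, ∀ x ∈ cl c, ∀ y ∈ boundary G cl c, G.dist x y.1 ≤ D + 1 := by
    rintro c x hx y ⟨z, hz, hzy⟩
    have h1 := hG.dist_triangle (u := x) (v := z) (w := y.1)
    have h2 := hDc c x hx z hz
    rw [SimpleGraph.dist_eq_one_iff_adj.2 hzy] at h1
    omega
  -- Interacting remaining sites border a common cluster, so their distance is at most its diameter
  -- plus two edges.
  refine uniqueGibbsWithDecay_of_decimation hD hS hSd hα hex (R := D + 2)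
    (fun _ _ _ => hG.dist_triangle) (fun i j h => ?_) (fun c x hx y hy => ?_)
    (fun c x hx y hy => ?_) (fun i x hx => ?_) hN
  · obtain ⟨c, ⟨z, hz, hzi⟩, hj⟩ := hI i j h
    have h1 := hG.dist_triangle (u := i.1) (v := z) (w := j.1)
    have h2 := hb c z hz j hj
    rw [SimpleGraph.dist_eq_one_iff_adj.2 hzi.symm] at h1
    omega
  · exact (hDc c x hx y hy).trans (by omega)
  · exact (hb c x hx y hy).trans (by omega)
  · rcases mem_thicken.1 hx with ⟨_, h⟩ | ⟨c, hc, hxc⟩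
    · rw [← Finset.mem_singleton.1 h, SimpleGraph.dist_self]
      exact Nat.zero_le _
    · obtain ⟨y, hy, hyc⟩ := mem_touched.1 hc
      rw [Finset.mem_singleton.1 hy] at hyc
      rw [SimpleGraph.dist_comm]
      exact (hb c x hxc i hyc).trans (by omega)

theorem card_outerBoundary_le {hD : IsDecimation G cl} {c : κ} {n : ℕ} (s : Fin n → V)
    (hs : ∀ y ∈ boundary G cl c, ∃ k, s k = y.1) : (outerBoundary hD c).card ≤ n := by
  classical
  have h : outerBoundary hD c ⊆ Finset.univ.image s := fun y hy => by
    obtain ⟨_, hyb⟩ := mem_outerBoundary.1 hy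
    obtain ⟨k, hk⟩ := hs _ hyb
    exact Finset.mem_image.2 ⟨k, Finset.mem_univ k, hk⟩
  exact (Finset.card_le_card h).trans (Finset.card_image_le.trans (by simp))

theorem isSpec_pottsWeight_hexLattice (hq : 4 ≤ q) : IsSpec (pottsWeight (q := q) hexLattice) :=
  isSpec_pottsWeight (fun _ _ => hexLattice_adj_iff.1) fun x => by
    have := card_hexNbr_le x
    omega

theorem exists_isGibbs_hexLattice (hq : 4 ≤ q) :
    ∃ μ, IsGibbs (pottsWeight (q := q) hexLattice) μ :=
  exists_isGibbs_pottsWeight (fun _ _ => hexLattice_adj_iff.1) (fun x => by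
    have := card_hexNbr_le x
    omega) (by omega)

theorem isGibbs_map_hexDecimated (hq : 4 ≤ q) {μ : Measure (HexSite → Fin q)}
    (hμ : IsGibbs (pottsWeight hexLattice) μ) :
    IsGibbs (hexDecimated q) (μ.map (restrictRemaining hexCluster)) :=
  isGibbs_map_restrictRemaining isDecimation_hexCluster
    (isSpec_pottsWeight_hexLattice hq).finiteRange hμ

theorem isGibbs_map_siteDecimated (hq : 4 ≤ q) {μ : Measure (HexSite → Fin q)}
    (hμ : IsGibbs (pottsWeight hexLattice) μ) :
    IsGibbs (siteDecimated q) (μ.map (restrictRemaining siteCluster)) :=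
  isGibbs_map_restrictRemaining isDecimation_siteCluster
    (isSpec_pottsWeight_hexLattice hq).finiteRange hμ

theorem uniqueGibbsWithDecay_hexDecimated_four : UniqueGibbsWithDecay (hexDecimated 4)
    fun i j => hexLattice.dist (hexEquiv i) (hexEquiv j) := by
  -- Existence for the decimated system is inherited from the original one through the marginal.
  obtain ⟨μ, hμ⟩ := exists_isGibbs_hexLattice (q := 4) le_rfl
  exact uniqueGibbsWithDecay_of_dobrushin (isSpec_hexDecimated (by norm_num))
    dobrushinConstant_hexDecimated_four_lt_one ⟨_, isGibbs_map_hexDecimated le_rfl hμ⟩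
    (fun _ => SimpleGraph.dist_self) (fun _ _ _ => hexLattice_dist_triangle _ _ _)
    fun _ _ => dist_le_of_interdependence_hexDecimated

theorem uniqueGibbsWithDecay_siteDecimated (hq : 5 ≤ q) : UniqueGibbsWithDecay (siteDecimated q)
    fun i j => triLattice.dist (siteEquiv i) (siteEquiv j) := by
  obtain ⟨μ, hμ⟩ := exists_isGibbs_hexLattice (q := q) (by omega)
  refine uniqueGibbsWithDecay_of_dobrushin (isSpec_siteDecimated (by omega))
    ((dobrushinConstant_siteDecimated_lt_one_iff (by omega)).2 hq)
    ⟨_, isGibbs_map_siteDecimated (by omega) hμ⟩ (fun _ => SimpleGraph.dist_self)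
    (fun _ _ _ => triLattice_connected.dist_triangle) (R := 1) fun i j h => ?_
  by_cases ha : triLattice.Adj (siteEquiv i) (siteEquiv j)
  · exact (SimpleGraph.dist_eq_one_iff_adj.2 ha).le
  · exact absurd (interdependence_siteDecimated_of_not_adj ha) h

theorem hexLattice_dist_le_of_mem_hexFace {p : ℤ × ℤ} {x y : HexSite} (hx : x ∈ hexFace p)
    (hy : y ∈ hexFace p) : hexLattice.dist x y ≤ 3 := by
  by_cases hxy : x = y
  · rw [hxy, SimpleGraph.dist_self]
    exact Nat.zero_le _
  · obtain ⟨m, rfl⟩ := exists_hexRing_of_mem_hexFace hx hy hxy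
    refine (dist_hexRing_le x m).trans ?_
    fin_cases m <;> simp

theorem exists_triFace_of_adj {x y : ℤ × ℤ} (h : triLattice.Adj x y) :
    ∃ p, x ∈ triFace p ∧ y ∈ triFace p := by
  obtain ⟨m, rfl⟩ := triLattice_adj_iff.1 h
  obtain ⟨a, b⟩ := x
  have key : ∀ p, ((a, b) ∈ triFace p ∧ triRing (a, b) m ∈ triFace p) →
      ∃ p, (a, b) ∈ triFace p ∧ triRing (a, b) m ∈ triFace p := fun p hp => ⟨p, hp⟩
  fin_cases m
  · exact key (a, b) (by simp [triFace, triRing])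
  · exact key (a, b) (by simp [triFace, triRing])
  · exact key (a - 1, b) (by simp [triFace, triRing])
  · exact key (a - 1, b) (by simp [triFace, triRing])
  · exact key (a, b - 1) (by simp [triFace, triRing])
  · exact key (a, b - 1) (by simp [triFace, triRing])

theorem uniqueGibbsWithDecay_hexLattice (hq : 4 ≤ q) :
    UniqueGibbsWithDecay (pottsWeight (q := q) hexLattice) hexLattice.dist := by
  have hS := isSpec_pottsWeight_hexLattice hq
  have hex := exists_isGibbs_hexLattice hq
  -- At `q = 4` single-site decimation violates Dobrushin's condition and the hexagonal clusters are
  -- used; for `q ≥ 5` single sites suffice.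
  rcases hq.eq_or_lt with rfl | hq'
  · refine uniqueGibbsWithDecay_dist_of_decimation isDecimation_hexCluster hS
      (isSpec_hexDecimated (by norm_num)) dobrushinConstant_hexDecimated_four_lt_one hex
      hexLattice_connected (D := 3) (N := 6)
      (fun c x hx y hy => hexLattice_dist_le_of_mem_hexFace hx hy) (fun i j h => ?_) fun c => ?_
    · by_contra hp
      refine h (interdependence_hexDecimated_of_not_mem fun ⟨p, hi, hj⟩ => hp ⟨p, ?_⟩)
      exact ⟨mem_boundary_hexCluster_iff.2 hi, mem_boundary_hexCluster_iff.2 hj⟩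
    · refine card_outerBoundary_le (fun k => (hexEquiv.symm (faceSite c k)).1) fun y hy => ?_
      obtain ⟨k, hk⟩ := mem_hexFace.1 (mem_boundary_hexCluster_iff.1 hy)
      exact ⟨k, by rw [hk, Equiv.symm_apply_apply]⟩
  · refine uniqueGibbsWithDecay_dist_of_decimation isDecimation_siteCluster hS
      (isSpec_siteDecimated hq) ((dobrushinConstant_siteDecimated_lt_one_iff hq).2 hq') hex
      hexLattice_connected (D := 0) (N := 3) (fun c x hx y hy => ?_) (fun i j h => ?_) fun c => ?_
    · rw [Finset.mem_singleton.1 hx, Finset.mem_singleton.1 hy, SimpleGraph.dist_self]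
    · by_contra hp
      refine h (interdependence_siteDecimated_of_not_adj fun ha => hp ?_)
      obtain ⟨p, hi, hj⟩ := exists_triFace_of_adj ha
      exact ⟨p, mem_boundary_siteCluster.2 hi, mem_boundary_siteCluster.2 hj⟩
    · refine card_outerBoundary_le (fun k => (siteEquiv.symm (triSite c k)).1) fun y hy => ?_
      obtain ⟨k, hk⟩ := mem_triFace.1 (mem_boundary_siteCluster.1 hy)
      exact ⟨k, by rw [hk, Equiv.symm_apply_apply]⟩

end Assembly

end PottsAF

theorem mainTheorem4 :
    -- decimation of hexagonal six-spin clusters: the result is a hexagonal lattice,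
    -- whose faces surround the clusters
    (PottsAF.NonInteracting PottsAF.hexLattice PottsAF.hexCluster ∧
      ∃ (e : PottsAF.Remaining PottsAF.hexCluster ≃ PottsAF.HexSite) (k : ℤ × ℤ ≃ ℤ × ℤ),
        (∀ c, e '' PottsAF.boundary PottsAF.hexLattice PottsAF.hexCluster c
          = (PottsAF.hexFace (k c) : Set PottsAF.HexSite)) ∧
        (∀ x y : PottsAF.Remaining PottsAF.hexCluster, ¬ PottsAF.hexLattice.Adj x.1 y.1) ∧
        (∀ q : ℕ, 3 ≤ q →
          (∀ (c : ℤ × ℤ) (t : PottsAF.Remaining PottsAF.hexCluster → Fin q),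
            0 < PottsAF.effectiveWeight PottsAF.hexLattice PottsAF.hexCluster c t) ∧
          ∃ c₁ c₂ c₃ : ℝ≥0∞,
            (∀ i j, PottsAF.hexLattice.dist (e i) (e j) = 1 →
              PottsAF.interdependence (PottsAF.hexDecimated q) i j = c₁) ∧
            (∀ i j, PottsAF.hexLattice.dist (e i) (e j) = 2 →
              PottsAF.interdependence (PottsAF.hexDecimated q) i j = c₂) ∧
            (∀ i j, PottsAF.hexLattice.dist (e i) (e j) = 3 →
              (∃ p, e i ∈ PottsAF.hexFace p ∧ e j ∈ PottsAF.hexFace p) →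
              PottsAF.interdependence (PottsAF.hexDecimated q) i j = c₃) ∧
            (∀ i j, (¬ ∃ p, e i ∈ PottsAF.hexFace p ∧ e j ∈ PottsAF.hexFace p) →
              PottsAF.interdependence (PottsAF.hexDecimated q) i j = 0) ∧
            PottsAF.dobrushinConstant (PottsAF.hexDecimated q) = 3 * c₁ + 6 * c₂ + 3 * c₃) ∧
        PottsAF.dobrushinConstant (PottsAF.hexDecimated 4) < 1 ∧
        PottsAF.UniqueGibbsWithDecay (PottsAF.hexDecimated 4)
          (fun i j => PottsAF.hexLattice.dist (e i) (e j))) ∧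
    -- single-site decimation: the result is a triangular lattice
    (PottsAF.NonInteracting PottsAF.hexLattice PottsAF.siteCluster ∧
      ∃ (e : PottsAF.Remaining PottsAF.siteCluster ≃ ℤ × ℤ) (k : ℤ × ℤ ≃ ℤ × ℤ),
        (∀ c, e '' PottsAF.boundary PottsAF.hexLattice PottsAF.siteCluster c
          = (PottsAF.triFace (k c) : Set (ℤ × ℤ))) ∧
        (∀ x y : PottsAF.Remaining PottsAF.siteCluster, ¬ PottsAF.hexLattice.Adj x.1 y.1) ∧
        (∀ (q : ℕ) (c : ℤ × ℤ) (t : PottsAF.Remaining PottsAF.siteCluster → Fin q),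
          PottsAF.effectiveWeight PottsAF.hexLattice PottsAF.siteCluster c t
            = (q : ℝ) -
              (t '' PottsAF.boundary PottsAF.hexLattice PottsAF.siteCluster c).ncard) ∧
        (∀ q : ℕ, 4 ≤ q →
          ∃ c : ℝ≥0∞,
            (∀ i j, PottsAF.triLattice.Adj (e i) (e j) →
              PottsAF.interdependence (PottsAF.siteDecimated q) i j = c) ∧
            (∀ i j, i ≠ j → ¬ PottsAF.triLattice.Adj (e i) (e j) →
              PottsAF.interdependence (PottsAF.siteDecimated q) i j = 0) ∧
            PottsAF.dobrushinConstant (PottsAF.siteDecimated q) = 6 * c) ∧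
        (∀ q : ℕ, 4 ≤ q →
          (PottsAF.dobrushinConstant (PottsAF.siteDecimated q) < 1 ↔ 5 ≤ q)) ∧
        (∀ q : ℕ, 5 ≤ q →
          PottsAF.UniqueGibbsWithDecay (PottsAF.siteDecimated q)
            (fun i j => PottsAF.triLattice.dist (e i) (e j)))) ∧
    -- for `q ≥ 4`: the decimated systems are the marginals of the original one, which has
    -- a unique Gibbs measure with exponential decay of correlations
    (∀ q : ℕ, 4 ≤ q →
      (∀ μ : MeasureTheory.Measure (PottsAF.HexSite → Fin q),
        PottsAF.IsGibbs (PottsAF.pottsWeight PottsAF.hexLattice) μ →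
          PottsAF.IsGibbs (PottsAF.hexDecimated q)
            (μ.map (PottsAF.restrictRemaining PottsAF.hexCluster)) ∧
          PottsAF.IsGibbs (PottsAF.siteDecimated q)
            (μ.map (PottsAF.restrictRemaining PottsAF.siteCluster))) ∧
      PottsAF.UniqueGibbsWithDecay (q := q) (PottsAF.pottsWeight PottsAF.hexLattice)
        PottsAF.hexLattice.dist) := by
  refine ⟨⟨PottsAF.nonInteracting_hexCluster, PottsAF.hexEquiv, Equiv.refl _,
    PottsAF.image_boundary_hexCluster, PottsAF.isDecimation_hexCluster.isolated,
    fun q hq => ⟨PottsAF.effectiveWeight_hexCluster_pos hq, _, _, _,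
      fun _ _ => PottsAF.interdependence_hexDecimated_of_dist_one,
      fun _ _ => PottsAF.interdependence_hexDecimated_of_dist_two,
      fun _ _ => PottsAF.interdependence_hexDecimated_of_dist_three,
      fun _ _ => PottsAF.interdependence_hexDecimated_of_not_mem,
      PottsAF.dobrushinConstant_hexDecimated q⟩,
    PottsAF.dobrushinConstant_hexDecimated_four_lt_one,
    PottsAF.uniqueGibbsWithDecay_hexDecimated_four⟩,
    ⟨PottsAF.nonInteracting_siteCluster, PottsAF.siteEquiv, Equiv.refl _,
      PottsAF.image_boundary_siteCluster, PottsAF.remaining_siteCluster_not_adj,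
      fun q => PottsAF.effectiveWeight_siteCluster,
      fun q _ => ⟨_, fun _ _ => PottsAF.interdependence_siteDecimated_of_adj,
        fun _ _ _ => PottsAF.interdependence_siteDecimated_of_not_adj,
        PottsAF.dobrushinConstant_siteDecimated q⟩,
      fun q => PottsAF.dobrushinConstant_siteDecimated_lt_one_iff,
      fun q => PottsAF.uniqueGibbsWithDecay_siteDecimated⟩,
    fun q hq => ⟨fun μ hμ => ⟨PottsAF.isGibbs_map_hexDecimated hq hμ,
      PottsAF.isGibbs_map_siteDecimated hq hμ⟩, PottsAF.uniqueGibbsWithDecay_hexLattice hq⟩⟩
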